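/- A long framed 4-graph is a finite graph (loops and multiple edges allowed, possibly with additional circle components without vertices) in which exactly two vertices, the two ends, have valency one and all other vertices, the crossings, have valency four, such that at each crossing the four half-edges are split into two pairs of (formally) opposite ones. Its unicursal components are its circle components and the classes of the equivalence relation on the edges generated by declaring two edges equivalent if they contain opposite half-edges at some crossing; the edges incident to the two ends are required to lie in the same component. If there is only one unicursal component, an orientation of the graph is a choice of which end is the initial one (the other one being the final one), and an isomorphism of oriented graphs is a graph isomorphism that respects the framing and takes the initial end to the initial end and the final end to the final end. Such a graph is traversed from the initial to the final end, going from a half-edge to the opposite one at each crossing, so that each crossing is passed exactly twice; two distinct crossings are linked if their two pairs of passages alternate along the traversal (i.e. their chords in the Gauss diagram are linked), and a crossing is odd if it is linked with an odd number of crossings. Oriented long free knots are the equivalence classes of oriented long framed 4-graphs with one unicursal component modulo isomorphism and the three Reidemeister moves and their inverses: (1) if an edge joins two non-opposite half-edges at a crossing, this crossing is deleted, and its opposite half-edges are joined; (2) if $v\ne w$ are crossings joined by two edges which are opposite neither at $v$ nor at $w$ (a bigon), then $v$ and $w$ are deleted, and at each of them the opposite half-edges are joined (the decreasing second Reidemeister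 move); (3) if three edges form a triangle with three distinct crossings as vertices, any two of these edges being non-opposite at their common vertex, then on each of the three strands passing straight through the two ends of one of these edges, the order of the two crossings is interchanged. The move keeps the initial and the final end. A long free knot is invertible if it coincides with the long free knot obtained by reversing the orientation (interchanging the roles of the two ends). **Theorem.** Let $K$ be an oriented long framed 4-graph with one unicursal component such that 1. all crossings of $K$ are odd; 2. no decreasing second Reidemeister move can be applied to $K$; 3. $K$ is not isomorphic, as an oriented graph, to $K$ with the orientation reversed. Then the oriented long free knot represented by $K$ is not invertible. -/

import Mathlib

universe u

/-- The two ends (vertices of valency one) of an oriented long graph: the noncompact component is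
oriented from `start` to `finish`. -/
inductive LongEnd : Type
  | start : LongEnd
  | finish : LongEnd

/-- Interchange of the two ends. -/
def LongEnd.swap : LongEnd → LongEnd
  | .start => .finish
  | .finish => .start

theorem LongEnd.swap_swap (e : LongEnd) : e.swap.swap = e := by cases e <;> rfl

/-- A long framed 4-graph, given by its half-edges. Loops and multiple edges are allowed. Each
crossing carries four half-edges, split by the framing into two pairs of opposite ones; besides,
each of the two ends of the long component carries exactly one half-edge, which is identified with
that end. An edge is a pair of half-edges `{x, edge x}`.

Circle components without vertices are not recorded. Such a circle is a whole unicursal component,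
so a long graph with only one unicursal component (the long one) has none. -/
structure LongFramedGraph : Type (u + 1) where
  /-- The crossings, that is, the vertices of valency four. -/
  Crossing : Type u
  /-- The half-edges at crossings. -/
  HalfEdge : Type u
  finite_crossing : Finite Crossing
  /-- The crossing from which a half-edge emanates. -/
  vert : HalfEdge → Crossing
  valency_four : ∀ c : Crossing, Nat.card {h : HalfEdge // vert h = c} = 4
  /-- The framing: the half-edge opposite to a given one at the same crossing. -/
  opp : HalfEdge → HalfEdge
  opp_opp : ∀ h, opp (opp h) = h
  opp_ne : ∀ h, opp h ≠ h
  vert_opp : ∀ h, vert (opp h) = vert h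
  /-- The other half of the edge containing a given half-edge. -/
  edge : HalfEdge ⊕ LongEnd → HalfEdge ⊕ LongEnd
  edge_edge : ∀ x, edge (edge x) = x
  edge_ne : ∀ x, edge x ≠ x

namespace LongFramedGraph

/-- All half-edges, including the two at the ends of the long component. -/
abbrev Dart (G : LongFramedGraph.{u}) : Type u := G.HalfEdge ⊕ LongEnd

/-- Two half-edges are adjacent along a unicursal component if they form an edge or are opposite
at a crossing. -/
def Adjacent (G : LongFramedGraph.{u}) (x y : G.Dart) : Prop :=
  G.edge x = y ∨ ∃ h : G.HalfEdge, x = Sum.inl h ∧ y = Sum.inl (G.opp h)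

/-- The unicursal components are the classes of the equivalence relation generated by adjacency;
there is only one. -/
def OneComponent (G : LongFramedGraph.{u}) : Prop :=
  ∀ x y : G.Dart, Relation.EqvGen G.Adjacent x y

/-! ### The Gauss diagram and its parity -/

/-- The walk along the long component from `start`, going straight through every crossing:
`walk n` is the half-edge at which the walk arrives by its edge number `n`. Once the walk has
arrived at an end, it stays there. -/
def walk (G : LongFramedGraph.{u}) : ℕ → G.Dart
  | 0 => G.edge (Sum.inr LongEnd.start)
  | n + 1 =>
    match G.walk n with
    | Sum.inl h => G.edge (Sum.inl (G.opp h))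
    | Sum.inr e => Sum.inr e

/-- The walk along the long component passes the crossing `c` at time `n`. In a graph with one
unicursal component each crossing is passed at exactly two times; these are the two ends of its
chord in the Gauss diagram. -/
def PassesAt (G : LongFramedGraph.{u}) (n : ℕ) (c : G.Crossing) : Prop :=
  ∃ h : G.HalfEdge, G.walk n = Sum.inl h ∧ G.vert h = c

/-- The chords of two different crossings are linked: their ends alternate. -/
def Linked (G : LongFramedGraph.{u}) (c d : G.Crossing) : Prop :=
  c ≠ d ∧ ∃ i j k l : ℕ, i < j ∧ j < k ∧ k < l ∧
    ((G.PassesAt i c ∧ G.PassesAt j d ∧ G.PassesAt k c ∧ G.PassesAt l d) ∨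
      (G.PassesAt i d ∧ G.PassesAt j c ∧ G.PassesAt k d ∧ G.PassesAt l c))

/-- A crossing is odd if its chord is linked with an odd number of chords. -/
def IsOddCrossing (G : LongFramedGraph.{u}) (c : G.Crossing) : Prop :=
  Odd (Set.ncard {d : G.Crossing | G.Linked c d})

/-! ### Isomorphisms and orientation reversal -/

/-- Isomorphism of oriented long framed 4-graphs: an isomorphism of graphs that respects the
framing and takes `start` to `start` and `finish` to `finish`. -/
def Isomorphic (G G' : LongFramedGraph.{u}) : Prop :=
  ∃ (f : G.Crossing ≃ G'.Crossing) (g : G.HalfEdge ≃ G'.HalfEdge),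
    (∀ h, G'.vert (g h) = f (G.vert h)) ∧
    (∀ h, G'.opp (g h) = g (G.opp h)) ∧
    (∀ x, G'.edge (Sum.map g id x) = Sum.map g id (G.edge x))

/-- Interchange the two ends, leaving all other half-edges in place. -/
def flipEnds {H : Type u} : H ⊕ LongEnd → H ⊕ LongEnd := Sum.map id LongEnd.swap

theorem flipEnds_flipEnds {H : Type u} (x : H ⊕ LongEnd) : flipEnds (flipEnds x) = x := by
  rcases x with h | e
  · rfl
  · simp [flipEnds, LongEnd.swap_swap]

theorem flipEnds_map {H H' : Type u} (g : H → H') (x : H ⊕ LongEnd) :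
    flipEnds (Sum.map g id x) = Sum.map g id (flipEnds x) := by
  rcases x with h | e <;> rfl

/-- The same framed graph with the orientation reversed: the names of the two ends are
interchanged. -/
def reverse (G : LongFramedGraph.{u}) : LongFramedGraph.{u} where
  Crossing := G.Crossing
  HalfEdge := G.HalfEdge
  finite_crossing := G.finite_crossing
  vert := G.vert
  valency_four := G.valency_four
  opp := G.opp
  opp_opp := G.opp_opp
  opp_ne := G.opp_ne
  vert_opp := G.vert_opp
  edge := fun x => flipEnds (G.edge (flipEnds x))
  edge_edge := fun x => by
    rw [flipEnds_flipEnds, G.edge_edge, flipEnds_flipEnds]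
  edge_ne := fun x hx => G.edge_ne (flipEnds x) (by
    have h := congrArg flipEnds hx
    rwa [flipEnds_flipEnds] at h)

/-! ### Reidemeister moves

The decreasing first and second moves delete the crossings of a loop or of a bigon and join the
free ends in such a way that every strand goes straight on. The increasing moves are their
inverses. -/

/-- `Strand S x y`: the path that leaves `x` along its edge and goes straight through crossings
belonging to `S` arrives at `y`. -/
inductive Strand (G : LongFramedGraph.{u}) (S : Set G.Crossing) : G.Dart → G.Dart → Prop
  | single (x : G.Dart) : Strand G S x (G.edge x)
  | pass (x : G.Dart) (h : G.HalfEdge) : Strand G S x (Sum.inl h) → G.vert h ∈ S →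
      Strand G S x (G.edge (Sum.inl (G.opp h)))

/-- `G'` is (isomorphic to) the graph obtained from `G` by deleting the crossings in `S` and
joining, at each of them, the opposite half-edges. -/
def Erases (G : LongFramedGraph.{u}) (S : Set G.Crossing) (G' : LongFramedGraph.{u}) : Prop :=
  ∃ (f : G'.Crossing ↪ G.Crossing) (g : G'.HalfEdge ↪ G.HalfEdge),
    Set.range f = Sᶜ ∧ Set.range g = {h | G.vert h ∉ S} ∧
    (∀ h, G.vert (g h) = f (G'.vert h)) ∧
    (∀ h, G.opp (g h) = g (G'.opp h)) ∧
    (∀ x, G.Strand S (Sum.map g id x) (Sum.map g id (G'.edge x)))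

/-- There is a loop at `v`: an edge joining two non-opposite half-edges at `v`. -/
def LoopAt (G : LongFramedGraph.{u}) (v : G.Crossing) : Prop :=
  ∃ h h' : G.HalfEdge, G.vert h = v ∧ G.vert h' = v ∧ h' ≠ G.opp h ∧
    G.edge (Sum.inl h) = Sum.inl h'

/-- There is a bigon with the vertices `v ≠ w`: two edges joining `v` to `w`, which are
not opposite to each other either at `v` or at `w`. -/
def BigonAt (G : LongFramedGraph.{u}) (v w : G.Crossing) : Prop :=
  v ≠ w ∧ ∃ h k h' k' : G.HalfEdge,
    G.vert h = v ∧ G.vert k = v ∧ h ≠ k ∧ k ≠ G.opp h ∧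
    G.vert h' = w ∧ G.vert k' = w ∧ k' ≠ G.opp h' ∧
    G.edge (Sum.inl h) = Sum.inl h' ∧ G.edge (Sum.inl k) = Sum.inl k'

/-- The first Reidemeister move that removes a loop. -/
def ReidemeisterOne (G G' : LongFramedGraph.{u}) : Prop :=
  ∃ v : G.Crossing, G.LoopAt v ∧ G.Erases {v} G'

/-- The second Reidemeister move that removes a bigon. -/
def ReidemeisterTwo (G G' : LongFramedGraph.{u}) : Prop :=
  ∃ v w : G.Crossing, G.BigonAt v w ∧ G.Erases {v, w} G'

/-- The third Reidemeister move. The edges `a a'`, `b b'`, `c c'` form a triangle with three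
distinct vertices, no two of them being opposite at a vertex. Each of the three strands
containing these edges passes two vertices of the triangle (the edge `a a'` lies on the strand
`opp a, a, a', opp a'`); after the move it passes the same two crossings in the other order, and
nothing else changes. -/
def ReidemeisterThree (G G' : LongFramedGraph.{u}) : Prop :=
  ∃ a a' b b' c c' : G.HalfEdge,
    (G.edge (Sum.inl a) = Sum.inl a' ∧ G.edge (Sum.inl b) = Sum.inl b' ∧
      G.edge (Sum.inl c) = Sum.inl c') ∧
    (G.vert a' = G.vert b ∧ G.vert b' = G.vert c ∧ G.vert c' = G.vert a) ∧
    (G.vert a ≠ G.vert b ∧ G.vert b ≠ G.vert c ∧ G.vert c ≠ G.vert a) ∧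
    (b ≠ G.opp a' ∧ c ≠ G.opp b' ∧ a ≠ G.opp c') ∧
    ∃ (f : G.Crossing ≃ G'.Crossing) (g : G.HalfEdge ≃ G'.HalfEdge),
      (∀ h, G'.opp (g h) = g (G.opp h)) ∧
      (∀ x, G'.edge (Sum.map g id x) = Sum.map g id (G.edge x)) ∧
      (∀ h k, h ∈ ({a, a', b, b', c, c'} : Set G.HalfEdge) →
        G.edge (Sum.inl h) = Sum.inl k → G'.vert (g h) = f (G.vert k)) ∧
      (∀ h, h ∉ ({a, a', b, b', c, c'} : Set G.HalfEdge) →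
        G.opp h ∉ ({a, a', b, b', c, c'} : Set G.HalfEdge) → G'.vert (g h) = f (G.vert h))

/-- Two graphs are isomorphic or differ by one Reidemeister move (the inverse moves are
accounted for by the generated equivalence relation below). -/
def Move (G G' : LongFramedGraph.{u}) : Prop :=
  Isomorphic G G' ∨ ReidemeisterOne G G' ∨ ReidemeisterTwo G G' ∨ ReidemeisterThree G G'

/-- No decreasing second Reidemeister move can be applied. -/
def NoDecreasingSecondMove (G : LongFramedGraph.{u}) : Prop :=
  ∀ v w : G.Crossing, ¬ G.BigonAt v w

/-! ### Reversal is compatible with the moves -/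

theorem reverse_edge_inl (G : LongFramedGraph.{u}) {h k : G.HalfEdge}
    (e : G.edge (Sum.inl h) = Sum.inl k) : G.reverse.edge (Sum.inl h) = Sum.inl k := by
  change flipEnds (G.edge (Sum.inl h)) = _
  rw [e]; rfl

theorem edge_inl_of_reverse (G : LongFramedGraph.{u}) {h k : G.HalfEdge}
    (e : G.reverse.edge (Sum.inl h) = Sum.inl k) : G.edge (Sum.inl h) = Sum.inl k := by
  have e' : flipEnds (G.edge (Sum.inl h)) = Sum.inl k := e
  have := congrArg flipEnds e'
  rwa [flipEnds_flipEnds] at this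

theorem reverse_edge_map {G G' : LongFramedGraph.{u}} {g : G.HalfEdge → G'.HalfEdge}
    (hg : ∀ x, G'.edge (Sum.map g id x) = Sum.map g id (G.edge x)) (x : G.Dart) :
    G'.reverse.edge (Sum.map g id x) = Sum.map g id (G.reverse.edge x) := by
  have e : flipEnds (G'.edge (flipEnds (Sum.map g id x))) =
      Sum.map g id (flipEnds (G.edge (flipEnds x))) := by
    rw [flipEnds_map, hg, flipEnds_map]
  exact e

theorem reverse_strand {G : LongFramedGraph.{u}} {S : Set G.Crossing} {x y : G.Dart}
    (h : G.Strand S x y) : G.reverse.Strand S (flipEnds x) (flipEnds y) := by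
  induction h with
  | single =>
    have := Strand.single (G := G.reverse) (S := S) (flipEnds x)
    change G.reverse.Strand S (flipEnds x) (flipEnds (G.edge (flipEnds (flipEnds x)))) at this
    rwa [flipEnds_flipEnds] at this
  | pass h _ hS ih => exact Strand.pass (G := G.reverse) (flipEnds x) h ih hS

theorem reverse_erases {G G' : LongFramedGraph.{u}} {S : Set G.Crossing}
    (h : G.Erases S G') : G.reverse.Erases S G'.reverse := by
  obtain ⟨f, g, h1, h2, h3, h4, h5⟩ := h
  refine ⟨f, g, h1, h2, h3, h4, fun x => ?_⟩
  have e1 : ∀ x : G'.Dart, flipEnds (Sum.map g id (flipEnds x)) = Sum.map g id x := fun x => by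
    rw [flipEnds_map, flipEnds_flipEnds]
  have e2 : ∀ (P : G.Dart → G.Dart → Prop) (a b : G.Dart) (a' b' : G.Dart),
      a = a' → b = b' → P a b → P a' b' := by
    rintro P a b _ _ rfl rfl hP
    exact hP
  exact e2 (fun a b => G.reverse.Strand S a b) _ _ _ _ (e1 x) (flipEnds_map g _)
    (reverse_strand (h5 (flipEnds x)))

theorem reverse_move {G G' : LongFramedGraph.{u}} (h : Move G G') :
    Move G.reverse G'.reverse := by
  rcases h with h | h | h | h
  · obtain ⟨f, g, h1, h2, h3⟩ := h
    exact Or.inl ⟨f, g, h1, h2, reverse_edge_map h3⟩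
  · obtain ⟨v, ⟨h, h', h1, h2, h3, h4⟩, hE⟩ := h
    exact Or.inr (Or.inl ⟨v, ⟨h, h', h1, h2, h3, reverse_edge_inl G h4⟩, reverse_erases hE⟩)
  · obtain ⟨v, w, ⟨hvw, h, k, h', k', h1, h2, h3, h4, h5, h6, h7, h8, h9⟩, hE⟩ := h
    exact Or.inr (Or.inr (Or.inl ⟨v, w, ⟨hvw, h, k, h', k', h1, h2, h3, h4, h5, h6, h7,
      reverse_edge_inl G h8, reverse_edge_inl G h9⟩, reverse_erases hE⟩))
  · obtain ⟨a, a', b, b', c, c', ⟨ha, hb, hc⟩, hv, hn, ho, f, g, h1, h2, h3, h4⟩ := h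
    exact Or.inr (Or.inr (Or.inr ⟨a, a', b, b', c, c', ⟨reverse_edge_inl G ha,
      reverse_edge_inl G hb, reverse_edge_inl G hc⟩, hv, hn, ho, f, g, h1, reverse_edge_map h2,
      fun h k hT e => h3 h k hT (edge_inl_of_reverse G e), h4⟩))

theorem reverse_oneComponent {G : LongFramedGraph.{u}} (h : G.OneComponent) :
    G.reverse.OneComponent := by
  have key : ∀ x y : G.Dart, Relation.EqvGen G.Adjacent x y →
      Relation.EqvGen G.reverse.Adjacent (flipEnds x) (flipEnds y) := by
    intro x y hxy
    induction hxy with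
    | rel x y h =>
      apply Relation.EqvGen.rel
      rcases h with rfl | ⟨k, rfl, rfl⟩
      · left
        change flipEnds (G.edge (flipEnds (flipEnds x))) = _
        rw [flipEnds_flipEnds]
        rfl
      · exact Or.inr ⟨k, rfl, rfl⟩
    | refl x => exact Relation.EqvGen.refl _
    | symm x y _ ih => exact Relation.EqvGen.symm _ _ ih
    | trans x y z _ _ ih1 ih2 => exact Relation.EqvGen.trans _ _ _ ih1 ih2
  intro x y
  have e := key _ _ (h (flipEnds x) (flipEnds y))
  exact flipEnds_flipEnds x ▸ flipEnds_flipEnds y ▸ e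

end LongFramedGraph

/-- An oriented long framed 4-graph with one unicursal component. -/
structure LongKnotGraph : Type (u + 1) extends LongFramedGraph.{u} where
  oneComponent : toLongFramedGraph.OneComponent

namespace LongKnotGraph

/-- The same graph with the orientation reversed. -/
def reverse (K : LongKnotGraph.{u}) : LongKnotGraph.{u} where
  toLongFramedGraph := K.toLongFramedGraph.reverse
  oneComponent := LongFramedGraph.reverse_oneComponent K.oneComponent

/-- Isomorphism or a single Reidemeister move. -/
def Move (K K' : LongKnotGraph.{u}) : Prop :=
  LongFramedGraph.Move K.toLongFramedGraph K'.toLongFramedGraph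

end LongKnotGraph

/-- Oriented long free knots: oriented long framed 4-graphs with one unicursal component modulo
the equivalence relation generated by isomorphisms and the three Reidemeister moves. -/
def LongFreeKnot : Type (u + 1) := Quot LongKnotGraph.Move.{u}

namespace LongFreeKnot

/-- The long free knot represented by a graph. -/
def mk (K : LongKnotGraph.{u}) : LongFreeKnot.{u} := Quot.mk _ K

/-- The long free knot with the orientation reversed. -/
def reverse : LongFreeKnot.{u} → LongFreeKnot.{u} :=
  Quot.map LongKnotGraph.reverse fun _ _ h => LongFramedGraph.reverse_move h

/-- A long free knot is invertible if it coincides with its reverse. -/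
def Invertible (κ : LongFreeKnot.{u}) : Prop := κ.reverse = κ

end LongFreeKnot

/-!
The proof uses a bracket: a count modulo 2 of states, in which only the even crossings are
smoothed. For an odd graph nothing is smoothed, so the bracket sees the graph itself.

*Parity.* A parity of a graph (`IsParity`) is a two-colouring of the half-edges that changes along
each edge and is constant on opposite half-edges. In a graph with one component it exists
(`OneComponent.exists_parity`: number the edges along the walk) and is unique up to exchanging the
colours. A crossing is called even if its two strands have different colours. For the crossings of
the Gauss diagram this is the opposite of being linked with an odd number of chords
(`OneComponent.notMem_evenCrossings`; one implication suffices), but the colouring is easier to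
follow through the moves: a loop is even, the two crossings of a bigon have the same parity, the
number of even crossings of a triangle is odd, and all other parities are unaffected.

*Bracket.* Let `Φ` be a property of graphs that is invariant under isomorphisms and second
Reidemeister moves. Each even crossing can be smoothed in two ways, by joining its half-edges into
two pairs other than the opposite ones. `bracket Φ G` is the number modulo 2 of the ways of
smoothing all even crossings for which the result has one component and satisfies `Φ`. It is
invariant under all moves (`bracket_move`). For the first move (`stateSum_moveOne`) and for even
bigons (`stateSum_moveTwo_smoothed`) the superfluous states either contain a circle or cancel; odd
bigons disappear because `Φ` is invariant under second moves. For a triangle with three even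
crossings, the eight states before and after the move are compared
(`stateSum_moveThree_smoothed`). If just one crossing is even, one of its smoothings turns the
other two crossings into a bigon, and the other one makes the third move a mere renaming
(`stateSum_moveThree_one`).

*States.* A state of `G` is the same graph with another pairing of opposite half-edges
(`Framing`, `refit`). Smoothed crossings are then erased in the same way as in the decreasing moves,
so that comparing two states amounts to comparing runs through a set `S` of crossings (`Run`,
`stateSum_compare`, `stateSum_transfer`).

*Conclusion.* The decreasing second moves are confluent (`ReidemeisterTwo.confluent`). Hence for an
irreducible graph `K` the property `ReducesTo K`, to become isomorphic to `K` by decreasing second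
moves, is invariant under second moves (`secondMoveInvariant_reducesTo`). If all crossings of `K`
are odd, then `bracket (ReducesTo K)` is 1 on `K`. The reversed graph is irreducible too and has no
even crossings, and it is not isomorphic to `K`, so the bracket is 0 on it
(`bracket_of_evenCrossings_eq_empty`).
-/

namespace LongFramedGraph

/-! ### Half-edges at a crossing -/

instance finite_longEnd : Finite LongEnd :=
  Finite.of_injective (fun e : LongEnd => match e with | .start => true | .finish => false)
    (by intro a b; cases a <;> cases b <;> simp)

instance finite_halfEdge (G : LongFramedGraph.{u}) : Finite G.HalfEdge := by
  have := G.finite_crossing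
  have h : ∀ c, Finite {h : G.HalfEdge // G.vert h = c} := fun c =>
    Nat.finite_of_card_ne_zero (by rw [G.valency_four c]; norm_num)
  exact Finite.of_equiv _ (Equiv.sigmaFiberEquiv G.vert)

theorem opp_injective (G : LongFramedGraph.{u}) : Function.Injective G.opp :=
  Function.Involutive.injective G.opp_opp

theorem edge_injective (G : LongFramedGraph.{u}) : Function.Injective G.edge :=
  Function.Involutive.injective G.edge_edge

/-- Two non-opposite half-edges at a crossing and their opposites exhaust the crossing. -/
theorem eq_of_vert_eq {G : LongFramedGraph.{u}} {h k x : G.HalfEdge} (hk : G.vert k = G.vert h)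
    (h1 : k ≠ h) (h2 : k ≠ G.opp h) (hx : G.vert x = G.vert h) :
    x = h ∨ x = G.opp h ∨ x = k ∨ x = G.opp k := by
  classical
  have hc : ({h, G.opp h, k, G.opp k} : Set G.HalfEdge).ncard = 4 := by
    have e : ({h, G.opp h, k, G.opp k} : Set G.HalfEdge) =
        (({h, G.opp h, k, G.opp k} : Finset G.HalfEdge) : Set G.HalfEdge) := by simp
    have a1 : G.opp k ≠ h := fun e => h2 (by rw [← e, G.opp_opp])
    have a2 : G.opp k ≠ G.opp h := fun e => h1 (G.opp_injective e)
    rw [e, Set.ncard_coe_finset, Finset.card_insert_of_notMem, Finset.card_insert_of_notMem,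
      Finset.card_insert_of_notMem, Finset.card_singleton]
    · simpa using (G.opp_ne k).symm
    · simp only [Finset.mem_insert, Finset.mem_singleton, not_or]
      exact ⟨h2.symm, a2.symm⟩
    · simp only [Finset.mem_insert, Finset.mem_singleton, not_or]
      exact ⟨(G.opp_ne h).symm, h1.symm, a1.symm⟩
  have hs : ({h, G.opp h, k, G.opp k} : Set G.HalfEdge) ⊆ {y | G.vert y = G.vert h} := by
    rintro y (rfl | rfl | rfl | rfl) <;> simp [G.vert_opp, hk]
  have e := Set.eq_of_subset_of_ncard_le hs
    (by rw [hc]; exact (G.valency_four (G.vert h)).le) (Set.toFinite _)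
  have : x ∈ ({h, G.opp h, k, G.opp k} : Set G.HalfEdge) := by rw [e]; exact hx
  simpa using this

/-! ### Runs through a set of crossings -/

/-- The dart `x` does not belong to a crossing in `S`. -/
def Out (G : LongFramedGraph.{u}) (S : Set G.Crossing) (x : G.Dart) : Prop :=
  ∀ h, x = Sum.inl h → G.vert h ∉ S

/-- One step of a traversal inside `S`: a path arriving at a crossing in `S` goes straight on to
the far end of the next edge. -/
def Step (G : LongFramedGraph.{u}) (S : Set G.Crossing) (x y : G.Dart) : Prop :=
  ∃ h, x = Sum.inl h ∧ G.vert h ∈ S ∧ y = G.edge (Sum.inl (G.opp h))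

/-- A path arriving at `x` and going straight through crossings in `S` arrives at `y`. -/
def Run (G : LongFramedGraph.{u}) (S : Set G.Crossing) : G.Dart → G.Dart → Prop :=
  Relation.ReflTransGen (G.Step S)

/-- No circle runs inside `S`: every path going straight through crossings in `S` leaves `S`. -/
def NoCircle (G : LongFramedGraph.{u}) (S : Set G.Crossing) : Prop :=
  ∀ x, ∃ y, G.Out S y ∧ G.Run S x y

section
variable {G : LongFramedGraph.{u}} {S : Set G.Crossing} {x y z w : G.Dart}

theorem out_inl {h : G.HalfEdge} : G.Out S (Sum.inl h) ↔ G.vert h ∉ S := by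
  simp [Out]

theorem out_inr {e : LongEnd} : G.Out S (Sum.inr e) := by simp [Out]

theorem not_out : ¬ G.Out S x ↔ ∃ h, x = Sum.inl h ∧ G.vert h ∈ S := by
  simp [Out]

theorem run_refl (x : G.Dart) : G.Run S x x := Relation.ReflTransGen.refl

theorem Run.cons {h : G.HalfEdge} (hh : G.vert h ∈ S)
    (r : G.Run S (G.edge (Sum.inl (G.opp h))) y) : G.Run S (Sum.inl h) y :=
  Relation.ReflTransGen.head ⟨h, rfl, hh, rfl⟩ r

theorem Run.mono {U : Set G.Crossing} (hU : S ⊆ U) (r : G.Run S x y) : G.Run U x y := by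
  induction r with
  | refl => exact Relation.ReflTransGen.refl
  | tail _ s ih =>
    obtain ⟨h, e, hh, e'⟩ := s
    exact ih.tail ⟨h, e, hU hh, e'⟩

theorem strand_iff_run : G.Strand S x y ↔ G.Run S (G.edge x) y := by
  constructor
  · intro s
    induction s with
    | single => exact run_refl _
    | pass h _ hh ih => exact Relation.ReflTransGen.tail ih ⟨h, rfl, hh, rfl⟩
  · intro r
    induction r with
    | refl => exact Strand.single _
    | tail _ s ih =>
      obtain ⟨h, rfl, hh, rfl⟩ := s
      exact Strand.pass _ h ih hh

theorem Step.unique (h1 : G.Step S x y) (h2 : G.Step S x z) : y = z := by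
  obtain ⟨h, rfl, _, rfl⟩ := h1
  obtain ⟨k, e, _, rfl⟩ := h2
  cases e
  rfl

theorem Out.not_step (hx : G.Out S x) : ¬ G.Step S x y := by
  rintro ⟨h, rfl, hh, -⟩
  exact hx h rfl hh

theorem Out.eq_of_run (hx : G.Out S x) (r : G.Run S x y) : y = x := by
  rcases Relation.ReflTransGen.cases_head r with h | ⟨z, s, -⟩
  · exact h.symm
  · exact absurd s hx.not_step

/-- Runs are deterministic. -/
theorem Run.continue (hy : G.Out S y) (r : G.Run S x y) (r' : G.Run S x z) : G.Run S z y := by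
  rcases Relation.ReflTransGen.total_of_right_unique (r := G.Step S)
    (fun _ _ _ h1 h2 => Step.unique h1 h2) r r'
    with h | h
  · rw [hy.eq_of_run h]; exact run_refl _
  · exact h

theorem Run.exit_unique (hy : G.Out S y) (hz : G.Out S z) (r : G.Run S x y) (r' : G.Run S x z) :
    y = z :=
  hz.eq_of_run (r.continue hy r')

theorem Step.reverse (s : G.Step S x y) : G.Step S (G.edge y) (G.edge x) := by
  obtain ⟨h, rfl, hh, rfl⟩ := s
  exact ⟨G.opp h, G.edge_edge _, by rwa [G.vert_opp], by rw [G.opp_opp]⟩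

theorem Run.reverse (r : G.Run S x y) : G.Run S (G.edge y) (G.edge x) := by
  induction r with
  | refl => exact run_refl _
  | tail _ s ih => exact Relation.ReflTransGen.head s.reverse ih

/-- If a run never leaves `S`, then every point of it has a predecessor on it: the step is an
injective map of a finite set into itself. -/
theorem exists_pred_of_no_exit (hx : ∀ y, G.Run S x y → ¬ G.Out S y) (r : G.Run S x y) :
    ∃ z, G.Run S x z ∧ G.Step S z y := by
  classical
  have hst : ∀ z, G.Run S x z → ∃ w, G.Step S z w := fun z hz => by
    obtain ⟨h, rfl, hh⟩ := not_out.1 (hx z hz)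
    exact ⟨_, h, rfl, hh, rfl⟩
  let A := {z // G.Run S x z}
  choose σ hσ using hst
  let τ : A → A := fun z => ⟨σ z.1 z.2, Relation.ReflTransGen.tail z.2 (hσ z.1 z.2)⟩
  have hinj : Function.Injective τ := by
    rintro ⟨z, hz⟩ ⟨w, hw⟩ e
    have e' : σ z hz = σ w hw := congrArg Subtype.val e
    have h1 := hσ z hz
    have h2 := hσ w hw
    rw [e'] at h1
    exact Subtype.ext (G.edge_injective (h1.reverse.unique h2.reverse))
  obtain ⟨⟨z, hz⟩, e⟩ := Finite.surjective_of_injective hinj ⟨y, r⟩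
  refine ⟨z, hz, ?_⟩
  have e' : σ z hz = y := congrArg Subtype.val e
  rw [← e']
  exact hσ z hz

/-- A path that starts outside `S` leaves `S` again. Otherwise every dart on it, in particular the
first one, would have a predecessor inside `S`. -/
theorem exists_exit (hx : G.Out S x) : ∃ y, G.Out S y ∧ G.Run S (G.edge x) y := by
  by_contra hcon
  push Not at hcon
  obtain ⟨z, -, hz⟩ := exists_pred_of_no_exit (x := G.edge x) (S := S)
    (fun y r hy => hcon y hy r) (run_refl _)
  have := hz.reverse
  rw [G.edge_edge] at this
  exact hx.not_step this

/-- Runs with exactly `n` steps. -/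
def RunN (G : LongFramedGraph.{u}) (S : Set G.Crossing) : ℕ → G.Dart → G.Dart → Prop
  | 0, x, y => x = y
  | n + 1, x, y => ∃ z, G.Step S x z ∧ RunN G S n z y

theorem RunN.snoc {n : ℕ} (r : G.RunN S n x y) (s : G.Step S y z) : G.RunN S (n + 1) x z := by
  induction n generalizing x with
  | zero => cases r; exact ⟨z, s, rfl⟩
  | succ n ih =>
    obtain ⟨w, sw, r⟩ := r
    exact ⟨w, sw, ih r⟩

theorem RunN.exists_last {n : ℕ} (r : G.RunN S (n + 1) x y) :
    ∃ z, G.RunN S n x z ∧ G.Step S z y := by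
  induction n generalizing x with
  | zero => obtain ⟨z, s, rfl⟩ := r; exact ⟨x, rfl, s⟩
  | succ n ih =>
    obtain ⟨w, sw, r⟩ := r
    obtain ⟨z, r, s⟩ := ih r
    exact ⟨z, ⟨w, sw, r⟩, s⟩

theorem Run.exists_runN (r : G.Run S x y) : ∃ n, G.RunN S n x y := by
  induction r with
  | refl => exact ⟨0, rfl⟩
  | tail _ s ih =>
    obtain ⟨n, r⟩ := ih
    exact ⟨n + 1, r.snoc s⟩

/-- A path never comes back along the edge it started from: such a path would be its own
reverse, and would turn around in the middle of an edge or at a crossing. -/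
theorem not_run_edge (x : G.Dart) : ¬ G.Run S (G.edge x) x := by
  intro r
  obtain ⟨n, r'⟩ := r.exists_runN
  clear r
  induction n using Nat.strong_induction_on generalizing x with
  | _ n ih =>
    match n, r' with
    | 0, r => exact G.edge_ne x r
    | 1, ⟨z, s, e⟩ =>
      have e : z = x := e
      subst e
      obtain ⟨h, e, -, e'⟩ := s
      rw [e', G.edge_edge] at e
      exact G.opp_ne h (Sum.inl_injective e)
    | n + 2, ⟨z, s, r⟩ =>
      obtain ⟨w, r, s'⟩ := RunN.exists_last r
      have e := s.unique s'.reverse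
      subst e
      exact ih n (by omega) w r

/-! ### Connectedness -/

theorem OneComponent.induction (hG : G.OneComponent) (P : G.Dart → Prop)
    (he : ∀ x, P x → P (G.edge x)) (ho : ∀ h, P (Sum.inl h) → P (Sum.inl (G.opp h)))
    (hx : P x) (y : G.Dart) : P y := by
  have key : ∀ x y, Relation.EqvGen G.Adjacent x y → (P x ↔ P y) := by
    intro x y h
    induction h with
    | rel x y h =>
      rcases h with rfl | ⟨h, rfl, rfl⟩
      · exact ⟨he x, fun h => by simpa [G.edge_edge] using he _ h⟩
      · exact ⟨ho h, fun h => by simpa [G.opp_opp] using ho _ h⟩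
    | refl => rfl
    | symm _ _ _ ih => exact ih.symm
    | trans _ _ _ _ _ ih1 ih2 => exact ih1.trans ih2
  exact (key x y (hG x y)).1 hx

theorem eqvGen_edge (x : G.Dart) : Relation.EqvGen G.Adjacent x (G.edge x) :=
  Relation.EqvGen.rel _ _ (Or.inl rfl)

theorem eqvGen_opp (h : G.HalfEdge) :
    Relation.EqvGen G.Adjacent (Sum.inl h) (Sum.inl (G.opp h)) :=
  Relation.EqvGen.rel _ _ (Or.inr ⟨h, rfl, rfl⟩)

theorem Run.eqvGen (r : G.Run S x y) : Relation.EqvGen G.Adjacent x y := by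
  induction r with
  | refl => exact Relation.EqvGen.refl _
  | tail _ s ih =>
    obtain ⟨h, rfl, -, rfl⟩ := s
    exact (ih.trans _ _ _ (eqvGen_opp h)).trans _ _ _ (eqvGen_edge _)

/-- A circle inside `S` would be a component without ends. -/
theorem OneComponent.noCircle (hG : G.OneComponent) (S : Set G.Crossing) : G.NoCircle S := by
  intro x
  by_contra hcon
  push Not at hcon
  have hno : ∀ y, G.Run S x y → ¬ G.Out S y := fun y r hy => hcon y hy r
  -- The darts met by the run, in either direction, form a whole component.
  have := hG.induction (x := x) (fun y => G.Run S x y ∨ G.Run S x (G.edge y)) ?_ ?_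
    (Or.inl (run_refl x)) (Sum.inr LongEnd.start)
  · rcases this with h | h
    · exact hno _ h out_inr
    · obtain ⟨z, hz, s⟩ := exists_pred_of_no_exit hno h
      have := s.reverse
      rw [G.edge_edge] at this
      exact out_inr.not_step this
  · rintro y (h | h)
    · right; rwa [G.edge_edge]
    · left; exact h
  · rintro h (r | r)
    · obtain ⟨k, e, hk⟩ := not_out.1 (hno _ r)
      cases e
      exact Or.inr (Relation.ReflTransGen.tail r ⟨h, rfl, hk, rfl⟩)
    · obtain ⟨z, hz, s⟩ := exists_pred_of_no_exit hno r
      obtain ⟨k, rfl, hk, e⟩ := s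
      have e2 := G.edge_injective e
      cases e2
      left; rwa [G.opp_opp]

end

/-! ### Erasing crossings -/

/-- The relation `Erases` with its maps made explicit. -/
structure ErasesVia (G : LongFramedGraph.{u}) (S : Set G.Crossing) (G' : LongFramedGraph.{u})
    (f : G'.Crossing ↪ G.Crossing) (g : G'.HalfEdge ↪ G.HalfEdge) : Prop where
  range_crossing : Set.range f = Sᶜ
  range_halfEdge : Set.range g = {h | G.vert h ∉ S}
  vert : ∀ h, G.vert (g h) = f (G'.vert h)
  opp : ∀ h, G.opp (g h) = g (G'.opp h)
  run : ∀ x, G.Run S (G.edge (Sum.map g id x)) (Sum.map g id (G'.edge x))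

theorem erases_iff {G G' : LongFramedGraph.{u}} {S : Set G.Crossing} :
    G.Erases S G' ↔ ∃ f g, G.ErasesVia S G' f g := by
  constructor
  · rintro ⟨f, g, h1, h2, h3, h4, h5⟩
    exact ⟨f, g, h1, h2, h3, h4, fun x => strand_iff_run.1 (h5 x)⟩
  · rintro ⟨f, g, h1, h2, h3, h4, h5⟩
    exact ⟨f, g, h1, h2, h3, h4, fun x => strand_iff_run.2 (h5 x)⟩

section
variable {G G' G'' : LongFramedGraph.{u}} {S : Set G.Crossing}
  {f : G'.Crossing ↪ G.Crossing} {g : G'.HalfEdge ↪ G.HalfEdge}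

theorem ErasesVia.notMem (E : G.ErasesVia S G' f g) (c : G'.Crossing) : f c ∉ S := by
  have : f c ∈ Set.range f := ⟨c, rfl⟩
  rw [E.range_crossing] at this
  exact this

theorem ErasesVia.exists_crossing (E : G.ErasesVia S G' f g) {c : G.Crossing} (hc : c ∉ S) :
    ∃ c', f c' = c := by
  have : c ∈ Set.range f := by rw [E.range_crossing]; exact hc
  exact this

theorem ErasesVia.exists_halfEdge (E : G.ErasesVia S G' f g) {h : G.HalfEdge}
    (hh : G.vert h ∉ S) : ∃ h', g h' = h := by
  have : h ∈ Set.range g := by rw [E.range_halfEdge]; exact hh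
  exact this

theorem ErasesVia.out (E : G.ErasesVia S G' f g) (x : G'.Dart) : G.Out S (Sum.map g id x) := by
  rcases x with h | e
  · refine out_inl.2 ?_
    rw [E.vert]
    exact E.notMem _
  · exact out_inr

theorem ErasesVia.exists_dart (E : G.ErasesVia S G' f g) {x : G.Dart} (hx : G.Out S x) :
    ∃ x' : G'.Dart, Sum.map g id x' = x := by
  rcases x with h | e
  · obtain ⟨h', rfl⟩ := E.exists_halfEdge (out_inl.1 hx)
    exact ⟨Sum.inl h', rfl⟩
  · exact ⟨Sum.inr e, rfl⟩

theorem map_injective {H H' : Type u} (g : H ↪ H') :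
    Function.Injective (Sum.map g id : H ⊕ LongEnd → H' ⊕ LongEnd) :=
  Sum.map_injective.2 ⟨g.injective, Function.injective_id⟩

theorem ErasesVia.edge_eq (E : G.ErasesVia S G' f g) {x y : G'.Dart}
    (r : G.Run S (G.edge (Sum.map g id x)) (Sum.map g id y)) : G'.edge x = y :=
  map_injective g ((E.run x).exit_unique (E.out _) (E.out _) r)

/-- If there is only one component, this remains so after erasing crossings. -/
theorem OneComponent.of_erasesVia (E : G.ErasesVia S G' f g) (hG : G.OneComponent) :
    G'.OneComponent := by
  have hn := hG.noCircle S
  have key : ∀ (x0 x : G'.Dart), Relation.EqvGen G'.Adjacent x0 x := by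
    intro x0 x
    -- `P z`: the path arriving at `z` leaves `S` at a dart connected with `x0`.
    let P : G.Dart → Prop := fun z =>
      ∃ y', G.Run S z (Sum.map g id y') ∧ Relation.EqvGen G'.Adjacent x0 y'
    have he : ∀ z, P z → P (G.edge z) := by
      rintro z ⟨y', r, h⟩
      obtain ⟨y2, hy2, r2⟩ := hn (G.edge z)
      obtain ⟨y2, rfl⟩ := E.exists_dart hy2
      have e := E.edge_eq (r.reverse.trans r2)
      exact ⟨y2, r2, h.trans _ _ _ (e ▸ eqvGen_edge y')⟩
    have ho : ∀ h, P (Sum.inl h) → P (Sum.inl (G.opp h)) := by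
      intro h hP
      by_cases hh : G.vert h ∈ S
      · obtain ⟨y', r, h'⟩ := hP
        have s : G.Step S (Sum.inl h) (G.edge (Sum.inl (G.opp h))) := ⟨h, rfl, hh, rfl⟩
        have r' : G.Run S (G.edge (Sum.inl (G.opp h))) (Sum.map g id y') :=
          r.continue (E.out _) (Relation.ReflTransGen.single s)
        have := he _ ⟨y', r', h'⟩
        rwa [G.edge_edge] at this
      · obtain ⟨k, rfl⟩ := E.exists_halfEdge hh
        obtain ⟨y', r, h'⟩ := hP
        have e := (E.out (Sum.inl k)).eq_of_run r
        have e := map_injective g e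
        subst e
        refine ⟨Sum.inl (G'.opp k), ?_, h'.trans _ _ _ (eqvGen_opp k)⟩
        rw [E.opp]
        exact run_refl _
    obtain ⟨y', r, h⟩ := hG.induction P he ho (x := Sum.map g id x0)
      ⟨x0, run_refl _, Relation.EqvGen.refl _⟩ (Sum.map g id x)
    have e := map_injective g ((E.out x).eq_of_run r)
    exact e ▸ h
  exact key

/-- If only one component is left after erasing and no circle has been lost, there was only one
before. -/
theorem OneComponent.of_erased (E : G.ErasesVia S G' f g) (hn : G.NoCircle S)
    (hG : G'.OneComponent) : G.OneComponent := by
  have key : ∀ x y, Relation.EqvGen G'.Adjacent x y →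
      Relation.EqvGen G.Adjacent (Sum.map g id x) (Sum.map g id y) := by
    intro x y h
    induction h with
    | rel x y h =>
      rcases h with rfl | ⟨h, rfl, rfl⟩
      · exact (eqvGen_edge _).trans _ _ _ (E.run x).eqvGen
      · have := eqvGen_opp (G := G) (g h)
        rwa [E.opp] at this
    | refl => exact Relation.EqvGen.refl _
    | symm _ _ _ ih => exact ih.symm
    | trans _ _ _ _ _ ih1 ih2 => exact ih1.trans _ _ _ ih2
  intro x y
  obtain ⟨x1, hx1, rx⟩ := hn x
  obtain ⟨y1, hy1, ry⟩ := hn y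
  obtain ⟨x1, rfl⟩ := E.exists_dart hx1
  obtain ⟨y1, rfl⟩ := E.exists_dart hy1
  exact (rx.eqvGen.trans _ _ _ (key _ _ (hG x1 y1))).trans _ _ _ ry.eqvGen.symm

/-- Erasing crossings in two steps. -/
theorem ErasesVia.trans (E : G.ErasesVia S G' f g) {S' : Set G'.Crossing}
    {f' : G''.Crossing ↪ G'.Crossing} {g' : G''.HalfEdge ↪ G'.HalfEdge}
    (E' : G'.ErasesVia S' G'' f' g') {U : Set G.Crossing} (hU : U = S ∪ f '' S') :
    G.ErasesVia U G'' (f'.trans f) (g'.trans g) := by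
  have hmem : ∀ c, f c ∈ U ↔ c ∈ S' := by
    intro c
    rw [hU, Set.mem_union, f.injective.mem_set_image]
    simp [E.notMem]
  have hsub : S ⊆ U := by rw [hU]; exact Set.subset_union_left
  have hmono : ∀ x y, G.Run S x y → G.Run U x y := fun _ _ r => r.mono hsub
  have hrun : ∀ x y, G'.Run S' x y → G.Run U (Sum.map g id x) (Sum.map g id y) := by
    intro x y r
    induction r with
    | refl => exact run_refl _
    | tail _ s ih =>
      obtain ⟨h, rfl, hh, rfl⟩ := s
      refine ih.trans (Run.cons (h := g h) ?_ ?_)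
      · rw [E.vert]; exact (hmem _).2 hh
      · rw [E.opp]; exact hmono _ _ (E.run (Sum.inl (G'.opp h)))
  refine ⟨?_, ?_, fun h => ?_, fun h => ?_, fun x => ?_⟩
  · ext c
    simp only [Function.Embedding.coe_trans, Set.mem_range, Function.comp_apply, Set.mem_compl_iff]
    constructor
    · rintro ⟨c, rfl⟩
      rw [hmem]
      exact E'.notMem c
    · intro hc
      obtain ⟨c, rfl⟩ := E.exists_crossing (fun h => hc (hsub h))
      rw [hmem] at hc
      obtain ⟨c, rfl⟩ := E'.exists_crossing hc
      exact ⟨c, rfl⟩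
  · ext h
    simp only [Function.Embedding.coe_trans, Set.mem_range, Function.comp_apply, Set.mem_ofPred_eq]
    constructor
    · rintro ⟨h, rfl⟩
      rw [E.vert, hmem, E'.vert]
      exact E'.notMem _
    · intro hh
      obtain ⟨h, rfl⟩ := E.exists_halfEdge (fun h => hh (hsub h))
      rw [E.vert, hmem] at hh
      obtain ⟨h, rfl⟩ := E'.exists_halfEdge hh
      exact ⟨h, rfl⟩
  · simp [E.vert, E'.vert]
  · simp [E.opp, E'.opp]
  · have e : ∀ x : G''.Dart, Sum.map (g'.trans g) id x = Sum.map g id (Sum.map g' id x) := by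
      rintro (h | h) <;> rfl
    rw [e, e]
    exact (hmono _ _ (E.run _)).trans (hrun _ _ (E'.run x))

end

/-- An equivalence between the images of two embeddings with the same range. -/
theorem exists_equiv_of_range_eq {A B C : Type u} (f : A ↪ C) (f' : B ↪ C)
    (h : Set.range f = Set.range f') : ∃ e : A ≃ B, ∀ a, f' (e a) = f a := by
  refine ⟨(Equiv.ofInjective f f.injective).trans
    ((Equiv.setCongr h).trans (Equiv.ofInjective f' f'.injective).symm), fun a => ?_⟩
  have := Equiv.apply_ofInjective_symm f'.injective
    (Equiv.setCongr h (Equiv.ofInjective f f.injective a))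
  simpa using this

/-- The result of erasing is unique up to isomorphism. -/
theorem ErasesVia.isomorphic {G H H' : LongFramedGraph.{u}} {S : Set G.Crossing}
    {f : H.Crossing ↪ G.Crossing} {g : H.HalfEdge ↪ G.HalfEdge}
    {f' : H'.Crossing ↪ G.Crossing} {g' : H'.HalfEdge ↪ G.HalfEdge}
    (E : G.ErasesVia S H f g) (E' : G.ErasesVia S H' f' g') : Isomorphic H H' := by
  obtain ⟨ef, hf⟩ := exists_equiv_of_range_eq f f' (by rw [E.range_crossing, E'.range_crossing])
  obtain ⟨eg, hg⟩ := exists_equiv_of_range_eq g g' (by rw [E.range_halfEdge, E'.range_halfEdge])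
  have hm : ∀ x : H.Dart, Sum.map g' id (Sum.map eg id x) = Sum.map g id x := by
    rintro (h | h)
    · simp [hg]
    · rfl
  refine ⟨ef, eg, fun h => f'.injective ?_, fun h => g'.injective ?_, fun x => E'.edge_eq ?_⟩
  · rw [← E'.vert, hg, hf, E.vert]
  · rw [← E'.opp, hg, hg, E.opp]
  · rw [hm, hm]; exact E.run x

theorem isomorphic_iff {G G' : LongFramedGraph.{u}} : Isomorphic G G' ↔ G.Erases ∅ G' := by
  rw [erases_iff]
  constructor
  · rintro ⟨f, g, h1, h2, h3⟩
    have hg : ∀ x : G'.Dart, Sum.map g id (Sum.map g.symm id x) = x := by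
      rintro (h | h) <;> simp
    have hg' : ∀ x : G.Dart, Sum.map g.symm id (Sum.map g id x) = x := by
      rintro (h | h) <;> simp
    refine ⟨f.symm.toEmbedding, g.symm.toEmbedding, by simp, by simp,
      fun h => ?_, fun h => ?_, fun x => ?_⟩
    · apply f.injective; simp [← h1]
    · apply g.injective; simp [← h2]
    · have := h3 (Sum.map g.symm id x)
      rw [hg] at this
      simp only [Equiv.coe_toEmbedding]
      rw [this, hg']
      exact run_refl _
  · rintro ⟨f, g, E⟩
    let f' := Equiv.ofBijective f ⟨f.injective, fun c => E.exists_crossing (by simp)⟩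
    let g' := Equiv.ofBijective g ⟨g.injective, fun c => E.exists_halfEdge (by simp)⟩
    have hg : ∀ x : G.Dart, Sum.map g id (Sum.map g'.symm id x) = x := by
      rintro (h | h)
      · simp only [Sum.map_inl]; rw [show g (g'.symm h) = h from g'.apply_symm_apply h]
      · rfl
    refine ⟨f'.symm, g'.symm, fun h => ?_, fun h => ?_, fun x => E.edge_eq ?_⟩
    · apply f.injective
      rw [← E.vert, show g (g'.symm h) = h from g'.apply_symm_apply h]
      exact (f'.apply_symm_apply _).symm
    · apply g.injective
      rw [← E.opp, show g (g'.symm h) = h from g'.apply_symm_apply h]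
      exact (g'.apply_symm_apply _).symm
    · rw [hg, hg]
      exact run_refl _

open Classical in
/-- The graph obtained by deleting the crossings in `S` and joining opposite half-edges. -/
noncomputable def erase (G : LongFramedGraph.{u}) (S : Set G.Crossing) : LongFramedGraph.{u} := by
  have hex : ∀ x : {h // G.vert h ∉ S} ⊕ LongEnd, ∃ y : {h // G.vert h ∉ S} ⊕ LongEnd,
      G.Run S (G.edge (Sum.map Subtype.val id x)) (Sum.map Subtype.val id y) := by
    intro x
    have hx : G.Out S (Sum.map Subtype.val id x) := by
      rcases x with ⟨h, hh⟩ | e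
      · exact out_inl.2 hh
      · exact out_inr
    obtain ⟨y, hy, r⟩ := exists_exit hx
    rcases y with h | e
    · exact ⟨Sum.inl ⟨h, out_inl.1 hy⟩, r⟩
    · exact ⟨Sum.inr e, r⟩
  have hout : ∀ x : {h // G.vert h ∉ S} ⊕ LongEnd, G.Out S (Sum.map Subtype.val id x) := by
    rintro (⟨h, hh⟩ | e)
    · exact out_inl.2 hh
    · exact out_inr
  have hinj : Function.Injective
      (Sum.map Subtype.val id : {h // G.vert h ∉ S} ⊕ LongEnd → G.Dart) :=
    Sum.map_injective.2 ⟨Subtype.val_injective, Function.injective_id⟩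
  exact
  { Crossing := {c // c ∉ S}
    HalfEdge := {h // G.vert h ∉ S}
    finite_crossing := by have := G.finite_crossing; infer_instance
    vert := fun h => ⟨G.vert h.1, h.2⟩
    valency_four := fun c => by
      rw [← G.valency_four c.1]
      exact Nat.card_congr
        { toFun := fun h => ⟨h.1.1, congrArg Subtype.val h.2⟩
          invFun := fun h => ⟨⟨h.1, by rw [h.2]; exact c.2⟩, Subtype.ext h.2⟩
          left_inv := fun h => rfl
          right_inv := fun h => rfl }
    opp := fun h => ⟨G.opp h.1, by rw [G.vert_opp]; exact h.2⟩
    opp_opp := fun h => Subtype.ext (G.opp_opp _)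
    opp_ne := fun h e => G.opp_ne h.1 (congrArg Subtype.val e)
    vert_opp := fun h => Subtype.ext (G.vert_opp _)
    edge := fun x => (hex x).choose
    edge_edge := fun x => by
      have h1 := (hex x).choose_spec
      have h2 := (hex (hex x).choose).choose_spec
      have h3 := h1.reverse
      rw [G.edge_edge] at h3
      exact hinj (h2.exit_unique (hout _) (hout _) h3)
    edge_ne := fun x e => by
      have h1 := (hex x).choose_spec
      rw [e] at h1
      exact not_run_edge _ h1 }

theorem erase_erasesVia (G : LongFramedGraph.{u}) (S : Set G.Crossing) :
    ∃ (f : (G.erase S).Crossing ↪ G.Crossing) (g : (G.erase S).HalfEdge ↪ G.HalfEdge),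
      G.ErasesVia S (G.erase S) f g := by
  refine ⟨⟨Subtype.val, Subtype.val_injective⟩, ⟨Subtype.val, Subtype.val_injective⟩,
    ?_, ?_, fun h => rfl, fun h => rfl, fun x => ?_⟩
  · ext c
    exact ⟨fun ⟨y, e⟩ => e ▸ y.2, fun hc => ⟨⟨c, hc⟩, rfl⟩⟩
  · ext c
    exact ⟨fun ⟨y, e⟩ => e ▸ y.2, fun hc => ⟨⟨c, hc⟩, rfl⟩⟩
  · exact Exists.choose_spec (p := fun y : {h // G.vert h ∉ S} ⊕ LongEnd =>
      G.Run S (G.edge (Sum.map Subtype.val id x)) (Sum.map Subtype.val id y)) _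

/-! ### Comparison of runs in two graphs -/

section
variable {G G' H : LongFramedGraph.{u}} {S : Set G.Crossing} {S' : Set G'.Crossing}

/-- Simulation principle: if every checkpoint `z ∈ Z` either leaves `S` at the same place as `ρ z`
leaves `S'`, or leads to a next checkpoint in both graphs, then the exits correspond. -/
theorem Run.simulate {φ ρ : G.Dart → G'.Dart} {Z : Set G.Dart}
    (hZ : ∀ z ∈ Z, (∃ y, G.Out S y ∧ G.Run S z y ∧ G'.Run S' (ρ z) (φ y)) ∨
      ∃ w, G.Step S z w ∧ ∃ z' ∈ Z, G.Run S w z' ∧ G'.Run S' (ρ z) (ρ z'))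
    {y z : G.Dart} (hy : G.Out S y) (hz : z ∈ Z) (r : G.Run S z y) :
    G'.Run S' (ρ z) (φ y) := by
  have key : ∀ w, G.Run S w y → ∀ z ∈ Z, G.Run S w z → G'.Run S' (ρ z) (φ y) := by
    intro w r
    induction r using Relation.ReflTransGen.head_induction_on with
    | refl =>
      intro z hz r'
      have e := hy.eq_of_run r'
      subst e
      rcases hZ z hz with ⟨y', _, r1, r2⟩ | ⟨w, s, -⟩
      · rwa [hy.eq_of_run r1] at r2
      · exact absurd s hy.not_step
    | head s r ih =>
      rename_i w0 w1
      intro z hz r'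
      rcases Relation.ReflTransGen.cases_head r' with e | ⟨w', s', r'⟩
      · subst e
        rcases hZ w0 hz with ⟨y', hy', r1, r2⟩ | ⟨w, s', z', hz', r1, r2⟩
        · rwa [Run.exit_unique hy' hy r1 (Relation.ReflTransGen.head s r)] at r2
        · have e := s.unique s'
          subst e
          exact r2.trans (ih z' hz' r1)
      · have e := s.unique s'
        subst e
        exact ih z hz r'
  exact key z r z hz (run_refl z)

/-- A form of `Run.simulate` for runs that start outside `S`. -/
theorem Run.transfer {φ ρ : G.Dart → G'.Dart} {Z : Set G.Dart}
    (hZ : ∀ z ∈ Z, (∃ y, G.Out S y ∧ G.Run S z y ∧ G'.Run S' (ρ z) (φ y)) ∨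
      ∃ w, G.Step S z w ∧ ∃ z' ∈ Z, G.Run S w z' ∧ G'.Run S' (ρ z) (ρ z'))
    (hstart : ∀ x, G.Out S x → ∃ z ∈ Z, G.Run S (G.edge x) z ∧ G'.Run S' (G'.edge (φ x)) (ρ z))
    {x y : G.Dart} (hx : G.Out S x) (hy : G.Out S y) (r : G.Run S (G.edge x) y) :
    G'.Run S' (G'.edge (φ x)) (φ y) := by
  obtain ⟨z, hz, r1, r2⟩ := hstart x hx
  exact r2.trans (Run.simulate hZ hy hz (r.continue hy r1))

/-- Two erasures have the same result if the half-edges that remain can be matched. -/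
theorem ErasesVia.transfer {f : H.Crossing ↪ G.Crossing} {g : H.HalfEdge ↪ G.HalfEdge}
    (E : G.ErasesVia S H f g) (ψ : G.Crossing ≃ G'.Crossing) (φ : G.HalfEdge ≃ G'.HalfEdge)
    (hψ : ∀ c, ψ c ∈ S' ↔ c ∈ S) (hS : ∀ h, G'.vert (φ h) ∈ S' ↔ G.vert h ∈ S)
    (hv : ∀ h, G.vert h ∉ S → G'.vert (φ h) = ψ (G.vert h))
    (ho : ∀ h, G.vert h ∉ S → G'.opp (φ h) = φ (G.opp h))
    (hr : ∀ x y, G.Out S x → G.Out S y → G.Run S (G.edge x) y →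
      G'.Run S' (G'.edge (Sum.map φ id x)) (Sum.map φ id y)) :
    G'.ErasesVia S' H (f.trans ψ.toEmbedding) (g.trans φ.toEmbedding) := by
  have hg : ∀ h, G.vert (g h) ∉ S := fun h => by rw [E.vert]; exact E.notMem _
  refine ⟨?_, ?_, fun h => ?_, fun h => ?_, fun x => ?_⟩
  · ext c
    obtain ⟨c, rfl⟩ := ψ.surjective c
    rw [Set.mem_compl_iff, hψ]
    constructor
    · rintro ⟨d, e⟩
      rw [← ψ.injective e]
      exact E.notMem d
    · intro hc
      obtain ⟨d, rfl⟩ := E.exists_crossing hc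
      exact ⟨d, rfl⟩
  · ext h
    obtain ⟨h, rfl⟩ := φ.surjective h
    rw [Set.mem_ofPred_eq, hS]
    constructor
    · rintro ⟨d, e⟩
      rw [← φ.injective e]
      exact hg d
    · intro hc
      obtain ⟨d, rfl⟩ := E.exists_halfEdge hc
      exact ⟨d, rfl⟩
  · simp [hv _ (hg h), E.vert]
  · simp [ho _ (hg h), E.opp]
  · have e : ∀ x : H.Dart, Sum.map (g.trans φ.toEmbedding) id x
        = Sum.map φ id (Sum.map g id x) := by rintro (h | h) <;> rfl
    rw [e, e]
    exact hr _ _ (E.out _) (E.out _) (E.run x)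

end

/-! ### Framings and smoothings -/

/-- The incidences and the opposite half-edges of a graph with given sets of crossings and
half-edges; only the edges of the graph are left out. -/
@[ext]
structure Framing (C H : Type u) : Type u where
  /-- The crossing from which a half-edge emanates. -/
  vert : H → C
  valency_four : ∀ c : C, Nat.card {h : H // vert h = c} = 4
  /-- The pairing of the half-edges at each crossing. -/
  opp : H → H
  opp_opp : ∀ h, opp (opp h) = h
  opp_ne : ∀ h, opp h ≠ h
  vert_opp : ∀ h, vert (opp h) = vert h

/-- The graph `G` with its framing replaced by `F`. -/
abbrev refit (G : LongFramedGraph.{u}) (F : Framing G.Crossing G.HalfEdge) :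
    LongFramedGraph.{u} where
  Crossing := G.Crossing
  HalfEdge := G.HalfEdge
  finite_crossing := G.finite_crossing
  vert := F.vert
  valency_four := F.valency_four
  opp := F.opp
  opp_opp := F.opp_opp
  opp_ne := F.opp_ne
  vert_opp := F.vert_opp
  edge := G.edge
  edge_edge := G.edge_edge
  edge_ne := G.edge_ne

/-- The framing of a graph. -/
def framing (G : LongFramedGraph.{u}) : Framing G.Crossing G.HalfEdge where
  vert := G.vert
  valency_four := G.valency_four
  opp := G.opp
  opp_opp := G.opp_opp
  opp_ne := G.opp_ne
  vert_opp := G.vert_opp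

open Classical in
/-- The smoothing of `G` at the crossing of `h` and `k` that joins `h` to `k` and `opp h` to
`opp k`, written as the conjugate of `opp` by the transposition of `opp h` and `k`. -/
noncomputable def smooth (G : LongFramedGraph.{u}) (h k : G.HalfEdge) (hk : G.vert k = G.vert h) :
    Framing G.Crossing G.HalfEdge where
  vert := G.vert
  valency_four := G.valency_four
  opp := fun x => Equiv.swap (G.opp h) k (G.opp (Equiv.swap (G.opp h) k x))
  opp_opp := fun x => by simp [G.opp_opp]
  opp_ne := fun x e => by
    apply G.opp_ne (Equiv.swap (G.opp h) k x)
    apply (Equiv.swap (G.opp h) k).injective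
    rw [e, Equiv.swap_apply_self]
  vert_opp := fun x => by
    have hs : ∀ y, G.vert (Equiv.swap (G.opp h) k y) = G.vert y := fun y => by
      rw [Equiv.swap_apply_def]
      split_ifs with h1 h2
      · rw [h1, hk, G.vert_opp]
      · rw [h2, hk, G.vert_opp]
      · rfl
    rw [hs, G.vert_opp, hs]

section
variable {G : LongFramedGraph.{u}}

theorem smooth_opp_self {h k : G.HalfEdge} (hk : G.vert k = G.vert h) (h1 : k ≠ h) :
    (G.smooth h k hk).opp h = k := by
  classical
  simp only [smooth]
  rw [Equiv.swap_apply_of_ne_of_ne (G.opp_ne h).symm h1.symm, Equiv.swap_apply_left]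

theorem smooth_opp_of_ne {h k x : G.HalfEdge} (hk : G.vert k = G.vert h)
    (hx : G.vert x ≠ G.vert h) : (G.smooth h k hk).opp x = G.opp x := by
  classical
  have hx' : ∀ y, G.vert y = G.vert x → Equiv.swap (G.opp h) k y = y := fun y hy =>
    Equiv.swap_apply_of_ne_of_ne (fun e => hx (by rw [← hy, e, G.vert_opp]))
      (fun e => hx (by rw [← hy, e, hk]))
  simp only [smooth]
  rw [hx' x rfl, hx' _ (G.vert_opp x)]

/-- The framing `F` joins `h` to `k` and the half-edges of `G` opposite to them to each other. -/
def Pairs (G : LongFramedGraph.{u}) (F : Framing G.Crossing G.HalfEdge) (h k : G.HalfEdge) :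
    Prop :=
  F.opp h = k ∧ F.opp (G.opp h) = G.opp k

theorem Pairs.symm {F : Framing G.Crossing G.HalfEdge} {h k : G.HalfEdge} (p : G.Pairs F h k) :
    G.Pairs F k h :=
  ⟨by rw [← p.1, F.opp_opp], by rw [← p.2, F.opp_opp]⟩

/-- If `F` joins two non-opposite half-edges of `G`, it joins their opposites, too. -/
theorem pairs_of_opp_eq {F : Framing G.Crossing G.HalfEdge} (hF : F.vert = G.vert)
    {h k : G.HalfEdge} (hk : G.vert k = G.vert h) (h1 : k ≠ h) (h2 : k ≠ G.opp h)
    (e : F.opp h = k) : G.Pairs F h k := by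
  refine ⟨e, ?_⟩
  have hv : G.vert (F.opp (G.opp h)) = G.vert h := by
    rw [← G.vert_opp h, ← hF, F.vert_opp]
  have e' : F.opp k = h := by rw [← e, F.opp_opp]
  rcases eq_of_vert_eq hk h1 h2 hv with a | a | a | a
  · exact absurd (by rw [← e, ← F.opp_opp (G.opp h), a]) h2
  · exact absurd a (F.opp_ne _)
  · exact absurd (by rw [← F.opp_opp (G.opp h), a, e']) (G.opp_ne h)
  · exact a

end

/-! ### The state sum -/

/-- `F` is a state of `G` on `E`: the crossings in `E` are smoothed in one of the two ways that do
not go straight on, and nothing is changed elsewhere. -/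
def IsState (G : LongFramedGraph.{u}) (E : Set G.Crossing) (F : Framing G.Crossing G.HalfEdge) :
    Prop :=
  F.vert = G.vert ∧ ∀ h, F.opp h = G.opp h ↔ G.vert h ∉ E

/-- `G` has one component and erasing `S` yields a graph with the property `Φ`. The components are
counted before erasing, since a circle all of whose crossings are erased leaves no trace. -/
def IsGood (Φ : LongFramedGraph.{u} → Prop) (G : LongFramedGraph.{u}) (S : Set G.Crossing) :
    Prop :=
  G.OneComponent ∧ ∃ H, G.Erases S H ∧ Φ H

/-- The states of `G` on `E` that have one component and a property `Φ` after erasing `E` and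
`S`. -/
def goodStates (Φ : LongFramedGraph.{u} → Prop) (G : LongFramedGraph.{u}) (E S : Set G.Crossing) :
    Set (Framing G.Crossing G.HalfEdge) :=
  {F | G.IsState E F ∧ IsGood Φ (G.refit F) (E ∪ S : Set G.Crossing)}

/-- The number modulo 2 of good states: the coefficient in the parity bracket of the class of
graphs given by `Φ`. The crossings in `E` are still to be smoothed; those in `S`, smoothed
already, are just erased. -/
noncomputable def stateSum (Φ : LongFramedGraph.{u} → Prop) (G : LongFramedGraph.{u})
    (E S : Set G.Crossing) : ZMod 2 :=
  ((goodStates Φ G E S).ncard : ZMod 2)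

section
variable {Φ : LongFramedGraph.{u} → Prop} {G H : LongFramedGraph.{u}} {E S : Set G.Crossing}

theorem finite_states (G : LongFramedGraph.{u}) :
    {F : Framing G.Crossing G.HalfEdge | F.vert = G.vert}.Finite := by
  refine Set.Finite.of_finite_image (f := Framing.opp) (Set.toFinite _) ?_
  intro F hF F' hF' e
  exact Framing.ext (hF.trans hF'.symm) e

theorem finite_goodStates : (goodStates Φ G E S).Finite :=
  (finite_states G).subset fun _ hF => hF.1.1

/-- The states of the smoothing `F0` at `c` are the states of `G` that agree with it at `c`. -/
theorem isState_of_split {F F0 : Framing G.Crossing G.HalfEdge} {c : G.Crossing} (hc : c ∈ E)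
    {h k : G.HalfEdge} (hh : G.vert h = c) (hk : G.vert k = c) (h1 : k ≠ h) (h2 : k ≠ G.opp h)
    (hF0 : F0.vert = G.vert) (hoff : ∀ x, G.vert x ≠ c → F0.opp x = G.opp x)
    (hp : G.Pairs F0 h k) :
    (G.refit F0).IsState (E \ {c} : Set G.Crossing) F ↔ G.IsState E F ∧ F.opp h = k := by
  have hcase : ∀ x, G.vert x = c → x = h ∨ x = G.opp h ∨ x = k ∨ x = G.opp k := fun x hx =>
    eq_of_vert_eq (hk.trans hh.symm) h1 h2 (hx.trans hh.symm)
  have hne : ∀ x, G.vert x = c → F0.opp x ≠ G.opp x := by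
    intro x hx
    have hq := hp.symm
    rcases hcase x hx with rfl | rfl | rfl | rfl
    · rw [hp.1]; exact h2
    · rw [hp.2]; exact fun e => h2 (G.opp_injective e)
    · rw [hq.1]; exact fun e => h2 (by rw [e, G.opp_opp])
    · rw [hq.2, G.opp_opp]; exact fun e => h2 e.symm
  constructor
  · rintro ⟨hF, hs⟩
    have hF : F.vert = F0.vert := hF
    have hs : ∀ x, F.opp x = F0.opp x ↔ F0.vert x ∉ E \ {c} := hs
    refine ⟨⟨hF.trans hF0, fun x => ?_⟩, ?_⟩
    · by_cases hx : G.vert x = c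
      · have : F.opp x = F0.opp x := by rw [hs, hF0, hx]; simp
        rw [this, hx]
        exact ⟨fun e => absurd e (hne x hx), fun e => absurd hc e⟩
      · rw [← hoff x hx, hs, hF0]
        simp [hx]
    · have : F.opp h = F0.opp h := by rw [hs, hF0, hh]; simp
      rw [this, hp.1]
  · rintro ⟨⟨hF, hs⟩, e⟩
    refine ⟨hF.trans hF0.symm, fun x => ?_⟩
    change F.opp x = F0.opp x ↔ F0.vert x ∉ E \ {c}
    rw [hF0]
    by_cases hx : G.vert x = c
    · have hq := pairs_of_opp_eq hF (hk.trans hh.symm) h1 h2 e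
      have : F.opp x = F0.opp x := by
        rcases hcase x hx with rfl | rfl | rfl | rfl
        · rw [hp.1, hq.1]
        · rw [hp.2, hq.2]
        · rw [hp.symm.1, hq.symm.1]
        · rw [hp.symm.2, hq.symm.2]
      simp [this, hx]
    · rw [hoff x hx, hs]
      simp [hx]

/-- The state sum is the sum over the two smoothings of a crossing. -/
theorem stateSum_split {c : G.Crossing} (hc : c ∈ E) {h k : G.HalfEdge} (hh : G.vert h = c)
    (hk : G.vert k = c) (h1 : k ≠ h) (h2 : k ≠ G.opp h) :
    ∃ F : Bool → Framing G.Crossing G.HalfEdge, (∀ i, (F i).vert = G.vert) ∧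
      (∀ i x, G.vert x ≠ c → (F i).opp x = G.opp x) ∧
      (∀ i, G.Pairs (F i) h (bif i then G.opp k else k)) ∧
      stateSum Φ G E S = stateSum Φ (G.refit (F false)) (E \ {c} : Set G.Crossing)
          (insert c S : Set G.Crossing) +
        stateSum Φ (G.refit (F true)) (E \ {c} : Set G.Crossing)
          (insert c S : Set G.Crossing) := by
  have hkh : G.vert k = G.vert h := hk.trans hh.symm
  have hkh' : G.vert (G.opp k) = G.vert h := by rw [G.vert_opp, hkh]
  have h1' : G.opp k ≠ h := fun e => h2 (by rw [← e, G.opp_opp])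
  have h2' : G.opp k ≠ G.opp h := fun e => h1 (G.opp_injective e)
  set F0 := G.smooth h k hkh with hF0
  set F1 := G.smooth h (G.opp k) hkh' with hF1
  have p0 : G.Pairs F0 h k := pairs_of_opp_eq rfl hkh h1 h2 (smooth_opp_self hkh h1)
  have p1 : G.Pairs F1 h (G.opp k) := pairs_of_opp_eq rfl hkh' h1' h2' (smooth_opp_self hkh' h1')
  have o0 : ∀ x, G.vert x ≠ c → F0.opp x = G.opp x := fun x hx =>
    smooth_opp_of_ne hkh (by rwa [hh])
  have o1 : ∀ x, G.vert x ≠ c → F1.opp x = G.opp x := fun x hx =>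
    smooth_opp_of_ne hkh' (by rwa [hh])
  refine ⟨fun i => bif i then F1 else F0, ?_, ?_, ?_, ?_⟩
  · rintro (_ | _) <;> rfl
  · rintro (_ | _)
    · exact o0
    · exact o1
  · rintro (_ | _)
    · exact p0
    · exact p1
  have eU : (E \ {c} ∪ insert c S : Set G.Crossing) = E ∪ S := by
    ext d
    by_cases hd : d = c
    · subst hd; simp [hc]
    · simp [hd]
  have e : goodStates Φ G E S =
      (goodStates Φ (G.refit F0) (E \ {c} : Set G.Crossing) (insert c S : Set G.Crossing) :
        Set (Framing G.Crossing G.HalfEdge)) ∪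
      goodStates Φ (G.refit F1) (E \ {c} : Set G.Crossing) (insert c S : Set G.Crossing) := by
    ext F
    have a0 := isState_of_split (G := G) (F := F) hc hh hk h1 h2 rfl o0 p0
    have a1 := isState_of_split (G := G) (F := F) hc hh (k := G.opp k)
      (by rw [G.vert_opp, hk]) h1' h2' rfl o1 p1
    have b : G.IsState E F → F.opp h = k ∨ F.opp h = G.opp k := by
      rintro ⟨hF, hs⟩
      have hv : G.vert (F.opp h) = G.vert h := by rw [← hF, F.vert_opp]
      rcases eq_of_vert_eq hkh h1 h2 hv with a | a | a | a
      · exact absurd a (F.opp_ne h)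
      · exact absurd hc (by rw [← hh]; exact (hs h).1 a)
      · exact Or.inl a
      · exact Or.inr a
    change (G.IsState E F ∧ IsGood Φ (G.refit F) (E ∪ S : Set G.Crossing)) ↔
      ((G.refit F0).IsState (E \ {c} : Set G.Crossing) F ∧
        IsGood Φ (G.refit F) (E \ {c} ∪ insert c S : Set G.Crossing)) ∨
      ((G.refit F1).IsState (E \ {c} : Set G.Crossing) F ∧
        IsGood Φ (G.refit F) (E \ {c} ∪ insert c S : Set G.Crossing))
    rw [eU, a0, a1]
    tauto
  have hd : Disjoint
      (goodStates Φ (G.refit F0) (E \ {c} : Set G.Crossing) (insert c S : Set G.Crossing) :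
        Set (Framing G.Crossing G.HalfEdge))
      (goodStates Φ (G.refit F1) (E \ {c} : Set G.Crossing) (insert c S : Set G.Crossing)) := by
    rw [Set.disjoint_left]
    intro F m0 m1
    have a0 := (isState_of_split (G := G) (F := F) hc hh hk h1 h2 rfl o0 p0).1 m0.1
    have a1 := (isState_of_split (G := G) (F := F) hc hh (k := G.opp k)
      (by rw [G.vert_opp, hk]) h1' h2' rfl o1 p1).1 m1.1
    exact G.opp_ne k (a1.2.symm.trans a0.2)
  have := Set.ncard_union_eq hd finite_goodStates finite_goodStates
  unfold stateSum
  rw [e, this, Nat.cast_add]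
  rfl

/-! ### The state sum and erasing -/

theorem step_refit_iff {F : Framing G.Crossing G.HalfEdge} (hF : F.vert = G.vert)
    (ho : ∀ h, G.vert h ∈ S → F.opp h = G.opp h) : (G.refit F).Step S = G.Step S := by
  funext x y
  apply propext
  constructor
  · rintro ⟨h, rfl, hh, rfl⟩
    have hh : F.vert h ∈ S := hh
    rw [hF] at hh
    exact ⟨h, rfl, hh, congrArg (fun z => G.edge (Sum.inl z)) (ho h hh)⟩
  · rintro ⟨h, rfl, hh, rfl⟩
    refine ⟨h, rfl, ?_, congrArg (fun z => G.edge (Sum.inl z)) (ho h hh).symm⟩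
    change F.vert h ∈ S
    rwa [hF]

theorem run_refit_iff {F : Framing G.Crossing G.HalfEdge} (hF : F.vert = G.vert)
    (ho : ∀ h, G.vert h ∈ S → F.opp h = G.opp h) : (G.refit F).Run S = G.Run S := by
  unfold Run
  rw [step_refit_iff hF ho]

theorem noCircle_refit_iff {F : Framing G.Crossing G.HalfEdge} (hF : F.vert = G.vert)
    (ho : ∀ h, G.vert h ∈ S → F.opp h = G.opp h) : (G.refit F).NoCircle S ↔ G.NoCircle S := by
  unfold NoCircle
  rw [run_refit_iff hF ho]
  have : ∀ y : G.Dart, (G.refit F).Out S y ↔ G.Out S y := by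
    intro y
    change (∀ h, y = Sum.inl h → F.vert h ∉ S) ↔ _
    rw [hF]; rfl
  exact forall_congr' fun x => exists_congr fun y => and_congr_left' (this y)

theorem IsState.opp_eq {F : Framing G.Crossing G.HalfEdge} (hF : G.IsState E F)
    (hd : Disjoint E S) (h : G.HalfEdge) (hh : G.vert h ∈ S) : F.opp h = G.opp h :=
  (hF.2 h).2 fun he => Set.disjoint_left.1 hd he hh

/-- A circle inside `S` remains in all states. -/
theorem stateSum_eq_zero (hd : Disjoint E S) (hn : ¬ G.NoCircle S) : stateSum Φ G E S = 0 := by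
  have : goodStates Φ G E S = ∅ := by
    ext F
    simp only [Set.mem_empty_iff_false, iff_false]
    rintro ⟨hF, hone, -⟩
    exact hn ((noCircle_refit_iff hF.1 (hF.opp_eq hd)).1 (hone.noCircle _))
  simp [stateSum, this]

theorem isGood_iff_of_erasesVia (hΦ : ∀ H H', Isomorphic H H' → Φ H → Φ H')
    {f : H.Crossing ↪ G.Crossing} {g : H.HalfEdge ↪ G.HalfEdge} (R : G.ErasesVia S H f g)
    (hn : G.NoCircle S) {U : Set G.Crossing} {U' : Set H.Crossing} (hU : U = S ∪ f '' U') :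
    IsGood Φ G U ↔ IsGood Φ H U' := by
  constructor
  · rintro ⟨h1, K, hK, hΦK⟩
    obtain ⟨f1, g1, R1⟩ := erases_iff.1 hK
    obtain ⟨f2, g2, R2⟩ := erase_erasesVia H U'
    exact ⟨h1.of_erasesVia R, H.erase U', erases_iff.2 ⟨f2, g2, R2⟩,
      hΦ _ _ (R1.isomorphic (R.trans R2 hU)) hΦK⟩
  · rintro ⟨h1, K, hK, hΦK⟩
    obtain ⟨f1, g1, R1⟩ := erases_iff.1 hK
    exact ⟨h1.of_erased R hn, K, erases_iff.2 ⟨_, _, R.trans R1 hU⟩, hΦK⟩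

/-- Crossings in `S` may be erased before the others are smoothed. -/
theorem stateSum_erase (hΦ : ∀ H H', Isomorphic H H' → Φ H → Φ H')
    {f : H.Crossing ↪ G.Crossing} {g : H.HalfEdge ↪ G.HalfEdge} (R : G.ErasesVia S H f g)
    (hn : G.NoCircle S) (hd : Disjoint E S) :
    stateSum Φ G E S = stateSum Φ H (f ⁻¹' E) ∅ := by
  classical
  -- Corresponding states of `G` and `H`.
  let Rel : Framing G.Crossing G.HalfEdge → Framing H.Crossing H.HalfEdge → Prop := fun F F' =>
    F.vert = G.vert ∧ F'.vert = H.vert ∧ (∀ h, F.opp (g h) = g (F'.opp h)) ∧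
      ∀ h, G.vert h ∈ S → F.opp h = G.opp h
  have hU : (E ∪ S : Set G.Crossing) = S ∪ f '' (f ⁻¹' E ∪ ∅) := by
    rw [Set.union_empty, Set.image_preimage_eq_inter_range, R.range_crossing, Set.union_comm]
    congr 1
    rw [eq_comm, Set.inter_eq_left]
    exact Set.subset_compl_iff_disjoint_right.2 hd
  have hmem : ∀ F F', Rel F F' →
      (F ∈ goodStates Φ G E S ↔ F' ∈ goodStates Φ H (f ⁻¹' E) ∅) := by
    rintro F F' ⟨hF, hF', ho, hs⟩
    have hR : (G.refit F).ErasesVia S (H.refit F') f g := by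
      refine ⟨R.range_crossing, ?_, fun h => ?_, ho, fun x => ?_⟩
      · change Set.range g = {h | F.vert h ∉ S}
        rw [hF]; exact R.range_halfEdge
      · change F.vert (g h) = f (F'.vert h)
        rw [hF, hF', R.vert]
      · rw [run_refit_iff hF hs]
        exact R.run x
    have hgood := isGood_iff_of_erasesVia hΦ hR ((noCircle_refit_iff hF hs).2 hn) hU
    refine and_congr ⟨fun h => ⟨hF', fun x => ?_⟩, fun h => ⟨hF, fun x => ?_⟩⟩ hgood
    · rw [← g.injective.eq_iff, ← ho, ← R.opp, h.2, R.vert]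
      rfl
    · by_cases hx : G.vert x ∈ S
      · exact ⟨fun _ he => Set.disjoint_left.1 hd he hx, fun _ => hs x hx⟩
      · obtain ⟨y, rfl⟩ := R.exists_halfEdge hx
        rw [ho, R.opp, g.injective.eq_iff, h.2, R.vert]
        rfl
  have hdown : ∀ F ∈ goodStates Φ G E S, ∃ F', Rel F F' := by
    rintro F ⟨hF, -⟩
    have hlift : ∀ h, ∃ k, g k = F.opp (g h) := fun h => R.exists_halfEdge (by
      rw [← hF.1, F.vert_opp, hF.1, R.vert]; exact R.notMem _)
    choose p hp using hlift
    refine ⟨⟨H.vert, H.valency_four, p, fun h => g.injective ?_, fun h e => ?_,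
      fun h => f.injective ?_⟩, hF.1, rfl, fun h => (hp h).symm, hF.opp_eq hd⟩
    · rw [hp, hp, F.opp_opp]
    · have := hp h
      rw [e] at this
      exact F.opp_ne _ this.symm
    · rw [← R.vert, ← R.vert, hp, ← hF.1, F.vert_opp]
  have hup : ∀ F' ∈ goodStates Φ H (f ⁻¹' E) ∅, ∃ F, Rel F F' := by
    rintro F' ⟨hF', -⟩
    have hlift : ∀ h, ∃ k, (G.vert h ∈ S → k = G.opp h) ∧
        ∀ h', g h' = h → k = g (F'.opp h') := by
      intro h
      by_cases hh : G.vert h ∈ S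
      · refine ⟨G.opp h, fun _ => rfl, ?_⟩
        rintro h' rfl
        rw [R.vert] at hh
        exact absurd hh (R.notMem _)
      · obtain ⟨h', rfl⟩ := R.exists_halfEdge hh
        exact ⟨g (F'.opp h'), fun h => absurd h hh, fun h'' e => by rw [g.injective e]⟩
    choose p hp1 hp2 using hlift
    have hp : ∀ h, p (g h) = g (F'.opp h) := fun h => hp2 _ h rfl
    have hcase : ∀ h, G.vert h ∈ S ∨ ∃ h', g h' = h := fun h =>
      (em (G.vert h ∈ S)).imp_right R.exists_halfEdge
    refine ⟨⟨G.vert, G.valency_four, p, fun h => ?_, fun h => ?_, fun h => ?_⟩, rfl, hF'.1, hp,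
      hp1⟩
    · rcases hcase h with hh | ⟨h, rfl⟩
      · rw [hp1 h hh, hp1 _ (by rwa [G.vert_opp]), G.opp_opp]
      · rw [hp, hp, F'.opp_opp]
    · rcases hcase h with hh | ⟨h, rfl⟩
      · rw [hp1 h hh]; exact G.opp_ne h
      · rw [hp]; exact fun e => F'.opp_ne h (g.injective e)
    · rcases hcase h with hh | ⟨h, rfl⟩
      · rw [hp1 h hh, G.vert_opp]
      · rw [hp, R.vert, R.vert, ← hF'.1, F'.vert_opp]
  choose down hdown using hdown
  unfold stateSum
  congr 1
  refine Set.ncard_congr down (fun F hF => (hmem _ _ (hdown F hF)).1 hF) ?_ ?_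
  · intro F K hF hK e
    have r1 := hdown F hF
    have r2 := hdown K hK
    rw [← e] at r2
    refine Framing.ext (r1.1.trans r2.1.symm) (funext fun h => ?_)
    by_cases hh : G.vert h ∈ S
    · rw [r1.2.2.2 h hh, r2.2.2.2 h hh]
    · obtain ⟨h, rfl⟩ := R.exists_halfEdge hh
      rw [r1.2.2.1, r2.2.2.1]
  · intro F' hF'
    obtain ⟨F, hF⟩ := hup F' hF'
    have m := (hmem _ _ hF).2 hF'
    refine ⟨F, m, ?_⟩
    have r := hdown F m
    refine Framing.ext (r.2.1.trans hF.2.1.symm) (funext fun h => g.injective ?_)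
    rw [← r.2.2.1, hF.2.2.1]

end

/-! ### Comparison of state sums -/

section
variable {Φ : LongFramedGraph.{u} → Prop} {G G' : LongFramedGraph.{u}} {E S : Set G.Crossing}
  {E' S' : Set G'.Crossing}

/-- State sums agree if the same graph remains after erasing `S` and `S'`, the half-edges being
matched by `φ`. -/
theorem stateSum_transfer (hΦ : ∀ H H', Isomorphic H H' → Φ H → Φ H')
    (ψ : G.Crossing ≃ G'.Crossing) (φ : G.HalfEdge ≃ G'.HalfEdge)
    (hψ : ∀ c, ψ c ∈ S' ↔ c ∈ S) (hS : ∀ h, G'.vert (φ h) ∈ S' ↔ G.vert h ∈ S)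
    (hv : ∀ h, G.vert h ∉ S → G'.vert (φ h) = ψ (G.vert h))
    (ho : ∀ h, G.vert h ∉ S → G'.opp (φ h) = φ (G.opp h))
    (hr : ∀ x y, G.Out S x → G.Out S y → G.Run S (G.edge x) y →
      G'.Run S' (G'.edge (Sum.map φ id x)) (Sum.map φ id y))
    (hn : G.NoCircle S ↔ G'.NoCircle S') (hE : ∀ c, ψ c ∈ E' ↔ c ∈ E) (hd : Disjoint E S) :
    stateSum Φ G E S = stateSum Φ G' E' S' := by
  have hd' : Disjoint E' S' := by
    rw [Set.disjoint_left]
    intro c h1 h2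
    obtain ⟨c, rfl⟩ := ψ.surjective c
    exact Set.disjoint_left.1 hd ((hE c).1 h1) ((hψ c).1 h2)
  by_cases h : G.NoCircle S
  · obtain ⟨f, g, R⟩ := erase_erasesVia G S
    have R' := R.transfer (S' := S') ψ φ hψ hS hv ho hr
    rw [stateSum_erase hΦ R h hd, stateSum_erase hΦ R' (hn.1 h) hd']
    congr 1
    ext c
    exact (hE _).symm
  · rw [stateSum_eq_zero hd h, stateSum_eq_zero hd' (fun h' => h (hn.2 h'))]

/-- Two framings that agree outside `S` have the same state sum after erasing `S` if they join
the half-edges at the border of `S` in the same way. Here `I` is the set of inner half-edges, which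
are joined to each other by edges. By `hB` the runs from border to border correspond, and by `hin`
there are no circles among the inner half-edges. -/
theorem stateSum_compare (hΦ : ∀ H H', Isomorphic H H' → Φ H → Φ H')
    {F F' : Framing G.Crossing G.HalfEdge} (I : Set G.HalfEdge)
    (hS : ∀ h, F'.vert h ∈ S ↔ F.vert h ∈ S) (hv : ∀ h, F.vert h ∉ S → F'.vert h = F.vert h)
    (ho : ∀ h, F.vert h ∉ S → F'.opp h = F.opp h) (hI : ∀ h ∈ I, F.vert h ∈ S)
    (hIe : ∀ h ∈ I, ∃ k ∈ I, G.edge (Sum.inl h) = Sum.inl k)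
    (hB : ∀ h, F.vert h ∈ S → h ∉ I → ∃ k, k ∉ I ∧
      (G.refit F).Run S (G.edge (Sum.inl (F.opp h))) (G.edge (Sum.inl k)) ∧
      (G.refit F').Run S (G.edge (Sum.inl (F'.opp h))) (G.edge (Sum.inl k)))
    (hin : ∀ h ∈ I, (∃ k, k ∉ I ∧ (G.refit F).Run S (Sum.inl h) (G.edge (Sum.inl k))) ∧
      ∃ k, k ∉ I ∧ (G.refit F').Run S (Sum.inl h) (G.edge (Sum.inl k)))
    (hd : Disjoint E S) :
    stateSum Φ (G.refit F) E S = stateSum Φ (G.refit F') E S := by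
  let Z : Set G.Dart := {z | ∀ k ∈ I, z ≠ Sum.inl k}
  have hZe : ∀ k, k ∉ I → G.edge (Sum.inl k) ∈ Z := by
    intro k hk j hj e
    obtain ⟨i, hi, e'⟩ := hIe j hj
    have e2 := G.edge_edge (Sum.inl k)
    rw [e, e'] at e2
    exact hk (Sum.inl_injective e2 ▸ hi)
  have hZ : ∀ z ∈ Z, (∃ y, (G.refit F).Out S y ∧ (G.refit F).Run S z y ∧
        (G.refit F').Run S (id z) (id y)) ∨
      ∃ w, (G.refit F).Step S z w ∧ ∃ z' ∈ Z, (G.refit F).Run S w z' ∧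
        (G.refit F').Run S (id z) (id z') := by
    intro z hz
    by_cases hzo : (G.refit F).Out S z
    · exact Or.inl ⟨z, hzo, Relation.ReflTransGen.refl, Relation.ReflTransGen.refl⟩
    · obtain ⟨h, rfl, hh⟩ := not_out.1 hzo
      obtain ⟨k, hk, r1, r2⟩ := hB h hh (fun hi => hz h hi rfl)
      exact Or.inr ⟨_, ⟨h, rfl, hh, rfl⟩, _, hZe k hk, r1, Run.cons ((hS h).2 hh) r2⟩
  have hZ' : ∀ z ∈ Z, (∃ y, (G.refit F').Out S y ∧ (G.refit F').Run S z y ∧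
        (G.refit F).Run S (id z) (id y)) ∨
      ∃ w, (G.refit F').Step S z w ∧ ∃ z' ∈ Z, (G.refit F').Run S w z' ∧
        (G.refit F).Run S (id z) (id z') := by
    intro z hz
    by_cases hzo : (G.refit F').Out S z
    · exact Or.inl ⟨z, hzo, Relation.ReflTransGen.refl, Relation.ReflTransGen.refl⟩
    · obtain ⟨h, rfl, hh⟩ := not_out.1 hzo
      obtain ⟨k, hk, r1, r2⟩ := hB h ((hS h).1 hh) (fun hi => hz h hi rfl)
      exact Or.inr ⟨_, ⟨h, rfl, hh, rfl⟩, _, hZe k hk, r2, Run.cons ((hS h).1 hh) r1⟩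
  have hout : ∀ x, (G.refit F').Out S x ↔ (G.refit F).Out S x := fun x =>
    forall_congr' fun h => imp_congr_right fun _ => not_congr (hS h)
  have hstart : ∀ x, (G.refit F).Out S x → ∃ z ∈ Z, (G.refit F).Run S (G.edge x) z ∧
      (G.refit F').Run S (G.edge (id x)) (id z) := by
    intro x hx
    refine ⟨G.edge x, ?_, run_refl _, run_refl _⟩
    rcases x with h | e
    · exact hZe h fun hi => hx h rfl (hI h hi)
    · intro k hk e'
      obtain ⟨i, hi, e2⟩ := hIe k hk
      rw [← e', G.edge_edge] at e2
      exact absurd e2 (by simp)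
  refine stateSum_transfer (G := G.refit F) (G' := G.refit F') hΦ (Equiv.refl _) (Equiv.refl _)
    (fun _ => Iff.rfl) hS hv ho ?_ ⟨fun hn x => ?_, fun hn x => ?_⟩ (fun _ => Iff.rfl) hd
  · intro x y hx hy r
    have := Run.transfer hZ hstart hx hy r
    simpa using this
  · have main : ∀ z ∈ Z, ∃ y, (G.refit F').Out S y ∧ (G.refit F').Run S z y := fun z hz => by
      obtain ⟨y, hy, r⟩ := hn z
      exact ⟨y, (hout y).2 hy, Run.simulate hZ hy hz r⟩
    by_cases hx : x ∈ Z
    · exact main x hx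
    · have : ∃ h ∈ I, x = Sum.inl h := by
        by_contra hc
        exact hx fun k hk e => hc ⟨k, hk, e⟩
      obtain ⟨h, hh, rfl⟩ := this
      obtain ⟨-, k, hk, r⟩ := hin h hh
      obtain ⟨y, hy, r'⟩ := main _ (hZe k hk)
      exact ⟨y, hy, r.trans r'⟩
  · have main : ∀ z ∈ Z, ∃ y, (G.refit F).Out S y ∧ (G.refit F).Run S z y := fun z hz => by
      obtain ⟨y, hy, r⟩ := hn z
      exact ⟨y, (hout y).1 hy, Run.simulate hZ' hy hz r⟩
    by_cases hx : x ∈ Z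
    · exact main x hx
    · have : ∃ h ∈ I, x = Sum.inl h := by
        by_contra hc
        exact hx fun k hk e => hc ⟨k, hk, e⟩
      obtain ⟨h, hh, rfl⟩ := this
      obtain ⟨⟨k, hk, r⟩, -⟩ := hin h hh
      obtain ⟨y, hy, r'⟩ := main _ (hZe k hk)
      exact ⟨y, hy, r.trans r'⟩

/-- The property `Φ` of graphs is invariant under isomorphisms and second Reidemeister moves. -/
structure SecondMoveInvariant (Φ : LongFramedGraph.{u} → Prop) : Prop where
  iso : ∀ H H', Isomorphic H H' → Φ H → Φ H'
  two : ∀ H H', ReidemeisterTwo H H' → (Φ H ↔ Φ H')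

/-- A bigon whose crossings are not smoothed, and whose edges may pass through crossings that are
erased, can be removed. -/
theorem stateSum_bigon (hΦ : SecondMoveInvariant Φ) {v w : G.Crossing} (hvw : v ≠ w)
    (hvE : v ∉ E) (hwE : w ∉ E) (hvS : v ∉ S) (hwS : w ∉ S) (hd : Disjoint E S)
    {h k h' k' : G.HalfEdge} (hh : G.vert h = v) (hk : G.vert k = v) (hhk : h ≠ k)
    (hhk' : k ≠ G.opp h) (hh' : G.vert h' = w) (hk' : G.vert k' = w) (hhk2 : k' ≠ G.opp h')
    (r : G.Run S (G.edge (Sum.inl h)) (Sum.inl h'))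
    (r' : G.Run S (G.edge (Sum.inl k)) (Sum.inl k')) :
    stateSum Φ G E S = stateSum Φ G E (S ∪ {v, w}) := by
  unfold stateSum
  congr 2
  ext F
  refine and_congr_right fun hF => and_congr_right fun _ => ?_
  set U : Set G.Crossing := E ∪ S with hUdef
  have hvU : v ∉ U := fun h => h.elim hvE hvS
  have hwU : w ∉ U := fun h => h.elim hwE hwS
  -- The bigon in the graph obtained by smoothing and erasing.
  obtain ⟨H, f, g, R⟩ : ∃ H f g, (G.refit F).ErasesVia U H f g := ⟨_, erase_erasesVia (G.refit F) U⟩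
  obtain ⟨v1, hv1⟩ := R.exists_crossing hvU
  obtain ⟨w1, hw1⟩ := R.exists_crossing hwU
  have hgv : ∀ x, f (H.vert x) = G.vert (g x) := fun x => by
    rw [← R.vert, ← hF.1]
  have hgo : ∀ x, G.vert (g x) ∉ E → g (H.opp x) = G.opp (g x) := fun x hx => by
    rw [← R.opp, ← hF.2 _ |>.2 hx]
  have hrun : ∀ x y, G.Run S x y → (G.refit F).Run U x y := by
    intro x y r
    have : (G.refit F).Run S x y := by
      rw [run_refit_iff hF.1 (hF.opp_eq hd)]; exact r
    exact this.mono Set.subset_union_right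
  have hlift : ∀ x : G.HalfEdge, G.vert x ∉ U → ∃ y, g y = x := fun x hx =>
    R.exists_halfEdge (by change F.vert x ∉ U; rwa [hF.1])
  obtain ⟨h, rfl⟩ := hlift h (by rwa [hh])
  obtain ⟨k, rfl⟩ := hlift k (by rwa [hk])
  obtain ⟨h', rfl⟩ := hlift h' (by rwa [hh'])
  obtain ⟨k', rfl⟩ := hlift k' (by rwa [hk'])
  have hB : H.BigonAt v1 w1 := by
    refine ⟨fun e => hvw (by rw [← hv1, ← hw1, e]), h, k, h', k', f.injective ?_,
      f.injective ?_, fun e => hhk (by rw [e]), fun e => hhk' ?_, f.injective ?_,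
      f.injective ?_, fun e => hhk2 ?_, ?_, ?_⟩
    · rw [hgv, hh, hv1]
    · rw [hgv, hk, hv1]
    · rw [e, hgo _ (by rwa [hh])]
    · rw [hgv, hh', hw1]
    · rw [hgv, hk', hw1]
    · rw [e, hgo _ (by rwa [hh'])]
    · exact R.edge_eq (x := Sum.inl h) (y := Sum.inl h') (hrun _ _ r)
    · exact R.edge_eq (x := Sum.inl k) (y := Sum.inl k') (hrun _ _ r')
  obtain ⟨f', g', R'⟩ := erase_erasesVia H {v1, w1}
  have h2 := hΦ.two H _ ⟨v1, w1, hB, erases_iff.2 ⟨f', g', R'⟩⟩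
  have R2 := R.trans R' (U := (E ∪ (S ∪ {v, w}) : Set G.Crossing)) (by
    rw [Set.image_pair, hv1, hw1, ← Set.union_assoc])
  constructor
  · rintro ⟨K, hK, hΦK⟩
    obtain ⟨_, _, RK⟩ := erases_iff.1 hK
    exact ⟨_, erases_iff.2 ⟨_, _, R2⟩, h2.1 (hΦ.iso _ _ (RK.isomorphic R) hΦK)⟩
  · rintro ⟨K, hK, hΦK⟩
    obtain ⟨_, _, RK⟩ := erases_iff.1 hK
    exact ⟨_, erases_iff.2 ⟨_, _, R⟩, h2.2 (hΦ.iso _ _ (RK.isomorphic R2) hΦK)⟩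

end

/-! ### Explicit runs -/

section
variable {G : LongFramedGraph.{u}} {S : Set G.Crossing} {F : Framing G.Crossing G.HalfEdge}
  {x y y' : G.HalfEdge} {z : G.Dart}

theorem run_step (hx : F.vert x ∈ S) (e : F.opp x = y) (e' : G.edge (Sum.inl y) = Sum.inl y')
    (r : (G.refit F).Run S (Sum.inl y') z) : (G.refit F).Run S (Sum.inl x) z := by
  refine Run.cons (G := G.refit F) hx ?_
  change (G.refit F).Run S (G.edge (Sum.inl (F.opp x))) z
  rwa [e, e']

theorem run_last (hx : F.vert x ∈ S) (e : F.opp x = y) :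
    (G.refit F).Run S (Sum.inl x) (G.edge (Sum.inl y)) := by
  refine Run.cons (G := G.refit F) hx ?_
  change (G.refit F).Run S (G.edge (Sum.inl (F.opp x))) _
  rw [e]
  exact run_refl _

theorem run_border (e : F.opp x = y) (e' : G.edge (Sum.inl y) = Sum.inl y')
    (r : (G.refit F).Run S (Sum.inl y') z) :
    (G.refit F).Run S (G.edge (Sum.inl (F.opp x))) z := by
  rwa [e, e']

theorem run_border_refl (e : F.opp x = y) :
    (G.refit F).Run S (G.edge (Sum.inl (F.opp x))) (G.edge (Sum.inl y)) := by
  rw [e]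
  exact Relation.ReflTransGen.refl

/-- A set of half-edges that a run through `S` does not leave contains a circle. -/
theorem not_noCircle {P : Set G.HalfEdge} (hx : x ∈ P)
    (hP : ∀ h ∈ P, F.vert h ∈ S ∧ ∃ k ∈ P, G.edge (Sum.inl (F.opp h)) = Sum.inl k) :
    ¬ (G.refit F).NoCircle S := by
  intro hn
  have key : ∀ y, (G.refit F).Run S (Sum.inl x) y → ∃ k ∈ P, y = Sum.inl k := by
    intro y r
    induction r with
    | refl => exact ⟨x, hx, rfl⟩
    | tail _ s ih =>
      obtain ⟨h, rfl, hh, rfl⟩ := s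
      obtain ⟨k, hk, e⟩ := ih
      cases e
      exact (hP h hk).2
  obtain ⟨y, hy, r⟩ := hn (Sum.inl x)
  obtain ⟨k, hk, rfl⟩ := key y r
  exact hy k rfl (hP k hk).1

/-- The four values of a framing at a crossing where it pairs `x` with `y`. -/
theorem Pairs.values (p : G.Pairs F x y) :
    F.opp x = y ∧ F.opp y = x ∧ F.opp (G.opp x) = G.opp y ∧ F.opp (G.opp y) = G.opp x :=
  ⟨p.1, p.symm.1, p.2, p.symm.2⟩

theorem Pairs.values_opp (p : G.Pairs F x (G.opp y)) :
    F.opp x = G.opp y ∧ F.opp (G.opp y) = x ∧ F.opp (G.opp x) = y ∧ F.opp y = G.opp x := by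
  have h := p.values
  rwa [G.opp_opp] at h

end

section
variable {Φ : LongFramedGraph.{u} → Prop} {G G' : LongFramedGraph.{u}} {E S : Set G.Crossing}

/-- A form of `stateSum_compare` for a set `I` of half-edges containing one half-edge out of each
opposite pair of `G` at the crossings in `S`. -/
theorem stateSum_compare_opp (hΦ : ∀ H H', Isomorphic H H' → Φ H → Φ H')
    (F F' : Framing G.Crossing G.HalfEdge) (I : Set G.HalfEdge)
    (hS : ∀ h, F'.vert h ∈ S ↔ F.vert h ∈ S) (hv : ∀ h, F.vert h ∉ S → F'.vert h = F.vert h)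
    (ho : ∀ h, F.vert h ∉ S → F'.opp h = F.opp h) (hI : ∀ h ∈ I, F.vert h ∈ S)
    (hIo : ∀ h ∈ I, G.opp h ∉ I) (hIo' : ∀ h, F.vert h ∈ S → h ∉ I → G.opp h ∈ I)
    (hIe : ∀ h ∈ I, ∃ k ∈ I, G.edge (Sum.inl h) = Sum.inl k)
    (hB : ∀ h ∈ I, ∃ k ∈ I,
      (G.refit F).Run S (G.edge (Sum.inl (F.opp (G.opp h)))) (G.edge (Sum.inl (G.opp k))) ∧
      (G.refit F').Run S (G.edge (Sum.inl (F'.opp (G.opp h)))) (G.edge (Sum.inl (G.opp k))))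
    (hin : ∀ h ∈ I, (∃ k ∈ I, (G.refit F).Run S (Sum.inl h) (G.edge (Sum.inl (G.opp k)))) ∧
      ∃ k ∈ I, (G.refit F').Run S (Sum.inl h) (G.edge (Sum.inl (G.opp k))))
    (hd : Disjoint E S) :
    stateSum Φ (G.refit F) E S = stateSum Φ (G.refit F') E S := by
  refine stateSum_compare hΦ I hS hv ho hI hIe (fun h hh hi => ?_) (fun h hh => ?_) hd
  · obtain ⟨k, hk, r⟩ := hB _ (hIo' h hh hi)
    rw [G.opp_opp] at r
    exact ⟨_, hIo k hk, r⟩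
  · obtain ⟨⟨k, hk, r⟩, k', hk', r'⟩ := hin h hh
    exact ⟨⟨_, hIo k hk, r⟩, _, hIo k' hk', r'⟩

/-- The sum over the two smoothings of a crossing in a graph refitted elsewhere. -/
theorem stateSum_split_refit {F : Framing G.Crossing G.HalfEdge} (hF : F.vert = G.vert)
    {c : G.Crossing} (ho : ∀ x, G.vert x = c → F.opp x = G.opp x) (hc : c ∈ E)
    {h k : G.HalfEdge} (hh : G.vert h = c) (hk : G.vert k = c) (h1 : k ≠ h) (h2 : k ≠ G.opp h) :
    ∃ F' : Bool → Framing G.Crossing G.HalfEdge, (∀ i, (F' i).vert = G.vert) ∧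
      (∀ i x, G.vert x ≠ c → (F' i).opp x = F.opp x) ∧
      (∀ i, G.Pairs (F' i) h (bif i then G.opp k else k)) ∧
      stateSum Φ (G.refit F) E S =
        stateSum Φ (G.refit (F' false)) (E \ {c} : Set G.Crossing)
          (insert c S : Set G.Crossing) +
        stateSum Φ (G.refit (F' true)) (E \ {c} : Set G.Crossing)
          (insert c S : Set G.Crossing) := by
  obtain ⟨F', hv, hoff, hp, hs⟩ := stateSum_split (Φ := Φ) (G := G.refit F) (E := E) (S := S) hc
    (h := h) (k := k) (by rw [← hh, ← hF]) (by rw [← hk, ← hF]) h1 (by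
      change k ≠ F.opp h
      rwa [ho h hh])
  have hk' : ∀ i : Bool, G.vert (bif i then G.opp k else k) = c := by
    rintro (_ | _)
    · exact hk
    · exact (G.vert_opp k).trans hk
  refine ⟨F', fun i => (hv i).trans hF, fun i x hx => hoff i x ?_, fun i => ?_, hs⟩
  · change F.vert x ≠ c
    rwa [hF]
  · have p := hp i
    have e : (bif i then (G.refit F).opp k else k) = (bif i then G.opp k else k) := by
      cases i
      · rfl
      · exact ho k hk
    rw [e] at p
    obtain ⟨p1, p2⟩ := p
    refine ⟨p1, ?_⟩
    have e1 : (G.refit F).opp h = G.opp h := ho h hh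
    have e2 : (G.refit F).opp (bif i then G.opp k else k) = G.opp (bif i then G.opp k else k) :=
      ho _ (hk' i)
    rw [e1, e2] at p2
    exact p2

/-- A set that meets a crossing in two non-opposite half-edges contains exactly one half-edge of
each opposite pair there. -/
theorem opp_mem_iff_of_inter {I : Set G.HalfEdge} {x y : G.HalfEdge} (hx : x ∈ I) (hy : y ∈ I)
    (hxy : G.vert y = G.vert x) (h1 : y ≠ x) (h2 : y ≠ G.opp x)
    (hI : ∀ h ∈ I, G.vert h = G.vert x → h = x ∨ h = y) {h : G.HalfEdge}
    (hh : G.vert h = G.vert x) : h ∈ I ↔ G.opp h ∉ I := by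
  have hox : G.opp x ∉ I := fun hm =>
    (hI _ hm (G.vert_opp x)).elim (G.opp_ne x) (fun e => h2 e.symm)
  have hoy : G.opp y ∉ I := fun hm =>
    (hI _ hm ((G.vert_opp y).trans hxy)).elim (fun e => h2 (by rw [← e, G.opp_opp])) (G.opp_ne y)
  rcases eq_of_vert_eq hxy h1 h2 hh with rfl | rfl | rfl | rfl
  · simp [hx, hox]
  · simp [G.opp_opp, hx, hox]
  · simp [hy, hoy]
  · simp [G.opp_opp, hy, hoy]

/-! ### The first move -/

/-- Of the two smoothings of a loop, one splits off a circle and the other is the result of the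
first Reidemeister move. -/
theorem stateSum_moveOne (hΦ : ∀ H H', Isomorphic H H' → Φ H → Φ H') (hG : G.OneComponent)
    {v : G.Crossing} (hv : v ∈ E) (hl : G.LoopAt v) {f : G'.Crossing ↪ G.Crossing}
    {g : G'.HalfEdge ↪ G.HalfEdge} (R : G.ErasesVia {v} G' f g) :
    stateSum Φ G E ∅ = stateSum Φ G' (f ⁻¹' E) ∅ := by
  obtain ⟨h, k, hh, hk, hhk, e1⟩ := hl
  have e2 : G.edge (Sum.inl k) = Sum.inl h := by rw [← e1, G.edge_edge]
  have hne : k ≠ h := by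
    rintro rfl
    exact G.edge_ne _ e1
  obtain ⟨F, hF, hoff, hp, hs⟩ := stateSum_split (Φ := Φ) (S := ∅) hv hh hk hne hhk
  have hd : Disjoint (E \ {v}) (insert v ∅ : Set G.Crossing) := by
    simp
  have m : ∀ i x, G.vert x = v → (F i).vert x ∈ (insert v ∅ : Set G.Crossing) := by
    intro i x hx; rw [hF, hx]; simp
  have mG : ∀ x, G.vert x = v → G.framing.vert x ∈ (insert v ∅ : Set G.Crossing) := by
    intro x hx
    change G.vert x ∈ _
    rw [hx]; simp
  -- Joining `h` to `k` turns the loop into a circle.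
  have s0 : stateSum Φ (G.refit (F false)) (E \ {v} : Set G.Crossing)
      (insert v ∅ : Set G.Crossing) = 0 := by
    refine stateSum_eq_zero hd (not_noCircle (P := {h}) rfl ?_)
    rintro x (e : x = h)
    rw [e]
    exact ⟨m _ _ hh, h, rfl, by rw [(hp false).1]; exact e2⟩
  -- The other smoothing runs through the loop in the reverse direction, with the same two ends.
  have s1 : stateSum Φ (G.refit (F true)) (E \ {v} : Set G.Crossing)
      (insert v ∅ : Set G.Crossing) = stateSum Φ (G.refit G.framing) (E \ {v} : Set G.Crossing)
      (insert v ∅ : Set G.Crossing) := by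
    have hI : ∀ {x}, G.vert x = v → (x ∈ ({h, k} : Set G.HalfEdge) ↔ G.opp x ∉ ({h, k} : Set _)) :=
      fun hx => opp_mem_iff_of_inter (I := {h, k}) (x := h) (y := k) (by simp) (by simp)
        (hk.trans hh.symm) hne hhk (fun y hy _ => by simpa using hy) (hx.trans hh.symm)
    have hIv : ∀ x ∈ ({h, k} : Set G.HalfEdge), G.vert x = v := by
      rintro x (e | (e : x = k)) <;> rw [e] <;> assumption
    have hm : ∀ x, (F true).vert x ∈ (insert v ∅ : Set G.Crossing) → G.vert x = v := by
      intro x hx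
      rw [hF] at hx
      simpa using hx
    obtain ⟨p1, p2, p3, p4⟩ := Pairs.values_opp (hp true)
    have q : ∀ x, G.framing.opp x = G.opp x := fun _ => rfl
    have q1 := q h
    have q2 := q k
    have q3 : G.framing.opp (G.opp h) = h := G.opp_opp h
    have q4 : G.framing.opp (G.opp k) = k := G.opp_opp k
    have m1 := m true _ hh
    have m2 := m true _ hk
    have n1 := mG _ hh
    have n2 := mG _ hk
    refine stateSum_compare_opp hΦ (F true) G.framing {h, k} (fun x => ?_) (fun x _ => ?_)
      (fun x hx => ?_) (fun x hx => m _ _ (hIv x hx)) (fun x hx => (hI (hIv x hx)).1 hx)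
      (fun x hx hi => by_contra fun hc => hi ((hI (hm x hx)).2 hc)) ?_ ?_ ?_ hd
    · rw [hF]; rfl
    · rw [hF]; rfl
    · refine (hoff true x ?_).symm
      rintro hx'
      exact hx (m _ _ hx')
    · rintro x (e | (e : x = k)) <;> rw [e]
      · exact ⟨k, by simp, e1⟩
      · exact ⟨h, by simp, e2⟩
    · rintro x (e | (e : x = k)) <;> rw [e]
      · exact ⟨k, by simp, run_border p3 e2 (run_last m1 p1), run_border q3 e1 (run_last n2 q2)⟩
      · exact ⟨h, by simp, run_border p2 e1 (run_last m2 p4), run_border q4 e2 (run_last n1 q1)⟩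
    · rintro x (e | (e : x = k)) <;> rw [e]
      · exact ⟨⟨k, by simp, run_last m1 p1⟩, h, by simp, run_last n1 q1⟩
      · exact ⟨⟨h, by simp, run_last m2 p4⟩, k, by simp, run_last n2 q2⟩
  rw [hs, s0, s1, zero_add]
  have ev : (insert v ∅ : Set G.Crossing) = {v} := by simp
  have := stateSum_erase hΦ R (hG.noCircle _) (E := E \ {v}) (by simp)
  rw [ev]
  refine this.trans ?_
  congr 1
  ext c
  have : f c ≠ v := R.notMem c
  simp [this]

end

/-! ### The second move -/

section
variable {Φ : LongFramedGraph.{u} → Prop} {G G' : LongFramedGraph.{u}} {E : Set G.Crossing}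

theorem add_add_cancel_zmod_two {a b c d : ZMod 2} (ha : a = 0) (hbc : b = c) :
    a + b + (c + d) = d := by
  rw [ha, hbc, zero_add, ← add_assoc, CharTwo.add_self_eq_zero, zero_add]

/-- The sum over the four smoothings of two crossings. -/
theorem stateSum_split_two {v w : G.Crossing} (hvw : v ≠ w) (hv : v ∈ E) (hw : w ∈ E)
    {h k h' k' : G.HalfEdge} (vh : G.vert h = v) (vk : G.vert k = v) (hhk : k ≠ h)
    (hkh : k ≠ G.opp h) (vh' : G.vert h' = w) (vk' : G.vert k' = w) (hhk' : k' ≠ h')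
    (hkh' : k' ≠ G.opp h') {T : Set G.Crossing} (hT : T = {v, w}) :
    ∃ K : Bool → Bool → Framing G.Crossing G.HalfEdge, (∀ i j, (K i j).vert = G.vert) ∧
      (∀ i j x, G.vert x ∉ T → (K i j).opp x = G.opp x) ∧
      (∀ i j, G.Pairs (K i j) h (bif i then G.opp k else k)) ∧
      (∀ i j, G.Pairs (K i j) h' (bif j then G.opp k' else k')) ∧
      stateSum Φ G E ∅ = stateSum Φ (G.refit (K false false)) (E \ T : Set G.Crossing) T +
          stateSum Φ (G.refit (K false true)) (E \ T : Set G.Crossing) T +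
        (stateSum Φ (G.refit (K true false)) (E \ T : Set G.Crossing) T +
          stateSum Φ (G.refit (K true true)) (E \ T : Set G.Crossing) T) := by
  have hT' : T = insert w (insert v ∅) := by
    rw [hT]; ext c; simp [or_comm]
  have hET : (E \ {v}) \ {w} = E \ T := by
    ext c; simp [hT, and_assoc]
  obtain ⟨F, hF, hFo, hFp, hFs⟩ := stateSum_split (Φ := Φ) (S := ∅) hv vh vk hhk hkh
  have := fun i => stateSum_split_refit (Φ := Φ) (E := E \ {v}) (S := insert v ∅) (hF i) (c := w)
    (fun x hx => hFo i x (by rw [hx]; exact hvw.symm)) ⟨hw, hvw.symm⟩ vh' vk' hhk' hkh'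
  choose K hK hKo hKp hKs using this
  refine ⟨K, hK, fun i j x hx => ?_, fun i j => ⟨?_, ?_⟩, hKp, ?_⟩
  · have hx' : ¬ (G.vert x = v ∨ G.vert x = w) := by simpa [hT] using hx
    rw [not_or] at hx'
    rw [hKo i j x hx'.2, hFo i x hx'.1]
  · rw [hKo i j _ (by rw [vh]; exact hvw), (hFp i).1]
  · rw [hKo i j _ (by rw [G.vert_opp, vh]; exact hvw), (hFp i).2]
  · rw [hFs, hKs, hKs, hET, hT']

/-- Comparison of two framings that differ from `G` at the crossings of a bigon only. -/
theorem stateSum_compare_bigon (hΦ : ∀ H H', Isomorphic H H' → Φ H → Φ H')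
    {v w : G.Crossing} (hvw : v ≠ w)
    {h k h' k' : G.HalfEdge} (vh : G.vert h = v) (vk : G.vert k = v) (hhk : k ≠ h)
    (hkh : k ≠ G.opp h) (vh' : G.vert h' = w) (vk' : G.vert k' = w) (hhk' : k' ≠ h')
    (hkh' : k' ≠ G.opp h') (e1 : G.edge (Sum.inl h) = Sum.inl h')
    (e2 : G.edge (Sum.inl k) = Sum.inl k') {T : Set G.Crossing} (hT : T = {v, w})
    {I : Set G.HalfEdge} (hIdef : I = {h, k, h', k'})
    (L M : Framing G.Crossing G.HalfEdge) (hL : L.vert = G.vert) (hM : M.vert = G.vert)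
    (hLo : ∀ x, G.vert x ∉ T → L.opp x = G.opp x) (hMo : ∀ x, G.vert x ∉ T → M.opp x = G.opp x)
    (hB : ∀ x ∈ I, ∃ y ∈ I,
      (G.refit L).Run T (G.edge (Sum.inl (L.opp (G.opp x)))) (G.edge (Sum.inl (G.opp y))) ∧
      (G.refit M).Run T (G.edge (Sum.inl (M.opp (G.opp x)))) (G.edge (Sum.inl (G.opp y))))
    (hin : ∀ x ∈ I, (∃ y ∈ I, (G.refit L).Run T (Sum.inl x) (G.edge (Sum.inl (G.opp y)))) ∧
      ∃ y ∈ I, (G.refit M).Run T (Sum.inl x) (G.edge (Sum.inl (G.opp y)))) :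
    stateSum Φ (G.refit L) (E \ T) T = stateSum Φ (G.refit M) (E \ T) T := by
  subst hIdef hT
  have e1' : G.edge (Sum.inl h') = Sum.inl h := by rw [← e1, G.edge_edge]
  have e2' : G.edge (Sum.inl k') = Sum.inl k := by rw [← e2, G.edge_edge]
  have vI : ∀ x ∈ ({h, k, h', k'} : Set G.HalfEdge), G.vert x ∈ ({v, w} : Set G.Crossing) := by
    rintro x (e | e | e | (e : x = k')) <;> rw [e] <;> simp [vh, vk, vh', vk']
  have hI : ∀ x, G.vert x ∈ ({v, w} : Set G.Crossing) →
      (x ∈ ({h, k, h', k'} : Set G.HalfEdge) ↔ G.opp x ∉ ({h, k, h', k'} : Set _)) := by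
    rintro x (hx | (hx : G.vert x = w))
    · refine opp_mem_iff_of_inter (I := {h, k, h', k'}) (x := h) (y := k) (by simp) (by simp)
        (vk.trans vh.symm) hhk hkh ?_ (hx.trans vh.symm)
      rintro y (e | e | e | (e : y = k')) hy
      · exact Or.inl e
      · exact Or.inr e
      · exact absurd (by rw [← vh, ← hy, e, vh']) hvw
      · exact absurd (by rw [← vh, ← hy, e, vk']) hvw
    · refine opp_mem_iff_of_inter (I := {h, k, h', k'}) (x := h') (y := k') (by simp) (by simp)
        (vk'.trans vh'.symm) hhk' hkh' ?_ (hx.trans vh'.symm)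
      rintro y (e | e | e | (e : y = k')) hy
      · exact absurd (by rw [← vh', ← hy, e, vh]) hvw
      · exact absurd (by rw [← vh', ← hy, e, vk]) hvw
      · exact Or.inl e
      · exact Or.inr e
  refine stateSum_compare_opp hΦ L M {h, k, h', k'} (fun x => by rw [hL, hM])
    (fun x _ => by rw [hL, hM]) (fun x hx => by rw [hL] at hx; rw [hLo x hx, hMo x hx])
    (fun x hx => by rw [hL]; exact vI x hx) (fun x hx => (hI x (vI x hx)).1 hx)
    (fun x hx hi => by_contra fun hc => hi ((hI x (by rwa [hL] at hx)).2 hc)) ?_ hB hin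
    Set.disjoint_sdiff_left
  rintro x (e | e | e | (e : x = k')) <;> rw [e]
  exacts [⟨h', by simp, e1⟩, ⟨k', by simp, e2⟩, ⟨h, by simp, e1'⟩, ⟨k, by simp, e2'⟩]

/-- Of the four ways to smooth both crossings of a bigon, one splits off a circle, two cancel
each other, and the fourth is the result of the second Reidemeister move. -/
theorem stateSum_moveTwo_smoothed (hΦ : ∀ H H', Isomorphic H H' → Φ H → Φ H')
    (hG : G.OneComponent) {v w : G.Crossing} (hv : v ∈ E) (hw : w ∈ E) (hb : G.BigonAt v w)
    {f : G'.Crossing ↪ G.Crossing} {g : G'.HalfEdge ↪ G.HalfEdge}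
    (R : G.ErasesVia {v, w} G' f g) :
    stateSum Φ G E ∅ = stateSum Φ G' (f ⁻¹' E) ∅ := by
  obtain ⟨hvw, h, k, h', k', vh, vk, hhk, hkh, vh', vk', hkh', e1, e2⟩ := hb
  have e1' : G.edge (Sum.inl h') = Sum.inl h := by rw [← e1, G.edge_edge]
  have e2' : G.edge (Sum.inl k') = Sum.inl k := by rw [← e2, G.edge_edge]
  have hhk' : k' ≠ h' := by
    rintro rfl
    exact hhk (Sum.inl_injective (e1'.symm.trans e2'))
  obtain ⟨T, hT⟩ : ∃ T : Set G.Crossing, T = {v, w} := ⟨_, rfl⟩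
  obtain ⟨I, hI⟩ : ∃ I : Set G.HalfEdge, I = {h, k, h', k'} := ⟨_, rfl⟩
  have Ih : h ∈ I := by simp [hI]
  have Ik : k ∈ I := by simp [hI]
  have Ih' : h' ∈ I := by simp [hI]
  have Ik' : k' ∈ I := by simp [hI]
  obtain ⟨K, hK, hoff, hp, hKp, hs⟩ :=
    stateSum_split_two (Φ := Φ) hvw hv hw vh vk hhk.symm hkh vh' vk' hhk' hkh' hT
  have m : ∀ F : Framing G.Crossing G.HalfEdge, F.vert = G.vert →
      F.vert h ∈ T ∧ F.vert k ∈ T ∧ F.vert h' ∈ T ∧ F.vert k' ∈ T := by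
    intro F hF
    rw [hF, hT, vh, vk, vh', vk']
    simp
  have compare := stateSum_compare_bigon (Φ := Φ) (E := E) hΦ hvw vh vk hhk.symm hkh vh' vk' hhk'
    hkh' e1 e2 hT hI
  have hhp := fun i j => (hp i j).values
  have hkp := fun i j => (hKp i j).values
  have hhp' := fun j => (hp true j).values_opp
  have hkp' := fun i => (hKp i true).values_opp
  rw [hs]
  refine (add_add_cancel_zmod_two (stateSum_eq_zero Set.disjoint_sdiff_left ?_) ?_).trans ?_
  · -- If both smoothings cut off the bigon, it becomes a circle.
    obtain ⟨a1, a2, a3, a4⟩ := hhp false false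
    obtain ⟨b1, b2, b3, b4⟩ := hkp false false
    obtain ⟨m1, m2, m3, m4⟩ := m _ (hK false false)
    simp only [cond_false] at a1 a2 a3 a4 b1 b2 b3 b4
    refine not_noCircle (P := {h, k'}) (x := h) (by simp) ?_
    rintro x (e | (e : x = k')) <;> rw [e]
    · exact ⟨m1, k', by simp, by rw [a1, e2]⟩
    · exact ⟨m4, h, by simp, by rw [b2, e1']⟩
  · -- If one of them does, it does not matter which one.
    obtain ⟨a1, a2, a3, a4⟩ := hhp false true
    obtain ⟨b1, b2, b3, b4⟩ := hkp' false
    obtain ⟨c1, c2, c3, c4⟩ := hhp' false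
    obtain ⟨d1, d2, d3, d4⟩ := hkp true false
    obtain ⟨m1, m2, m3, m4⟩ := m _ (hK false true)
    obtain ⟨n1, n2, n3, n4⟩ := m _ (hK true false)
    simp only [cond_false] at a1 a2 a3 a4 d1 d2 d3 d4
    refine compare _ _ (hK _ _) (hK _ _) (hoff _ _) (hoff _ _) ?_ ?_
    · intro x hx
      rw [hI] at hx
      rcases hx with e | e | e | (e : x = k') <;> rw [e]
      · exact ⟨k, Ik, run_border_refl a3,
          run_border c3 e2 (run_step n4 d2 e1' (run_last n1 c1))⟩
      · exact ⟨h, Ih, run_border_refl a4,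
          run_border c2 e1 (run_step n3 d1 e2' (run_last n2 c4))⟩
      · exact ⟨k', Ik', run_border b3 e2' (run_step m2 a2 e1 (run_last m3 b1)),
          run_border_refl d3⟩
      · exact ⟨h', Ih', run_border b2 e1' (run_step m1 a1 e2 (run_last m4 b4)),
          run_border_refl d4⟩
    · intro x hx
      rw [hI] at hx
      rcases hx with e | e | e | (e : x = k') <;> rw [e]
      · exact ⟨⟨h', Ih', run_step m1 a1 e2 (run_last m4 b4)⟩, k, Ik, run_last n1 c1⟩
      · exact ⟨⟨k', Ik', run_step m2 a2 e1 (run_last m3 b1)⟩, h, Ih, run_last n2 c4⟩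
      · exact ⟨⟨k', Ik', run_last m3 b1⟩, h, Ih, run_step n3 d1 e2' (run_last n2 c4)⟩
      · exact ⟨⟨h', Ih', run_last m4 b4⟩, k, Ik, run_step n4 d2 e1' (run_last n1 c1)⟩
  · -- Otherwise the ends are joined as if the strands went straight on.
    have s1 : stateSum Φ (G.refit (K true true)) (E \ T) T =
        stateSum Φ (G.refit G.framing) (E \ T) T := by
      obtain ⟨a1, a2, a3, a4⟩ := hhp' true
      obtain ⟨b1, b2, b3, b4⟩ := hkp' true
      obtain ⟨m1, m2, m3, m4⟩ := m _ (hK true true)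
      obtain ⟨n1, n2, n3, n4⟩ := m G.framing rfl
      have q : ∀ x, G.framing.opp x = G.opp x := fun _ => rfl
      have q' : ∀ x, G.framing.opp (G.opp x) = x := G.opp_opp
      refine compare _ _ (hK _ _) rfl (hoff _ _) (fun x _ => rfl) ?_ ?_
      · intro x hx
        rw [hI] at hx
        rcases hx with e | e | e | (e : x = k') <;> rw [e]
        · exact ⟨h', Ih', run_border a3 e2 (run_last m4 b4),
            run_border (q' _) e1 (run_last n3 (q _))⟩
        · exact ⟨k', Ik', run_border a2 e1 (run_last m3 b1),
            run_border (q' _) e2 (run_last n4 (q _))⟩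
        · exact ⟨h, Ih, run_border b3 e2' (run_last m2 a4),
            run_border (q' _) e1' (run_last n1 (q _))⟩
        · exact ⟨k, Ik, run_border b2 e1' (run_last m1 a1),
            run_border (q' _) e2' (run_last n2 (q _))⟩
      · intro x hx
        rw [hI] at hx
        rcases hx with e | e | e | (e : x = k') <;> rw [e]
        · exact ⟨⟨k, Ik, run_last m1 a1⟩, h, Ih, run_last n1 (q _)⟩
        · exact ⟨⟨h, Ih, run_last m2 a4⟩, k, Ik, run_last n2 (q _)⟩
        · exact ⟨⟨k', Ik', run_last m3 b1⟩, h', Ih', run_last n3 (q _)⟩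
        · exact ⟨⟨h', Ih', run_last m4 b4⟩, k', Ik', run_last n4 (q _)⟩
    rw [← hT] at R
    rw [s1]
    refine (stateSum_erase hΦ R (hG.noCircle _) Set.disjoint_sdiff_left).trans ?_
    congr 1
    ext c
    have : f c ∉ T := R.notMem c
    simp [this]

/-- Invariance under the second move if both crossings are smoothed or neither is. -/
theorem stateSum_moveTwo (hΦ : SecondMoveInvariant Φ)
    (hG : G.OneComponent) {v w : G.Crossing} (hvw : v ∈ E ↔ w ∈ E) (hb : G.BigonAt v w)
    {f : G'.Crossing ↪ G.Crossing} {g : G'.HalfEdge ↪ G.HalfEdge}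
    (R : G.ErasesVia {v, w} G' f g) :
    stateSum Φ G E ∅ = stateSum Φ G' (f ⁻¹' E) ∅ := by
  by_cases hv : v ∈ E
  · exact stateSum_moveTwo_smoothed hΦ.iso hG hv (hvw.1 hv) hb R
  · have hw : w ∉ E := fun hw => hv (hvw.2 hw)
    have hd : Disjoint E {v, w} := by
      rw [Set.disjoint_right]
      rintro c (rfl | rfl) <;> assumption
    obtain ⟨hne, h, k, h', k', vh, vk, hhk, hkh, vh', vk', hkh', e1, e2⟩ := hb
    rw [stateSum_bigon hΦ hne hv hw (by simp) (by simp) (by simp) vh vk hhk hkh vh' vk' hkh'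
      (by rw [e1]; exact run_refl _) (by rw [e2]; exact run_refl _), Set.empty_union]
    exact stateSum_erase hΦ.iso R (hG.noCircle _) hd

end

/-! ### Triangles -/

/-- `F'` agrees with `F` outside the set `T` of crossings. -/
structure Framing.AgreesOff {C H : Type u} (F F' : Framing C H) (T : Set C) : Prop where
  mem : ∀ x, F'.vert x ∈ T ↔ F.vert x ∈ T
  vert : ∀ x, F.vert x ∉ T → F'.vert x = F.vert x
  opp : ∀ x, F.vert x ∉ T → F'.opp x = F.opp x

theorem Framing.AgreesOff.symm {C H : Type u} {F F' : Framing C H} {T : Set C}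
    (h : F.AgreesOff F' T) : F'.AgreesOff F T :=
  ⟨fun x => (h.mem x).symm, fun x hx => (h.vert x (mt (h.mem x).2 hx)).symm,
    fun x hx => (h.opp x (mt (h.mem x).2 hx)).symm⟩

theorem Framing.AgreesOff.trans {C H : Type u} {F F' F'' : Framing C H} {T : Set C}
    (h : F.AgreesOff F' T) (h' : F'.AgreesOff F'' T) : F.AgreesOff F'' T :=
  ⟨fun x => (h'.mem x).trans (h.mem x),
    fun x hx => (h'.vert x (mt (h.mem x).1 hx)).trans (h.vert x hx),
    fun x hx => (h'.opp x (mt (h.mem x).1 hx)).trans (h.opp x hx)⟩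

/-- The edges `a a'`, `b b'`, `c c'` form a triangle to which the third Reidemeister move applies.

Of the two smoothings at the vertex of `a` and `c'`, the one that joins `a` to `c'` is said to cut
this corner of the triangle, and the one that joins `a` to `opp c'` to open it. -/
structure Triangle (G : LongFramedGraph.{u}) (a a' b b' c c' : G.HalfEdge) : Prop where
  edge_a : G.edge (Sum.inl a) = Sum.inl a'
  edge_b : G.edge (Sum.inl b) = Sum.inl b'
  edge_c : G.edge (Sum.inl c) = Sum.inl c'
  vert_a' : G.vert a' = G.vert b
  vert_b' : G.vert b' = G.vert c
  vert_c' : G.vert c' = G.vert a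
  ne_ab : G.vert a ≠ G.vert b
  ne_bc : G.vert b ≠ G.vert c
  ne_ca : G.vert c ≠ G.vert a
  opp_a' : b ≠ G.opp a'
  opp_b' : c ≠ G.opp b'
  opp_c' : a ≠ G.opp c'

section
variable {Φ : LongFramedGraph.{u} → Prop} {G : LongFramedGraph.{u}} {E T : Set G.Crossing}
  {I : Set G.HalfEdge} {a a' b b' c c' : G.HalfEdge}

namespace Triangle

theorem rotate (t : G.Triangle a a' b b' c c') : G.Triangle b b' c c' a a' :=
  ⟨t.edge_b, t.edge_c, t.edge_a, t.vert_b', t.vert_c', t.vert_a', t.ne_bc, t.ne_ca, t.ne_ab,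
    t.opp_b', t.opp_c', t.opp_a'⟩

theorem edge_a' (t : G.Triangle a a' b b' c c') : G.edge (Sum.inl a') = Sum.inl a := by
  rw [← t.edge_a, G.edge_edge]

theorem ne_c' (t : G.Triangle a a' b b' c c') : c' ≠ a := by
  intro e
  have h1 := t.rotate.rotate.edge_a'
  rw [e, t.edge_a] at h1
  apply t.ne_bc
  rw [← t.vert_a', Sum.inl_injective h1]

theorem opp_a (t : G.Triangle a a' b b' c c') : c' ≠ G.opp a := fun e =>
  t.opp_c' (by rw [e, G.opp_opp])

theorem opp_mem_iff_at (t : G.Triangle a a' b b' c c') (hI : I = {a, a', b, b', c, c'})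
    {x : G.HalfEdge} (hx : G.vert x = G.vert a) : x ∈ I ↔ G.opp x ∉ I := by
  subst hI
  refine opp_mem_iff_of_inter (I := {a, a', b, b', c, c'}) (x := a) (y := c') (by simp) (by simp)
    t.vert_c' t.ne_c' t.opp_a ?_ hx
  rintro y (e | e | e | e | e | (e : y = c')) hy
  · exact Or.inl e
  · exact absurd (by rw [← hy, e, t.vert_a']) t.ne_ab
  · exact absurd (by rw [← hy, e]) t.ne_ab
  · exact absurd (by rw [← hy, e, t.vert_b']) t.ne_ca
  · exact absurd (by rw [← hy, e]) t.ne_ca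
  · exact Or.inr e

theorem opp_mem_iff (t : G.Triangle a a' b b' c c') (hI : I = {a, a', b, b', c, c'})
    (hT : T = {G.vert a, G.vert b, G.vert c}) {x : G.HalfEdge} (hx : G.vert x ∈ T) :
    x ∈ I ↔ G.opp x ∉ I := by
  subst hT
  rcases hx with hx | hx | hx
  · exact t.opp_mem_iff_at hI hx
  · exact t.rotate.opp_mem_iff_at (by rw [hI]; ext y; simp; tauto) hx
  · exact t.rotate.rotate.opp_mem_iff_at (by rw [hI]; ext y; simp; tauto) hx

theorem vert_mem (t : G.Triangle a a' b b' c c') (hT : T = {G.vert a, G.vert b, G.vert c}) :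
    G.vert a ∈ T ∧ G.vert a' ∈ T ∧ G.vert b ∈ T ∧ G.vert b' ∈ T ∧ G.vert c ∈ T ∧
      G.vert c' ∈ T := by
  subst hT
  simp [t.vert_a', t.vert_b', t.vert_c']

end Triangle

theorem Triangle.vert_mem_of_agreesOff (t : G.Triangle a a' b b' c c')
    (hT : T = {G.vert a, G.vert b, G.vert c}) {F : Framing G.Crossing G.HalfEdge}
    (hF : G.framing.AgreesOff F T) : F.vert a ∈ T ∧ F.vert a' ∈ T ∧ F.vert b ∈ T ∧
      F.vert b' ∈ T ∧ F.vert c ∈ T ∧ F.vert c' ∈ T := by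
  obtain ⟨v1, v2, v3, v4, v5, v6⟩ := t.vert_mem hT
  exact ⟨(hF.mem _).2 v1, (hF.mem _).2 v2, (hF.mem _).2 v3, (hF.mem _).2 v4, (hF.mem _).2 v5,
    (hF.mem _).2 v6⟩

/-- Comparison of two framings that differ at the crossings of a triangle only. -/
theorem stateSum_compare_triangle (hΦ : ∀ H H', Isomorphic H H' → Φ H → Φ H')
    (t : G.Triangle a a' b b' c c') (hI : I = {a, a', b, b', c, c'})
    (hT : T = {G.vert a, G.vert b, G.vert c}) {L M : Framing G.Crossing G.HalfEdge}
    (hL : G.framing.AgreesOff L T) (hM : G.framing.AgreesOff M T)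
    (hB : ∀ x ∈ I, ∃ y ∈ I,
      (G.refit L).Run T (G.edge (Sum.inl (L.opp (G.opp x)))) (G.edge (Sum.inl (G.opp y))) ∧
      (G.refit M).Run T (G.edge (Sum.inl (M.opp (G.opp x)))) (G.edge (Sum.inl (G.opp y))))
    (hin : ∀ x ∈ I, (∃ y ∈ I, (G.refit L).Run T (Sum.inl x) (G.edge (Sum.inl (G.opp y)))) ∧
      ∃ y ∈ I, (G.refit M).Run T (Sum.inl x) (G.edge (Sum.inl (G.opp y)))) :
    stateSum Φ (G.refit L) (E \ T) T = stateSum Φ (G.refit M) (E \ T) T := by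
  have hLM := hL.symm.trans hM
  have vI : ∀ x ∈ I, G.vert x ∈ T := by
    obtain ⟨h1, h2, h3, h4, h5, h6⟩ := t.vert_mem hT
    subst hI
    rintro x (e | e | e | e | e | (e : x = c')) <;> rw [e] <;> assumption
  refine stateSum_compare_opp hΦ L M I hLM.mem hLM.vert hLM.opp
    (fun x hx => (hL.mem x).2 (vI x hx)) (fun x hx => (t.opp_mem_iff hI hT (vI x hx)).1 hx)
    (fun x hx hi => by_contra fun hc => hi ((t.opp_mem_iff hI hT ((hL.mem x).1 hx)).2 hc))
    ?_ hB hin Set.disjoint_sdiff_left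
  subst hI
  rintro x (e | e | e | e | e | (e : x = c')) <;> rw [e]
  exacts [⟨a', by simp, t.edge_a⟩, ⟨a, by simp, t.edge_a'⟩, ⟨b', by simp, t.edge_b⟩,
    ⟨b, by simp, t.rotate.edge_a'⟩, ⟨c', by simp, t.edge_c⟩, ⟨c, by simp, t.rotate.rotate.edge_a'⟩]

theorem exists_exit_intro {F : Framing G.Crossing G.HalfEdge} {x k : G.HalfEdge}
    (r : (G.refit F).Run T (Sum.inl x) (G.edge (Sum.inl (G.opp k)))) (hk : k ∈ I) :
    ∃ k ∈ I, (G.refit F).Run T (Sum.inl x) (G.edge (Sum.inl (G.opp k))) :=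
  ⟨k, hk, r⟩

/-- Cutting the corners at two crossings of a triangle and opening the third gives the same
connection, whichever crossing is the third. -/
theorem stateSum_triangle_cancel (hΦ : ∀ H H', Isomorphic H H' → Φ H → Φ H')
    (t : G.Triangle a a' b b' c c') (hT : T = {G.vert a, G.vert b, G.vert c})
    {L M : Framing G.Crossing G.HalfEdge}
    (hL : G.framing.AgreesOff L T) (hM : G.framing.AgreesOff M T)
    (l1 : G.Pairs L a c') (l2 : G.Pairs L b a') (l3 : G.Pairs L c (G.opp b'))
    (m1 : G.Pairs M a c') (m2 : G.Pairs M b (G.opp a')) (m3 : G.Pairs M c b') :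
    stateSum Φ (G.refit L) (E \ T) T = stateSum Φ (G.refit M) (E \ T) T := by
  obtain ⟨I, hI⟩ : ∃ I : Set G.HalfEdge, I = {a, a', b, b', c, c'} := ⟨_, rfl⟩
  obtain ⟨i1, i2, i3, i4, i5, i6⟩ :
      a ∈ I ∧ a' ∈ I ∧ b ∈ I ∧ b' ∈ I ∧ c ∈ I ∧ c' ∈ I := by subst hI; simp
  obtain ⟨u1, u2, u3, u4, u5, u6⟩ := t.vert_mem_of_agreesOff hT hL
  obtain ⟨w1, w2, w3, w4, w5, w6⟩ := t.vert_mem_of_agreesOff hT hM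
  have e1 := t.edge_a
  have e2 := t.edge_b
  have e3 := t.edge_c
  have e4 := t.edge_a'
  have e5 := t.rotate.edge_a'
  have e6 := t.rotate.rotate.edge_a'
  obtain ⟨l11, l12, l13, l14⟩ := l1.values
  obtain ⟨l21, l22, l23, l24⟩ := l2.values
  obtain ⟨l31, l32, l33, l34⟩ := l3.values_opp
  obtain ⟨m11, m12, m13, m14⟩ := m1.values
  obtain ⟨m21, m22, m23, m24⟩ := m2.values_opp
  obtain ⟨m31, m32, m33, m34⟩ := m3.values
  refine stateSum_compare_triangle hΦ t hI hT hL hM (fun x hx => ?_) (fun x hx => ?_)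
  · rw [hI] at hx
    rcases hx with e | e | e | e | e | (e : x = c') <;> rw [e] <;>
    [refine ⟨c', i6, ?_, ?_⟩; refine ⟨b, i3, ?_, ?_⟩; refine ⟨a', i2, ?_, ?_⟩;
      refine ⟨c, i5, ?_, ?_⟩; refine ⟨b', i4, ?_, ?_⟩; refine ⟨a, i1, ?_, ?_⟩]
    all_goals first
      | exact run_border_refl (by assumption)
      | refine run_border (by assumption) (by assumption) ?_
        repeat first
          | exact run_last (by assumption) (by assumption)
          | refine run_step (by assumption) (by assumption) (by assumption) ?_
  · rw [hI] at hx
    rcases hx with e | e | e | e | e | (e : x = c') <;> rw [e] <;> constructor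
    all_goals
      apply exists_exit_intro
      · repeat first
          | exact run_last (by assumption) (by assumption)
          | refine run_step (by assumption) (by assumption) (by assumption) ?_
      · assumption

/-- Opening one crossing of a triangle and cutting the other two corners amounts to opening all
three crossings after the third move. -/
theorem stateSum_triangle_open_one (hΦ : ∀ H H', Isomorphic H H' → Φ H → Φ H')
    (t : G.Triangle a a' b b' c c') (hT : T = {G.vert a, G.vert b, G.vert c})
    {L M : Framing G.Crossing G.HalfEdge}
    (hL : G.framing.AgreesOff L T) (hM : G.framing.AgreesOff M T)
    (l1 : G.Pairs L a (G.opp c')) (l2 : G.Pairs L b a') (l3 : G.Pairs L c b')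
    (m1 : G.Pairs M a' (G.opp c)) (m2 : G.Pairs M b' (G.opp a)) (m3 : G.Pairs M c' (G.opp b)) :
    stateSum Φ (G.refit L) (E \ T) T = stateSum Φ (G.refit M) (E \ T) T := by
  obtain ⟨I, hI⟩ : ∃ I : Set G.HalfEdge, I = {a, a', b, b', c, c'} := ⟨_, rfl⟩
  obtain ⟨i1, i2, i3, i4, i5, i6⟩ :
      a ∈ I ∧ a' ∈ I ∧ b ∈ I ∧ b' ∈ I ∧ c ∈ I ∧ c' ∈ I := by subst hI; simp
  obtain ⟨u1, u2, u3, u4, u5, u6⟩ := t.vert_mem_of_agreesOff hT hL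
  obtain ⟨w1, w2, w3, w4, w5, w6⟩ := t.vert_mem_of_agreesOff hT hM
  have e1 := t.edge_a
  have e2 := t.edge_b
  have e3 := t.edge_c
  have e4 := t.edge_a'
  have e5 := t.rotate.edge_a'
  have e6 := t.rotate.rotate.edge_a'
  obtain ⟨l11, l12, l13, l14⟩ := l1.values_opp
  obtain ⟨l21, l22, l23, l24⟩ := l2.values
  obtain ⟨l31, l32, l33, l34⟩ := l3.values
  obtain ⟨m11, m12, m13, m14⟩ := m1.values_opp
  obtain ⟨m21, m22, m23, m24⟩ := m2.values_opp
  obtain ⟨m31, m32, m33, m34⟩ := m3.values_opp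
  refine stateSum_compare_triangle hΦ t hI hT hL hM (fun x hx => ?_) (fun x hx => ?_)
  · rw [hI] at hx
    rcases hx with e | e | e | e | e | (e : x = c') <;> rw [e] <;>
    [refine ⟨c', i6, ?_, ?_⟩; refine ⟨b, i3, ?_, ?_⟩; refine ⟨a', i2, ?_, ?_⟩;
      refine ⟨c, i5, ?_, ?_⟩; refine ⟨b', i4, ?_, ?_⟩; refine ⟨a, i1, ?_, ?_⟩]
    all_goals first
      | exact run_border_refl (by assumption)
      | refine run_border (by assumption) (by assumption) ?_
        repeat first
          | exact run_last (by assumption) (by assumption)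
          | refine run_step (by assumption) (by assumption) (by assumption) ?_
  · rw [hI] at hx
    rcases hx with e | e | e | e | e | (e : x = c') <;> rw [e] <;> constructor
    all_goals
      apply exists_exit_intro
      · repeat first
          | exact run_last (by assumption) (by assumption)
          | refine run_step (by assumption) (by assumption) (by assumption) ?_
      · assumption

/-- Opening two crossings of a triangle and cutting the third corner gives the same before and
after the third move. -/
theorem stateSum_triangle_open_two (hΦ : ∀ H H', Isomorphic H H' → Φ H → Φ H')
    (t : G.Triangle a a' b b' c c') (hT : T = {G.vert a, G.vert b, G.vert c})
    {L M : Framing G.Crossing G.HalfEdge}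
    (hL : G.framing.AgreesOff L T) (hM : G.framing.AgreesOff M T)
    (l1 : G.Pairs L a (G.opp c')) (l2 : G.Pairs L b (G.opp a')) (l3 : G.Pairs L c b')
    (m1 : G.Pairs M a' (G.opp c)) (m2 : G.Pairs M b' (G.opp a)) (m3 : G.Pairs M c' b) :
    stateSum Φ (G.refit L) (E \ T) T = stateSum Φ (G.refit M) (E \ T) T := by
  obtain ⟨I, hI⟩ : ∃ I : Set G.HalfEdge, I = {a, a', b, b', c, c'} := ⟨_, rfl⟩
  obtain ⟨i1, i2, i3, i4, i5, i6⟩ :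
      a ∈ I ∧ a' ∈ I ∧ b ∈ I ∧ b' ∈ I ∧ c ∈ I ∧ c' ∈ I := by subst hI; simp
  obtain ⟨u1, u2, u3, u4, u5, u6⟩ := t.vert_mem_of_agreesOff hT hL
  obtain ⟨w1, w2, w3, w4, w5, w6⟩ := t.vert_mem_of_agreesOff hT hM
  have e1 := t.edge_a
  have e2 := t.edge_b
  have e3 := t.edge_c
  have e4 := t.edge_a'
  have e5 := t.rotate.edge_a'
  have e6 := t.rotate.rotate.edge_a'
  obtain ⟨l11, l12, l13, l14⟩ := l1.values_opp
  obtain ⟨l21, l22, l23, l24⟩ := l2.values_opp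
  obtain ⟨l31, l32, l33, l34⟩ := l3.values
  obtain ⟨m11, m12, m13, m14⟩ := m1.values_opp
  obtain ⟨m21, m22, m23, m24⟩ := m2.values_opp
  obtain ⟨m31, m32, m33, m34⟩ := m3.values
  refine stateSum_compare_triangle hΦ t hI hT hL hM (fun x hx => ?_) (fun x hx => ?_)
  · rw [hI] at hx
    rcases hx with e | e | e | e | e | (e : x = c') <;> rw [e] <;>
    [refine ⟨a', i2, ?_, ?_⟩; refine ⟨a, i1, ?_, ?_⟩; refine ⟨c', i6, ?_, ?_⟩;
      refine ⟨c, i5, ?_, ?_⟩; refine ⟨b', i4, ?_, ?_⟩; refine ⟨b, i3, ?_, ?_⟩]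
    all_goals first
      | exact run_border_refl (by assumption)
      | refine run_border (by assumption) (by assumption) ?_
        repeat first
          | exact run_last (by assumption) (by assumption)
          | refine run_step (by assumption) (by assumption) (by assumption) ?_
  · rw [hI] at hx
    rcases hx with e | e | e | e | e | (e : x = c') <;> rw [e] <;> constructor
    all_goals
      apply exists_exit_intro
      · repeat first
          | exact run_last (by assumption) (by assumption)
          | refine run_step (by assumption) (by assumption) (by assumption) ?_
      · assumption

/-- Cutting one corner of a triangle while going straight on at the other two crossings gives the
same before and after the third move. -/
theorem stateSum_triangle_straight (hΦ : ∀ H H', Isomorphic H H' → Φ H → Φ H')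
    (t : G.Triangle a a' b b' c c') (hT : T = {G.vert a, G.vert b, G.vert c})
    {L M : Framing G.Crossing G.HalfEdge}
    (hL : G.framing.AgreesOff L T) (hM : G.framing.AgreesOff M T)
    (l1 : G.Pairs L a c') (l2 : L.opp b = G.opp b) (l3 : L.opp a' = G.opp a')
    (l4 : L.opp c = G.opp c) (l5 : L.opp b' = G.opp b')
    (m1 : G.Pairs M a' c) (m2 : M.opp a = G.opp a) (m3 : M.opp b' = G.opp b')
    (m4 : M.opp b = G.opp b) (m5 : M.opp c' = G.opp c') :
    stateSum Φ (G.refit L) (E \ T) T = stateSum Φ (G.refit M) (E \ T) T := by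
  obtain ⟨I, hI⟩ : ∃ I : Set G.HalfEdge, I = {a, a', b, b', c, c'} := ⟨_, rfl⟩
  obtain ⟨i1, i2, i3, i4, i5, i6⟩ :
      a ∈ I ∧ a' ∈ I ∧ b ∈ I ∧ b' ∈ I ∧ c ∈ I ∧ c' ∈ I := by subst hI; simp
  obtain ⟨u1, u2, u3, u4, u5, u6⟩ := t.vert_mem_of_agreesOff hT hL
  obtain ⟨w1, w2, w3, w4, w5, w6⟩ := t.vert_mem_of_agreesOff hT hM
  have e1 := t.edge_a
  have e2 := t.edge_b
  have e3 := t.edge_c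
  have e4 := t.edge_a'
  have e5 := t.rotate.edge_a'
  have e6 := t.rotate.rotate.edge_a'
  obtain ⟨l11, l12, l13, l14⟩ := l1.values
  obtain ⟨m11, m12, m13, m14⟩ := m1.values
  have ls1 : L.opp (G.opp b) = b := by rw [← l2, L.opp_opp]
  have ls2 : L.opp (G.opp a') = a' := by rw [← l3, L.opp_opp]
  have ls3 : L.opp (G.opp c) = c := by rw [← l4, L.opp_opp]
  have ls4 : L.opp (G.opp b') = b' := by rw [← l5, L.opp_opp]
  have ms1 : M.opp (G.opp a) = a := by rw [← m2, M.opp_opp]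
  have ms2 : M.opp (G.opp b') = b' := by rw [← m3, M.opp_opp]
  have ms3 : M.opp (G.opp b) = b := by rw [← m4, M.opp_opp]
  have ms4 : M.opp (G.opp c') = c' := by rw [← m5, M.opp_opp]
  refine stateSum_compare_triangle hΦ t hI hT hL hM (fun x hx => ?_) (fun x hx => ?_)
  · rw [hI] at hx
    rcases hx with e | e | e | e | e | (e : x = c') <;> rw [e] <;>
    [refine ⟨c', i6, ?_, ?_⟩; refine ⟨c, i5, ?_, ?_⟩; refine ⟨b', i4, ?_, ?_⟩;
      refine ⟨b, i3, ?_, ?_⟩; refine ⟨a', i2, ?_, ?_⟩; refine ⟨a, i1, ?_, ?_⟩]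
    all_goals first
      | exact run_border_refl (by assumption)
      | refine run_border (by assumption) (by assumption) ?_
        repeat first
          | exact run_last (by assumption) (by assumption)
          | refine run_step (by assumption) (by assumption) (by assumption) ?_
  · rw [hI] at hx
    rcases hx with e | e | e | e | e | (e : x = c') <;> rw [e] <;> constructor
    all_goals
      apply exists_exit_intro
      · repeat first
          | exact run_last (by assumption) (by assumption)
          | refine run_step (by assumption) (by assumption) (by assumption) ?_
      · assumption

end

/-! ### The third move -/

/-- The framing `M` of `G` is the result of the third move on the triangle: on each strand the
two crossings of the triangle are interchanged. -/
structure ThirdMoved (G : LongFramedGraph.{u}) (M : Framing G.Crossing G.HalfEdge)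
    (a a' b b' c c' : G.HalfEdge) : Prop where
  opp : M.opp = G.opp
  vert_a : M.vert a = G.vert a'
  vert_a' : M.vert a' = G.vert a
  vert_b : M.vert b = G.vert b'
  vert_b' : M.vert b' = G.vert b
  vert_c : M.vert c = G.vert c'
  vert_c' : M.vert c' = G.vert c
  off : ∀ x, x ∉ ({a, a', b, b', c, c'} : Set G.HalfEdge) →
    G.opp x ∉ ({a, a', b, b', c, c'} : Set G.HalfEdge) → M.vert x = G.vert x

section
variable {Φ : LongFramedGraph.{u} → Prop} {G : LongFramedGraph.{u}} {E T : Set G.Crossing}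
  {I : Set G.HalfEdge} {a a' b b' c c' : G.HalfEdge} {M : Framing G.Crossing G.HalfEdge}

theorem ThirdMoved.rotate (m : G.ThirdMoved M a a' b b' c c') : G.ThirdMoved M b b' c c' a a' := by
  have e : ({b, b', c, c', a, a'} : Set G.HalfEdge) = {a, a', b, b', c, c'} := by
    ext y; simp; tauto
  exact ⟨m.opp, m.vert_b, m.vert_b', m.vert_c, m.vert_c', m.vert_a, m.vert_a',
    by rw [e]; exact m.off⟩

theorem ThirdMoved.vert_opp (m : G.ThirdMoved M a a' b b' c c') (x : G.HalfEdge) :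
    M.vert (G.opp x) = M.vert x := by
  rw [← m.opp, M.vert_opp]

theorem ThirdMoved.triangle (m : G.ThirdMoved M a a' b b' c c')
    (t : G.Triangle a a' b b' c c') : (G.refit M).Triangle a' a b' b c' c := by
  refine ⟨t.edge_a', t.rotate.edge_a', t.rotate.rotate.edge_a', ?_, ?_, ?_, ?_, ?_, ?_, ?_, ?_, ?_⟩
  · exact m.vert_a.trans (t.vert_a'.trans m.vert_b'.symm)
  · exact m.vert_b.trans (t.vert_b'.trans m.vert_c'.symm)
  · exact m.vert_c.trans (t.vert_c'.trans m.vert_a'.symm)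
  · change M.vert a' ≠ M.vert b'
    rw [m.vert_a', m.vert_b']; exact t.ne_ab
  · change M.vert b' ≠ M.vert c'
    rw [m.vert_b', m.vert_c']; exact t.ne_bc
  · change M.vert c' ≠ M.vert a'
    rw [m.vert_a', m.vert_c']; exact t.ne_ca
  · change b' ≠ M.opp a
    rw [m.opp]
    exact fun e => t.ne_ca (by rw [← t.vert_b', e, G.vert_opp])
  · change c' ≠ M.opp b
    rw [m.opp]
    exact fun e => t.ne_ab (by rw [← t.vert_c', e, G.vert_opp])
  · change a' ≠ M.opp c
    rw [m.opp]
    exact fun e => t.ne_bc (by rw [← t.vert_a', e, G.vert_opp])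

theorem ThirdMoved.agreesOff (m : G.ThirdMoved M a a' b b' c c')
    (t : G.Triangle a a' b b' c c') (hT : T = {G.vert a, G.vert b, G.vert c}) :
    G.framing.AgreesOff M T := by
  obtain ⟨v1, v2, v3, v4, v5, v6⟩ := t.vert_mem hT
  have hin : ∀ x ∈ ({a, a', b, b', c, c'} : Set G.HalfEdge), G.vert x ∈ T ∧ M.vert x ∈ T := by
    rintro x (e | e | e | e | e | (e : x = c')) <;> rw [e]
    · rw [m.vert_a]; exact ⟨v1, v2⟩
    · rw [m.vert_a']; exact ⟨v2, v1⟩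
    · rw [m.vert_b]; exact ⟨v3, v4⟩
    · rw [m.vert_b']; exact ⟨v4, v3⟩
    · rw [m.vert_c]; exact ⟨v5, v6⟩
    · rw [m.vert_c']; exact ⟨v6, v5⟩
  have key : ∀ x, (G.vert x ∈ T ∧ M.vert x ∈ T) ∨ M.vert x = G.vert x := by
    intro x
    by_cases h1 : x ∈ ({a, a', b, b', c, c'} : Set G.HalfEdge)
    · exact Or.inl (hin x h1)
    · by_cases h2 : G.opp x ∈ ({a, a', b, b', c, c'} : Set G.HalfEdge)
      · have := hin _ h2
        rw [G.vert_opp, m.vert_opp] at this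
        exact Or.inl this
      · exact Or.inr (m.off x h1 h2)
  refine ⟨fun x => ?_, fun x hx => ?_, fun x _ => congrFun m.opp x⟩
  · rcases key x with ⟨h1, h2⟩ | h
    · exact ⟨fun _ => h1, fun _ => h2⟩
    · rw [h]; rfl
  · rcases key x with ⟨h1, h2⟩ | h
    · exact absurd h1 hx
    · exact h

/-- The sum over the eight smoothings of the crossings of a triangle. -/
theorem stateSum_split_triangle (t : G.Triangle a a' b b' c c')
    (hT : T = {G.vert a, G.vert b, G.vert c}) (hE : T ⊆ E) :
    ∃ K : Bool → Bool → Bool → Framing G.Crossing G.HalfEdge,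
      (∀ i j k, (K i j k).vert = G.vert) ∧
      (∀ i j k x, G.vert x ∉ T → (K i j k).opp x = G.opp x) ∧
      (∀ i j k, G.Pairs (K i j k) a (bif i then G.opp c' else c')) ∧
      (∀ i j k, G.Pairs (K i j k) b (bif j then G.opp a' else a')) ∧
      (∀ i j k, G.Pairs (K i j k) c (bif k then G.opp b' else b')) ∧
      ∀ s : Bool → Bool → Bool → ZMod 2,
        (∀ i j k, s i j k = stateSum Φ (G.refit (K i j k)) (E \ T : Set G.Crossing) T) →
        stateSum Φ G E ∅ =
          s false false false + s false false true + (s false true false + s false true true) +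
          (s true false false + s true false true + (s true true false + s true true true)) := by
  have ha : G.vert a ∈ E := hE (t.vert_mem hT).1
  have hb : G.vert b ∈ E := hE (t.vert_mem hT).2.2.1
  have hc : G.vert c ∈ E := hE (t.vert_mem hT).2.2.2.2.1
  have hT' :
      (insert (G.vert c) (insert (G.vert b) (insert (G.vert a) ∅)) : Set G.Crossing) = T := by
    rw [hT]; ext x; simp; tauto
  have hET : ((E \ {G.vert a}) \ {G.vert b}) \ {G.vert c} = E \ T := by
    ext x; simp [hT]; tauto
  obtain ⟨F, hF, hFo, hFp, hFs⟩ := stateSum_split (Φ := Φ) (S := ∅) ha rfl t.vert_c' t.ne_c'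
    t.opp_a
  have := fun i => stateSum_split_refit (Φ := Φ) (E := E \ {G.vert a})
    (S := insert (G.vert a) ∅) (hF i) (c := G.vert b)
    (fun x hx => hFo i x (by rw [hx]; exact t.ne_ab.symm)) ⟨hb, t.ne_ab.symm⟩ rfl t.vert_a'
    t.rotate.ne_c' t.rotate.opp_a
  choose K hK hKo hKp hKs using this
  have := fun i j => stateSum_split_refit (Φ := Φ) (E := (E \ {G.vert a}) \ {G.vert b})
    (S := insert (G.vert b) (insert (G.vert a) ∅)) (hK i j) (c := G.vert c)
    (fun x hx => (hKo i j x (by rw [hx]; exact t.ne_bc.symm)).trans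
      (hFo i x (by rw [hx]; exact t.ne_ca)))
    ⟨⟨hc, t.ne_ca⟩, t.ne_bc.symm⟩ rfl t.vert_b' t.rotate.rotate.ne_c' t.rotate.rotate.opp_a
  choose L hL hLo hLp hLs using this
  refine ⟨L, hL, fun i j k x hx => ?_, fun i j k => ⟨?_, ?_⟩, fun i j k => ⟨?_, ?_⟩, hLp,
    fun s hs => ?_⟩
  · have hx' : ¬ (G.vert x = G.vert a ∨ G.vert x = G.vert b ∨ G.vert x = G.vert c) := by
      simpa [hT] using hx
    rw [not_or, not_or] at hx'
    rw [hLo i j k x hx'.2.2, hKo i j x hx'.2.1, hFo i x hx'.1]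
  · rw [hLo i j k _ t.ne_ca.symm, hKo i j _ t.ne_ab, (hFp i).1]
  · rw [hLo i j k _ (by rw [G.vert_opp]; exact t.ne_ca.symm),
      hKo i j _ (by rw [G.vert_opp]; exact t.ne_ab), (hFp i).2]
  · rw [hLo i j k _ t.ne_bc, (hKp i j).1]
  · rw [hLo i j k _ (by rw [G.vert_opp]; exact t.ne_bc), (hKp i j).2]
  · rw [hFs, hKs, hKs, hLs, hLs, hLs, hLs, hET, hT']
    simp only [hs]

theorem agreesOff_of_vert_eq {F : Framing G.Crossing G.HalfEdge} (hF : F.vert = G.vert)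
    (ho : ∀ x, G.vert x ∉ T → F.opp x = G.opp x) : G.framing.AgreesOff F T :=
  ⟨fun x => by rw [hF]; rfl, fun x _ => by rw [hF]; rfl, ho⟩

theorem pairs_refit_iff {F : Framing G.Crossing G.HalfEdge} (hM : M.opp = G.opp)
    {x y : G.HalfEdge} : (G.refit M).Pairs F x y ↔ G.Pairs F x y := by
  unfold Pairs
  change F.opp x = y ∧ F.opp (M.opp x) = M.opp y ↔ _
  rw [hM]

/-- Cutting all corners of a triangle splits off a circle. -/
theorem stateSum_triangle_circle (t : G.Triangle a a' b b' c c')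
    (hT : T = {G.vert a, G.vert b, G.vert c}) {L : Framing G.Crossing G.HalfEdge}
    (hL : G.framing.AgreesOff L T)
    (l1 : G.Pairs L a c') (l2 : G.Pairs L b a') (l3 : G.Pairs L c b') :
    stateSum Φ (G.refit L) (E \ T) T = 0 := by
  refine stateSum_eq_zero Set.disjoint_sdiff_left
    (not_noCircle (P := {a', b', c'}) (x := a') (by simp) ?_)
  obtain ⟨u1, u2, u3, u4, u5, u6⟩ := t.vert_mem_of_agreesOff hT hL
  rintro x (e | e | (e : x = c')) <;> rw [e]
  · exact ⟨u2, b', by simp, by rw [l2.symm.1, t.edge_b]⟩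
  · exact ⟨u4, c', by simp, by rw [l3.symm.1, t.edge_c]⟩
  · exact ⟨u6, a', by simp, by rw [l1.symm.1, t.edge_a]⟩

/-- Invariance under the third move if all three crossings are smoothed. On both sides the state
with three cut corners contains a circle, and of the three states with two cut corners, which
are all equal, two cancel. The remaining one equals the state with three open corners on the other
side, and the states with one cut corner correspond to each other. -/
theorem stateSum_moveThree_smoothed (hΦ : ∀ H H', Isomorphic H H' → Φ H → Φ H')
    (t : G.Triangle a a' b b' c c') (m : G.ThirdMoved M a a' b b' c c')
    (hT : T = {G.vert a, G.vert b, G.vert c}) (hE : T ⊆ E) :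
    stateSum Φ G E ∅ = stateSum Φ (G.refit M) E ∅ := by
  have t' := m.triangle t
  have hT' : T = {(G.refit M).vert a', (G.refit M).vert b', (G.refit M).vert c'} := by
    change T = {M.vert a', M.vert b', M.vert c'}
    rw [m.vert_a', m.vert_b', m.vert_c', hT]
  have hM := m.agreesOff t hT
  obtain ⟨K, hK, hKo, k1, k2, k3, hs⟩ := stateSum_split_triangle (Φ := Φ) t hT hE
  obtain ⟨L, hL, hLo, l1, l2, l3, hs'⟩ := stateSum_split_triangle (Φ := Φ) t' hT' hE
  have hKa := fun i j k => agreesOff_of_vert_eq (hK i j k) (hKo i j k)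
  have hLa' : ∀ i j k, M.AgreesOff (L i j k) T := fun i j k =>
    agreesOff_of_vert_eq (G := G.refit M) (hL i j k) (hLo i j k)
  have hLa := fun i j k => hM.trans (hLa' i j k)
  have hKa' := fun i j k => hM.symm.trans (hKa i j k)
  have e1 : (G.refit M).opp = G.opp := m.opp
  have hp : ∀ (F : Framing G.Crossing G.HalfEdge) (x y : G.HalfEdge),
      (G.refit M).Pairs F x y ↔ G.Pairs F x y := fun _ _ _ => pairs_refit_iff m.opp
  have q1 := fun i j k => (hp _ _ _).1 (l1 i j k)
  have q2 := fun i j k => (hp _ _ _).1 (l2 i j k)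
  have q3 := fun i j k => (hp _ _ _).1 (l3 i j k)
  have r1 := fun i j k => (hp _ _ _).2 (k1 i j k)
  have r2 := fun i j k => (hp _ _ _).2 (k2 i j k)
  have r3 := fun i j k => (hp _ _ _).2 (k3 i j k)
  rw [e1] at q1 q2 q3
  rw [hs _ (fun i j k => rfl), hs' _ (fun i j k => rfl)]
  have z := stateSum_triangle_circle (Φ := Φ) (E := E) t hT (hKa _ _ _) (k1 false false false)
    (k2 false false false) (k3 false false false)
  have z' : stateSum Φ (G.refit (L false false false)) (E \ T) T = 0 :=
    stateSum_triangle_circle (Φ := Φ) (G := G.refit M) (E := E) t' hT' (hLa' _ _ _)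
      (l1 false false false) (l2 false false false) (l3 false false false)
  have c0 := stateSum_triangle_cancel (E := E) hΦ t hT (hKa _ _ _) (hKa _ _ _)
    (k1 false false true) (k2 false false true) (k3 false false true)
    (k1 false true false) (k2 false true false) (k3 false true false)
  have c1 : stateSum Φ (G.refit (L false false true)) (E \ T) T =
      stateSum Φ (G.refit (L false true false)) (E \ T) T :=
    stateSum_triangle_cancel (G := G.refit M) (E := E) hΦ t' hT' (hLa' _ _ _) (hLa' _ _ _)
      (l1 false false true) (l2 false false true) (l3 false false true)
      (l1 false true false) (l2 false true false) (l3 false true false)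
  have o0 := stateSum_triangle_open_one (E := E) hΦ t hT (hKa _ _ _) (hLa _ _ _)
    (k1 true false false) (k2 true false false) (k3 true false false)
    (q1 true true true) (q2 true true true) (q3 true true true)
  have o1 : stateSum Φ (G.refit (L true false false)) (E \ T) T =
      stateSum Φ (G.refit (K true true true)) (E \ T) T :=
    stateSum_triangle_open_one (G := G.refit M) (E := E) hΦ t' hT' (hLa' _ _ _) (hKa' _ _ _)
      (l1 true false false) (l2 true false false) (l3 true false false)
      (by rw [e1]; exact r1 true true true) (by rw [e1]; exact r2 true true true)
      (by rw [e1]; exact r3 true true true)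
  have w0 := stateSum_triangle_open_two (E := E) hΦ t hT (hKa _ _ _) (hLa _ _ _)
    (k1 true true false) (k2 true true false) (k3 true true false)
    (q1 true true false) (q2 true true false) (q3 true true false)
  have w1 := stateSum_triangle_open_two (E := E) hΦ t.rotate
    (by rw [hT]; ext x; simp; tauto) (hKa _ _ _) (hLa _ _ _)
    (k2 false true true) (k3 false true true) (k1 false true true)
    (q2 false true true) (q3 false true true) (q1 false true true)
  have w2 := stateSum_triangle_open_two (E := E) hΦ t.rotate.rotate
    (by rw [hT]; ext x; simp; tauto) (hKa _ _ _) (hLa _ _ _)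
    (k3 true false true) (k1 true false true) (k2 true false true)
    (q3 true false true) (q1 true false true) (q2 true false true)
  have h2 : ∀ x : ZMod 2, x + x = 0 := CharTwo.add_self_eq_zero
  rw [z, c0, o0, w0, w1, w2]
  change _ = stateSum Φ (G.refit (L false false false)) (E \ T) T +
      stateSum Φ (G.refit (L false false true)) (E \ T) T +
      (stateSum Φ (G.refit (L false true false)) (E \ T) T +
        stateSum Φ (G.refit (L false true true)) (E \ T) T) +
      (stateSum Φ (G.refit (L true false false)) (E \ T) T +
        stateSum Φ (G.refit (L true false true)) (E \ T) T +
      (stateSum Φ (G.refit (L true true false)) (E \ T) T +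
        stateSum Φ (G.refit (L true true true)) (E \ T) T))
  rw [z', c1, o1]
  linear_combination h2 (stateSum Φ (G.refit (K false true false)) (E \ T) T) -
    h2 (stateSum Φ (G.refit (L false true false)) (E \ T) T)

end

/-! ### The third move with one smoothed crossing -/

section
variable {Φ : LongFramedGraph.{u} → Prop} {G : LongFramedGraph.{u}} {E T : Set G.Crossing}
  {I : Set G.HalfEdge} {a a' b b' c c' : G.HalfEdge} {M : Framing G.Crossing G.HalfEdge}

/-- If one corner of a triangle is cut, the other two crossings form a bigon. -/
theorem stateSum_triangle_bigon (hΦ : SecondMoveInvariant Φ) (t : G.Triangle a a' b b' c c')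
    (hT : T = {G.vert a, G.vert b, G.vert c}) (hb : G.vert b ∉ E) (hc : G.vert c ∉ E)
    {L : Framing G.Crossing G.HalfEdge} (hL : L.vert = G.vert)
    (hLo : ∀ x, G.vert x ≠ G.vert a → L.opp x = G.opp x) (l : G.Pairs L a c') :
    stateSum Φ (G.refit L) (E \ {G.vert a} : Set G.Crossing) ({G.vert a} : Set G.Crossing) =
      stateSum Φ (G.refit L) (E \ T : Set G.Crossing) T := by
  have hv : ∀ x, (G.refit L).vert x = G.vert x := fun x => congrFun hL x
  have hbig := stateSum_bigon (G := G.refit L) (E := (E \ {G.vert a} : Set G.Crossing))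
    (S := ({G.vert a} : Set G.Crossing)) hΦ (v := G.vert b) (w := G.vert c) t.ne_bc
    (fun h => hb h.1) (fun h => hc h.1) t.ne_ab.symm t.ne_ca Set.disjoint_sdiff_left
    (h := a') (k := b) (h' := c) (k' := b') ((hv a').trans t.vert_a') (hv b) t.rotate.ne_c'
    (by
      change b ≠ L.opp a'
      rw [hLo _ (by rw [t.vert_a']; exact t.ne_ab.symm)]
      exact t.opp_a')
    (hv c) ((hv b').trans t.vert_b')
    (by
      change b' ≠ L.opp c
      rw [hLo _ t.ne_ca]
      exact t.rotate.rotate.opp_a)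
    (by
      change (G.refit L).Run _ (G.edge (Sum.inl a')) _
      rw [t.edge_a']
      exact run_step (by rw [hL]; rfl) l.1 t.rotate.rotate.edge_a' Relation.ReflTransGen.refl)
    (by
      change (G.refit L).Run _ (G.edge (Sum.inl b)) _
      rw [t.edge_b]
      exact Relation.ReflTransGen.refl)
  have e1 : ({G.vert a} ∪ {G.vert b, G.vert c} : Set G.Crossing) = T := by
    rw [hT]; rfl
  have e2 : (E \ {G.vert a} : Set G.Crossing) = E \ T := by
    ext x
    by_cases hxb : x = G.vert b
    · simp [hxb, hb]
    · by_cases hxc : x = G.vert c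
      · simp [hxc, hc]
      · simp [hT, hxb, hxc]
  rw [hbig, ← e2]
  congr 1

/-- A permutation interchanging two pairs of opposite half-edges. -/
theorem exists_swap_pairs {x y : G.HalfEdge} (h1 : y ≠ x) (h2 : y ≠ G.opp x) :
    ∃ τ : Equiv.Perm G.HalfEdge, τ x = y ∧ τ y = x ∧ τ (G.opp x) = G.opp y ∧
      τ (G.opp y) = G.opp x ∧
      ∀ z, z ≠ x → z ≠ G.opp x → z ≠ y → z ≠ G.opp y → τ z = z := by
  classical
  have h3 : G.opp y ≠ x := fun e => h2 (by rw [← e, G.opp_opp])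
  have h4 : G.opp y ≠ G.opp x := fun e => h1 (G.opp_injective e)
  have h5 := G.opp_ne x
  have h6 := G.opp_ne y
  refine ⟨Equiv.swap x y * Equiv.swap (G.opp x) (G.opp y), ?_, ?_, ?_, ?_, ?_⟩
  · rw [Equiv.Perm.mul_apply, Equiv.swap_apply_of_ne_of_ne h5.symm h3.symm, Equiv.swap_apply_left]
  · rw [Equiv.Perm.mul_apply, Equiv.swap_apply_of_ne_of_ne h2 h6.symm, Equiv.swap_apply_right]
  · rw [Equiv.Perm.mul_apply, Equiv.swap_apply_left, Equiv.swap_apply_of_ne_of_ne h3 h6]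
  · rw [Equiv.Perm.mul_apply, Equiv.swap_apply_right, Equiv.swap_apply_of_ne_of_ne h5 h2.symm]
  · intro z z1 z2 z3 z4
    rw [Equiv.Perm.mul_apply, Equiv.swap_apply_of_ne_of_ne z2 z4,
      Equiv.swap_apply_of_ne_of_ne z1 z3]

/-- A permutation interchanging the pair of opposite half-edges at `x` with the one at `y`, and
the one at `z` with the one at `w`. -/
theorem exists_swap_two_pairs {x y z w : G.HalfEdge} (xy : y ≠ x) (xy' : y ≠ G.opp x)
    (zw : w ≠ z) (zw' : w ≠ G.opp z) (xz : x ≠ z) (xz' : x ≠ G.opp z) (xw : x ≠ w)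
    (xw' : x ≠ G.opp w) (yz : y ≠ z) (yz' : y ≠ G.opp z) (yw : y ≠ w) (yw' : y ≠ G.opp w) :
    ∃ τ : Equiv.Perm G.HalfEdge,
      (τ x = y ∧ τ y = x ∧ τ (G.opp x) = G.opp y ∧ τ (G.opp y) = G.opp x) ∧
      (τ z = w ∧ τ w = z ∧ τ (G.opp z) = G.opp w ∧ τ (G.opp w) = G.opp z) ∧
      ∀ u, u ≠ x → u ≠ G.opp x → u ≠ y → u ≠ G.opp y → u ≠ z → u ≠ G.opp z → u ≠ w →
        u ≠ G.opp w → τ u = u := by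
  obtain ⟨σ, s1, s2, s3, s4, s5⟩ := exists_swap_pairs xy xy'
  obtain ⟨ρ, r1, r2, r3, r4, r5⟩ := exists_swap_pairs zw zw'
  have o : ∀ {p q : G.HalfEdge}, p ≠ q → G.opp p ≠ G.opp q := fun h e => h (G.opp_injective e)
  have o1 : ∀ {p q : G.HalfEdge}, p ≠ G.opp q → G.opp p ≠ q := fun h e =>
    h (by rw [← e, G.opp_opp])
  have o2 : ∀ {p q : G.HalfEdge}, p ≠ G.opp q → q ≠ G.opp p := fun h e =>
    h (by rw [e, G.opp_opp])
  refine ⟨σ * ρ, ⟨?_, ?_, ?_, ?_⟩, ⟨?_, ?_, ?_, ?_⟩, ?_⟩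
  · rw [Equiv.Perm.mul_apply, r5 x xz xz' xw xw', s1]
  · rw [Equiv.Perm.mul_apply, r5 y yz yz' yw yw', s2]
  · rw [Equiv.Perm.mul_apply, r5 _ (o1 xz') (o xz) (o1 xw') (o xw), s3]
  · rw [Equiv.Perm.mul_apply, r5 _ (o1 yz') (o yz) (o1 yw') (o yw), s4]
  · rw [Equiv.Perm.mul_apply, r1, s5 w xw.symm (o2 xw') yw.symm (o2 yw')]
  · rw [Equiv.Perm.mul_apply, r2, s5 z xz.symm (o2 xz') yz.symm (o2 yz')]
  · rw [Equiv.Perm.mul_apply, r3, s5 _ (o1 (o2 xw')) (o xw.symm) (o1 (o2 yw')) (o yw.symm)]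
  · rw [Equiv.Perm.mul_apply, r4, s5 _ (o1 (o2 xz')) (o xz.symm) (o1 (o2 yz')) (o yz.symm)]
  · intro u u1 u2 u3 u4 u5 u6 u7 u8
    rw [Equiv.Perm.mul_apply, r5 u u5 u6 u7 u8, s5 u u1 u2 u3 u4]

/-- The matching of half-edges that slides two crossings of a triangle along the strands through
the third one. -/
theorem Triangle.exists_slide (t : G.Triangle a a' b b' c c') :
    ∃ τ : Equiv.Perm G.HalfEdge,
      (τ a = G.opp c ∧ τ (G.opp a) = c ∧ τ c' = G.opp a' ∧ τ (G.opp c') = a') ∧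
      (τ b = b ∧ τ (G.opp b) = G.opp b ∧ τ a' = G.opp c' ∧ τ (G.opp a') = c') ∧
      (τ c = G.opp a ∧ τ (G.opp c) = a ∧ τ b' = b' ∧ τ (G.opp b') = G.opp b') ∧
      ∀ x, G.vert x ≠ G.vert a → G.vert x ≠ G.vert b → G.vert x ≠ G.vert c → τ x = x := by
  have vo := G.vert_opp
  have va' := t.vert_a'
  have vb' := t.vert_b'
  have vc' := t.vert_c'
  have nab := t.ne_ab
  have nbc := t.ne_bc
  have nca := t.ne_ca
  have hne : ∀ x y, G.vert x ≠ G.vert y → x ≠ y := fun x y h e => h (by rw [e])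
  obtain ⟨τ, ⟨t1, t8, t2, t7⟩, ⟨t3, t6, t4, t5⟩, t9⟩ := exists_swap_two_pairs (G := G)
    (x := a') (y := G.opp c') (z := c) (w := G.opp a)
    (hne _ _ (by rw [vo, vc', va']; exact nab)) (hne _ _ (by rw [vo, vc', vo, va']; exact nab))
    (hne _ _ (by rw [vo]; exact nca.symm)) (hne _ _ (by rw [vo, vo]; exact nca.symm))
    (hne _ _ (by rw [va']; exact nbc)) (hne _ _ (by rw [va', vo]; exact nbc))
    (hne _ _ (by rw [va', vo]; exact nab.symm)) (hne _ _ (by rw [va', vo, vo]; exact nab.symm))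
    (hne _ _ (by rw [vo, vc']; exact nca.symm)) (hne _ _ (by rw [vo, vc', vo]; exact nca.symm))
    (fun e => t.ne_c' (G.opp_injective e)) (by rw [G.opp_opp]; exact t.opp_c'.symm)
  rw [G.opp_opp] at t2 t4 t5 t7
  simp only [G.opp_opp] at t9
  have b1 : b ≠ a' := t.rotate.ne_c'.symm
  have b2 : b ≠ G.opp a' := t.opp_a'
  have b3 : b' ≠ c := t.rotate.rotate.ne_c'
  have b4 : b' ≠ G.opp c := t.rotate.rotate.opp_a
  have bo : ∀ {x y}, x ≠ G.opp y → G.opp x ≠ y := fun h e => h (by rw [← e, G.opp_opp])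
  have bo' : ∀ {x y}, x ≠ y → G.opp x ≠ G.opp y := fun h e => h (G.opp_injective e)
  have hne' : ∀ {x}, G.vert x ≠ G.vert a → x ≠ a ∧ x ≠ G.opp a ∧ x ≠ c' ∧ x ≠ G.opp c' :=
    fun {x} h => ⟨hne _ _ h, hne _ _ (by rwa [vo]), hne _ _ (by rwa [vc']),
      hne _ _ (by rwa [vo, vc'])⟩
  have tb : ∀ x, G.vert x = G.vert b → x ≠ a' → x ≠ G.opp a' → τ x = x := by
    intro x hx h1 h2
    obtain ⟨n1, n2, n3, n4⟩ := hne' (x := x) (by rw [hx]; exact nab.symm)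
    exact t9 x h1 h2 n4 n3 (hne _ _ (by rw [hx]; exact nbc))
      (hne _ _ (by rw [hx, vo]; exact nbc)) n2 n1
  have tc : ∀ x, G.vert x = G.vert c → x ≠ c → x ≠ G.opp c → τ x = x := by
    intro x hx h1 h2
    obtain ⟨n1, n2, n3, n4⟩ := hne' (x := x) (by rw [hx]; exact nca)
    exact t9 x (hne _ _ (by rw [hx, va']; exact nbc.symm))
      (hne _ _ (by rw [hx, vo, va']; exact nbc.symm)) n4 n3 h1 h2 n2 n1
  have tb1 : τ b = b := tb b rfl b1 b2
  have tb2 : τ (G.opp b) = G.opp b := tb _ (vo b) (bo b2) (bo' b1)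
  have tb3 : τ b' = b' := tc b' vb' b3 b4
  have tb4 : τ (G.opp b') = G.opp b' := tc _ ((vo b').trans vb') (bo b4) (bo' b3)
  have toff : ∀ x, G.vert x ≠ G.vert a → G.vert x ≠ G.vert b → G.vert x ≠ G.vert c → τ x = x := by
    intro x h1 h2 h3
    obtain ⟨n1, n2, n3, n4⟩ := hne' (x := x) h1
    exact t9 x (hne _ _ (by rwa [va'])) (hne _ _ (by rwa [vo, va'])) n4 n3 (hne _ _ h3)
      (hne _ _ (by rwa [vo])) n2 n1
  exact ⟨τ, ⟨t5, t6, t7, t8⟩, ⟨tb1, tb2, t1, t2⟩, ⟨t3, t4, tb3, tb4⟩, toff⟩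

theorem Triangle.halfEdge_cases (t : G.Triangle a a' b b' c c') (x : G.HalfEdge) :
    (x = a ∨ x = G.opp a ∨ x = c' ∨ x = G.opp c') ∨
      (x = b ∨ x = G.opp b ∨ x = a' ∨ x = G.opp a') ∨
      (x = c ∨ x = G.opp c ∨ x = b' ∨ x = G.opp b') ∨
      (G.vert x ≠ G.vert a ∧ G.vert x ≠ G.vert b ∧ G.vert x ≠ G.vert c) := by
  by_cases h1 : G.vert x = G.vert a
  · exact Or.inl (eq_of_vert_eq t.vert_c' t.ne_c' t.opp_a h1)
  · by_cases h2 : G.vert x = G.vert b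
    · exact Or.inr (Or.inl (eq_of_vert_eq t.vert_a' t.rotate.ne_c' t.rotate.opp_a h2))
    · by_cases h3 : G.vert x = G.vert c
      · exact Or.inr (Or.inr (Or.inl
          (eq_of_vert_eq t.vert_b' t.rotate.rotate.ne_c' t.rotate.rotate.opp_a h3)))
      · exact Or.inr (Or.inr (Or.inr ⟨h1, h2, h3⟩))

/-- If one corner of a triangle is opened and its crossing erased, the third move only
renames the other two crossings. The matching `τ` of the half-edges slides each of these two
crossings along the strand that passes the erased crossing. -/
theorem stateSum_triangle_slide (hΦ : ∀ H H', Isomorphic H H' → Φ H → Φ H')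
    (t : G.Triangle a a' b b' c c') (m : G.ThirdMoved M a a' b b' c c')
    (hb : G.vert b ∉ E) (hc : G.vert c ∉ E)
    {K L : Framing G.Crossing G.HalfEdge} (hK : K.vert = G.vert)
    (hKo : ∀ x, G.vert x ≠ G.vert a → K.opp x = G.opp x) (k : G.Pairs K a (G.opp c'))
    (hL : L.vert = M.vert) (hLo : ∀ x, M.vert x ≠ G.vert a → L.opp x = G.opp x)
    (l : G.Pairs L a' (G.opp c)) :
    stateSum Φ (G.refit K) (E \ {G.vert a} : Set G.Crossing) ({G.vert a} : Set G.Crossing) =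
      stateSum Φ (G.refit L) (E \ {G.vert a} : Set G.Crossing)
        ({G.vert a} : Set G.Crossing) := by
  classical
  obtain ⟨k1, k2, k3, k4⟩ := k.values_opp
  obtain ⟨l1, l2, l3, l4⟩ := l.values_opp
  have e1 := t.edge_a
  have e3 := t.edge_c
  have e4 := t.edge_a'
  have e6 := t.rotate.rotate.edge_a'
  have vo := G.vert_opp
  have mo := m.vert_opp
  have va' := t.vert_a'
  have vb' := t.vert_b'
  have vc' := t.vert_c'
  have nab := t.ne_ab
  have nbc := t.ne_bc
  have nca := t.ne_ca
  obtain ⟨τ, ⟨t1, t2, t3, t4⟩, ⟨t5, t6, t7, t8⟩, ⟨t9, t10, t11, t12⟩, t13⟩ := t.exists_slide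
  have M1 : M.vert a = G.vert b := m.vert_a.trans va'
  have M2 : M.vert a' = G.vert a := m.vert_a'
  have M3 : M.vert b = G.vert c := m.vert_b.trans vb'
  have M4 : M.vert b' = G.vert b := m.vert_b'
  have M5 : M.vert c = G.vert a := m.vert_c.trans vc'
  have M6 : M.vert c' = G.vert c := m.vert_c'
  have M7 : ∀ x, G.vert x ≠ G.vert a → G.vert x ≠ G.vert b → G.vert x ≠ G.vert c →
      M.vert x = G.vert x := fun x h1 h2 h3 =>
    (m.agreesOff t rfl).vert x (by
      simp only [Set.mem_insert_iff, Set.mem_singleton_iff, not_or]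
      exact ⟨h1, h2, h3⟩)
  have ψb : Equiv.swap (G.vert b) (G.vert c) (G.vert b) = G.vert c := Equiv.swap_apply_left _ _
  have ψc : Equiv.swap (G.vert b) (G.vert c) (G.vert c) = G.vert b := Equiv.swap_apply_right _ _
  have nab' := nab.symm
  have nbc' := nbc.symm
  have nca' := nca.symm
  -- Runs through the erased crossing are compared from darts outside the edges `a a'`, `c c'`.
  let Z : Set G.Dart := {z | ∀ k ∈ ({a, a', c, c'} : Set G.HalfEdge), z ≠ Sum.inl k}
  have hZe : ∀ k, k ∉ ({a, a', c, c'} : Set G.HalfEdge) → G.edge (Sum.inl k) ∈ Z := by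
    intro k hk j hj e
    apply hk
    rw [← G.edge_injective.eq_iff, G.edge_edge] at e
    rcases hj with rfl | rfl | rfl | (rfl : j = c')
    · rw [e1] at e; rw [Sum.inl_injective e]; simp
    · rw [e4] at e; rw [Sum.inl_injective e]; simp
    · rw [e3] at e; rw [Sum.inl_injective e]; simp
    · rw [e6] at e; rw [Sum.inl_injective e]; simp
  have hK' : ∀ x, K.vert x = G.vert x := congrFun hK
  have hL' : ∀ x, L.vert x = M.vert x := congrFun hL
  have uS : ∀ x, G.vert x = G.vert a → K.vert x ∈ ({G.vert a} : Set G.Crossing) :=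
    fun x hx => by rw [hK']; exact hx
  have wS : ∀ x, M.vert x = G.vert a → L.vert x ∈ ({G.vert a} : Set G.Crossing) :=
    fun x hx => by rw [hL']; exact hx
  have stay : ∀ x, G.vert x ≠ G.vert a → τ x = x →
      (∃ y, (G.refit K).Out ({G.vert a} : Set G.Crossing) y ∧
        (G.refit K).Run ({G.vert a} : Set G.Crossing) (Sum.inl x) y ∧
        (G.refit L).Run ({G.vert a} : Set G.Crossing) (id (Sum.inl x)) (Sum.map τ id y)) := by
    intro x hx hτ
    refine ⟨Sum.inl x, out_inl.2 ?_, Relation.ReflTransGen.refl, ?_⟩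
    · change K.vert x ∉ ({G.vert a} : Set G.Crossing)
      rw [hK']; exact hx
    · rw [Sum.map_inl, hτ]; exact Relation.ReflTransGen.refl
  -- Such a run passes the erased crossing at most once, and the exits match.
  have hZ : ∀ z ∈ Z, ∃ y, (G.refit K).Out ({G.vert a} : Set G.Crossing) y ∧
      (G.refit K).Run ({G.vert a} : Set G.Crossing) z y ∧
      (G.refit L).Run ({G.vert a} : Set G.Crossing) (id z) (Sum.map τ id y) := by
    rintro (x | e) hz
    · have out : ∀ y, G.vert y ≠ G.vert a →
          (G.refit K).Out ({G.vert a} : Set G.Crossing) (Sum.inl y) := fun y hy =>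
        out_inl.2 (by change K.vert y ∉ ({G.vert a} : Set G.Crossing); rw [hK']; exact hy)
      have bad : x ∉ ({a, a', c, c'} : Set G.HalfEdge) := fun h => hz x h rfl
      rcases t.halfEdge_cases x with (e | e | e | e) | (e | e | e | e) | (e | e | e | e) |
        ⟨h1, h2, h3⟩
      · exact absurd (by simp [e]) bad
      · subst e
        refine ⟨Sum.inl c, out c nca, run_step (uS _ (vo a)) k3 e6 Relation.ReflTransGen.refl, ?_⟩
        rw [Sum.map_inl, t9]; exact Relation.ReflTransGen.refl
      · exact absurd (by simp [e]) bad
      · subst e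
        refine ⟨Sum.inl a', out a' (by rw [va']; exact nab'),
          run_step (uS _ (by rw [vo, vc'])) k2 e1 Relation.ReflTransGen.refl, ?_⟩
        rw [Sum.map_inl, t7]; exact Relation.ReflTransGen.refl
      · subst e; exact stay _ nab' t5
      · subst e; exact stay _ (by rw [vo]; exact nab') t6
      · exact absurd (by simp [e]) bad
      · subst e
        refine ⟨Sum.inl (G.opp a'), out _ (by rw [vo, va']; exact nab'),
          Relation.ReflTransGen.refl, ?_⟩
        rw [Sum.map_inl, t8]
        exact run_step (wS _ (by rw [mo, M2])) l3 e3 Relation.ReflTransGen.refl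
      · exact absurd (by simp [e]) bad
      · subst e
        refine ⟨Sum.inl (G.opp c), out _ (by rw [vo]; exact nca),
          Relation.ReflTransGen.refl, ?_⟩
        rw [Sum.map_inl, t10]
        exact run_step (wS _ (by rw [mo, M5])) l2 e4 Relation.ReflTransGen.refl
      · subst e; exact stay _ (by rw [vb']; exact nca) t11
      · subst e; exact stay _ (by rw [vo, vb']; exact nca) t12
      · exact stay _ h1 (t13 x h1 h2 h3)
    · exact ⟨Sum.inr e, out_inr, Relation.ReflTransGen.refl, Relation.ReflTransGen.refl⟩
  -- The matching interchanges the crossings of `b` and `c` and respects opposite half-edges.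
  have hτS : ∀ h, L.vert (τ h) ∈ ({G.vert a} : Set G.Crossing) ↔
      K.vert h ∈ ({G.vert a} : Set G.Crossing) := by
    intro h
    rw [hK', hL', Set.mem_singleton_iff, Set.mem_singleton_iff]
    rcases t.halfEdge_cases h with (e | e | e | e) | (e | e | e | e) | (e | e | e | e) |
      ⟨h1, h2, h3⟩
    · rw [e, t1, mo, M5]
    · rw [e, t2, vo, M5]
    · rw [e, t3, mo, M2, vc']
    · rw [e, t4, vo, M2, vc']
    · rw [e, t5, M3]; exact iff_of_false nca nab'
    · rw [e, t6, mo, vo, M3]; exact iff_of_false nca nab'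
    · rw [e, t7, mo, M6, va']; exact iff_of_false nca nab'
    · rw [e, t8, M6, vo, va']; exact iff_of_false nca nab'
    · rw [e, t9, mo, M1]; exact iff_of_false nab' nca
    · rw [e, t10, M1, vo]; exact iff_of_false nab' nca
    · rw [e, t11, M4, vb']; exact iff_of_false nab' nca
    · rw [e, t12, mo, vo, M4, vb']; exact iff_of_false nab' nca
    · rw [t13 h h1 h2 h3, M7 h h1 h2 h3]
  have hτv : ∀ h, G.vert h ≠ G.vert a →
      L.vert (τ h) = Equiv.swap (G.vert b) (G.vert c) (G.vert h) := by
    intro h hh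
    rw [hL']
    rcases t.halfEdge_cases h with (e | e | e | e) | (e | e | e | e) | (e | e | e | e) |
      ⟨h1, h2, h3⟩
    · exact absurd (by rw [e]) hh
    · exact absurd (by rw [e, vo]) hh
    · exact absurd (by rw [e, vc']) hh
    · exact absurd (by rw [e, vo, vc']) hh
    · rw [e, t5, M3, ψb]
    · rw [e, t6, mo, vo, M3, ψb]
    · rw [e, t7, mo, M6, va', ψb]
    · rw [e, t8, M6, vo, va', ψb]
    · rw [e, t9, mo, M1, ψc]
    · rw [e, t10, M1, vo, ψc]
    · rw [e, t11, M4, vb', ψc]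
    · rw [e, t12, mo, vo, M4, vb', ψc]
    · rw [t13 h h1 h2 h3, M7 h h1 h2 h3, Equiv.swap_apply_of_ne_of_ne h2 h3]
  have hτo : ∀ h, G.vert h ≠ G.vert a → L.opp (τ h) = τ (K.opp h) := by
    intro h hh
    rw [hKo h hh, hLo (τ h) (by
      rw [← hL']
      exact fun e => hh (by rw [← hK']; exact (hτS h).1 e))]
    rcases t.halfEdge_cases h with (e | e | e | e) | (e | e | e | e) | (e | e | e | e) |
      ⟨h1, h2, h3⟩
    · exact absurd (by rw [e]) hh
    · exact absurd (by rw [e, vo]) hh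
    · exact absurd (by rw [e, vc']) hh
    · exact absurd (by rw [e, vo, vc']) hh
    · rw [e, t5, t6]
    · rw [e, t6, G.opp_opp, t5]
    · rw [e, t7, t8, G.opp_opp]
    · rw [e, t8, G.opp_opp, t7]
    · rw [e, t9, t10, G.opp_opp]
    · rw [e, t10, G.opp_opp, t9]
    · rw [e, t11, t12]
    · rw [e, t12, G.opp_opp, t11]
    · rw [t13 h h1 h2 h3, t13 (G.opp h) (by rwa [vo]) (by rwa [vo]) (by rwa [vo])]
  have hne : ∀ x y, G.vert x ≠ G.vert y → x ≠ y := fun x y h e => h (by rw [e])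
  have nI : ∀ k, k ≠ a → k ≠ a' → k ≠ c → k ≠ c' → k ∉ ({a, a', c, c'} : Set G.HalfEdge) := by
    rintro k h1 h2 h3 h4 (h | h | h | h)
    exacts [h1 h, h2 h, h3 h, h4 h]
  have z1 : G.edge (Sum.inl (G.opp c')) ∈ Z := hZe _ (nI _ t.opp_c'.symm
    (hne _ _ (by rw [vo, vc', va']; exact nab)) (hne _ _ (by rw [vo, vc']; exact nca'))
    (G.opp_ne _))
  have z2 : G.edge (Sum.inl (G.opp a)) ∈ Z := hZe _ (nI _ (G.opp_ne _)
    (hne _ _ (by rw [vo, va']; exact nab)) (hne _ _ (by rw [vo]; exact nca')) t.opp_a.symm)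
  have z3 : G.edge (Sum.inl (G.opp c)) ∈ Z := hZe _ (nI _
    (hne _ _ (by rw [vo]; exact nca)) (hne _ _ (by rw [vo, va']; exact nbc')) (G.opp_ne _)
    (hne _ _ (by rw [vo, vc']; exact nca)))
  have z4 : G.edge (Sum.inl (G.opp a')) ∈ Z := hZe _ (nI _
    (hne _ _ (by rw [vo, va']; exact nab')) (G.opp_ne _) (hne _ _ (by rw [vo, va']; exact nbc))
    (hne _ _ (by rw [vo, va', vc']; exact nab')))
  have direct : ∀ x, x ∉ ({a, a', c, c'} : Set G.HalfEdge) → τ x = x →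
      ∃ z ∈ Z, (G.refit K).Run ({G.vert a} : Set G.Crossing) (G.edge (Sum.inl x)) z ∧
        (G.refit L).Run ({G.vert a} : Set G.Crossing)
          (G.edge (Sum.map τ id (Sum.inl x))) (id z) := by
    intro x hx hτ
    refine ⟨_, hZe x hx, Relation.ReflTransGen.refl, ?_⟩
    rw [Sum.map_inl, hτ]
    exact Relation.ReflTransGen.refl
  have hstart : ∀ x, (G.refit K).Out ({G.vert a} : Set G.Crossing) x → ∃ z ∈ Z,
      (G.refit K).Run ({G.vert a} : Set G.Crossing) (G.edge x) z ∧
        (G.refit L).Run ({G.vert a} : Set G.Crossing) (G.edge (Sum.map τ id x)) (id z) := by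
    rintro (x | e) hx
    · have hx' : G.vert x ≠ G.vert a := by
        have : K.vert x ∉ ({G.vert a} : Set G.Crossing) := hx x rfl
        rwa [hK'] at this
      rcases t.halfEdge_cases x with (e | e | e | e) | (e | e | e | e) | (e | e | e | e) |
        ⟨h1, h2, h3⟩
      · exact absurd (by rw [e]) hx'
      · exact absurd (by rw [e, vo]) hx'
      · exact absurd (by rw [e, vc']) hx'
      · exact absurd (by rw [e, vo, vc']) hx'
      · subst e
        exact direct _ (nI _ (hne _ _ nab') t.rotate.ne_c'.symm (hne _ _ nbc)
          (hne _ _ (by rw [vc']; exact nab'))) t5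
      · subst e
        exact direct _ (nI _ (hne _ _ (by rw [vo]; exact nab'))
          (fun e => t.opp_a' (by rw [← e, G.opp_opp])) (hne _ _ (by rw [vo]; exact nbc))
          (hne _ _ (by rw [vo, vc']; exact nab'))) t6
      · subst e
        refine ⟨_, z1, ?_, ?_⟩
        · rw [e4]; exact run_last (uS _ rfl) k1
        · rw [Sum.map_inl, t7]; exact Relation.ReflTransGen.refl
      · subst e
        refine ⟨_, z4, Relation.ReflTransGen.refl, ?_⟩
        rw [Sum.map_inl, t8, e6]; exact run_last (wS _ M5) l4
      · subst e
        refine ⟨_, z2, ?_, ?_⟩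
        · rw [e3]; exact run_last (uS _ vc') k4
        · rw [Sum.map_inl, t9]; exact Relation.ReflTransGen.refl
      · subst e
        refine ⟨_, z3, Relation.ReflTransGen.refl, ?_⟩
        rw [Sum.map_inl, t10, e1]; exact run_last (wS _ M2) l1
      · subst e
        exact direct _ (nI _ (hne _ _ (by rw [vb']; exact nca))
          (hne _ _ (by rw [vb', va']; exact nbc')) t.rotate.rotate.ne_c'
          (hne _ _ (by rw [vb', vc']; exact nca))) t11
      · subst e
        exact direct _ (nI _ (hne _ _ (by rw [vo, vb']; exact nca))
          (hne _ _ (by rw [vo, vb', va']; exact nbc'))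
          (fun e => t.rotate.rotate.opp_a (by rw [← e, G.opp_opp]))
          (hne _ _ (by rw [vo, vb', vc']; exact nca))) t12
      · exact direct _ (nI _ (hne _ _ h1) (hne _ _ (by rwa [va'])) (hne _ _ h3)
          (hne _ _ (by rwa [vc']))) (t13 x h1 h2 h3)
    · refine ⟨G.edge (Sum.inr e), ?_, Relation.ReflTransGen.refl, Relation.ReflTransGen.refl⟩
      intro j hj e'
      have e2 := G.edge_edge (Sum.inr e)
      rw [e'] at e2
      rcases hj with rfl | rfl | rfl | (rfl : j = c')
      · rw [e1] at e2; cases e2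
      · rw [e4] at e2; cases e2
      · rw [e3] at e2; cases e2
      · rw [e6] at e2; cases e2
  have hnK : (G.refit K).NoCircle ({G.vert a} : Set G.Crossing) := by
    have hz' : ∀ z ∈ Z, ∃ y, (G.refit K).Out ({G.vert a} : Set G.Crossing) y ∧
        (G.refit K).Run ({G.vert a} : Set G.Crossing) z y := fun z hz => by
      obtain ⟨y, h1, h2, -⟩ := hZ z hz
      exact ⟨y, h1, h2⟩
    have halt : ∀ x, G.vert x ≠ G.vert a →
        ∃ y, (G.refit K).Out ({G.vert a} : Set G.Crossing) y ∧
          (G.refit K).Run ({G.vert a} : Set G.Crossing) (Sum.inl x) y := fun x hx =>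
      ⟨_, out_inl.2 (by change K.vert x ∉ ({G.vert a} : Set G.Crossing); rwa [hK']),
        Relation.ReflTransGen.refl⟩
    intro x
    by_cases hx : x ∈ Z
    · exact hz' x hx
    · obtain ⟨j, hj, rfl⟩ : ∃ j ∈ ({a, a', c, c'} : Set G.HalfEdge), x = Sum.inl j := by
        by_contra hc
        exact hx fun j hj e => hc ⟨j, hj, e⟩
      rcases hj with e | e | e | (e : j = c') <;> rw [e]
      · obtain ⟨y, hy, r⟩ := hz' _ z1
        exact ⟨y, hy, (run_last (uS _ rfl) k1).trans r⟩
      · exact halt _ (by rw [va']; exact nab')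
      · exact halt _ nca
      · obtain ⟨y, hy, r⟩ := hz' _ z2
        exact ⟨y, hy, (run_last (uS _ vc') k4).trans r⟩
  have hnL : (G.refit L).NoCircle ({G.vert a} : Set G.Crossing) := by
    have hz' : ∀ z ∈ Z, ∃ y, (G.refit L).Out ({G.vert a} : Set G.Crossing) y ∧
        (G.refit L).Run ({G.vert a} : Set G.Crossing) z y := fun z hz => by
      obtain ⟨y, h1, -, h2⟩ := hZ z hz
      refine ⟨_, ?_, h2⟩
      rcases y with y | y
      · exact out_inl.2 fun h => out_inl.1 h1 ((hτS y).1 h)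
      · exact out_inr
    have halt : ∀ x, M.vert x ≠ G.vert a →
        ∃ y, (G.refit L).Out ({G.vert a} : Set G.Crossing) y ∧
          (G.refit L).Run ({G.vert a} : Set G.Crossing) (Sum.inl x) y := fun x hx =>
      ⟨_, out_inl.2 (by change L.vert x ∉ ({G.vert a} : Set G.Crossing); rwa [hL']),
        Relation.ReflTransGen.refl⟩
    intro x
    by_cases hx : x ∈ Z
    · exact hz' x hx
    · obtain ⟨j, hj, rfl⟩ : ∃ j ∈ ({a, a', c, c'} : Set G.HalfEdge), x = Sum.inl j := by
        by_contra hc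
        exact hx fun j hj e => hc ⟨j, hj, e⟩
      rcases hj with e | e | e | (e : j = c') <;> rw [e]
      · exact halt _ (by rw [M1]; exact nab')
      · obtain ⟨y, hy, r⟩ := hz' _ z3
        exact ⟨y, hy, (run_last (wS _ M2) l1).trans r⟩
      · obtain ⟨y, hy, r⟩ := hz' _ z4
        exact ⟨y, hy, (run_last (wS _ M5) l4).trans r⟩
      · exact halt _ (by rw [M6]; exact nca)
  have hψ : ∀ x, Equiv.swap (G.vert b) (G.vert c) x = x ∨
      (Equiv.swap (G.vert b) (G.vert c) x = G.vert c ∧ x = G.vert b) ∨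
      (Equiv.swap (G.vert b) (G.vert c) x = G.vert b ∧ x = G.vert c) := by
    intro x
    by_cases h1 : x = G.vert b
    · rw [h1]; exact Or.inr (Or.inl ⟨ψb, rfl⟩)
    · by_cases h2 : x = G.vert c
      · rw [h2]; exact Or.inr (Or.inr ⟨ψc, rfl⟩)
      · exact Or.inl (Equiv.swap_apply_of_ne_of_ne h1 h2)
  have hK3 : ∀ h, K.vert h ∉ ({G.vert a} : Set G.Crossing) → G.vert h ≠ G.vert a := by
    intro h hh
    rwa [hK'] at hh
  refine stateSum_transfer (G := G.refit K) (G' := G.refit L) hΦ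
    (Equiv.swap (G.vert b) (G.vert c)) τ (fun x => ?_) hτS
    (fun h hh => (hτv h (hK3 h hh)).trans (congrArg _ (hK' h).symm)) (fun h hh => hτo h (hK3 h hh))
    (fun x y hx hy r => Run.transfer (G := G.refit K) (G' := G.refit L) (Z := Z)
      (ρ := id) (φ := Sum.map τ id)
      (fun z hz => Or.inl (hZ z hz)) hstart hx hy r) ⟨fun _ => hnL, fun _ => hnK⟩ (fun x => ?_)
    Set.disjoint_sdiff_left
  · rcases hψ x with h | ⟨h, h'⟩ | ⟨h, h'⟩
    · rw [h]
    · rw [h, h']; exact iff_of_false nca nab'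
    · rw [h, h']; exact iff_of_false nab' nca
  · rcases hψ x with h | ⟨h, h'⟩ | ⟨h, h'⟩
    · rw [h]
    · rw [h, h']; exact iff_of_false (fun e => hc e.1) (fun e => hb e.1)
    · rw [h, h']; exact iff_of_false (fun e => hb e.1) (fun e => hc e.1)

end

section
variable {Φ : LongFramedGraph.{u} → Prop} {G : LongFramedGraph.{u}} {E T : Set G.Crossing}
  {a a' b b' c c' : G.HalfEdge} {M : Framing G.Crossing G.HalfEdge}

/-- Invariance under the third move if exactly one crossing, that of `a` and `c'`, is smoothed:
one smoothing makes the other two crossings a bigon, the other one lets them slide. -/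
theorem stateSum_moveThree_one (hΦ : SecondMoveInvariant Φ)
    (t : G.Triangle a a' b b' c c') (m : G.ThirdMoved M a a' b b' c c')
    (ha : G.vert a ∈ E) (hb : G.vert b ∉ E) (hc : G.vert c ∉ E) :
    stateSum Φ G E ∅ = stateSum Φ (G.refit M) E ∅ := by
  obtain ⟨T, hT⟩ : ∃ T : Set G.Crossing, T = {G.vert a, G.vert b, G.vert c} := ⟨_, rfl⟩
  have t' := m.triangle t
  have hT' : T = {(G.refit M).vert a', (G.refit M).vert b', (G.refit M).vert c'} := by
    change T = {M.vert a', M.vert b', M.vert c'}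
    rw [m.vert_a', m.vert_b', m.vert_c', hT]
  obtain ⟨F, hF, hFo, hFp, hFs⟩ := stateSum_split (Φ := Φ) (S := ∅) ha rfl t.vert_c' t.ne_c'
    t.opp_a
  obtain ⟨F', hF', hFo', hFp', hFs'⟩ := stateSum_split (G := G.refit M) (Φ := Φ) (S := ∅) ha
    m.vert_a' (m.vert_c.trans t.vert_c') t'.ne_c' t'.opp_a
  have hFo' : ∀ i x, M.vert x ≠ G.vert a → (F' i).opp x = G.opp x := fun i x hx => by
    rw [hFo' i x hx]; exact congrFun m.opp x
  have q := fun i => (pairs_refit_iff m.opp).1 (hFp' i)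
  have e1 : (G.refit M).opp = G.opp := m.opp
  rw [e1] at q
  rw [hFs, hFs']
  have hins : (insert (G.vert a) ∅ : Set G.Crossing) = {G.vert a} := by simp
  rw [hins]
  congr 1
  · have b1 := stateSum_triangle_bigon hΦ t hT hb hc (hF false) (hFo false) (hFp false)
    have b2 := stateSum_triangle_bigon (G := G.refit M) (E := E) (T := T) hΦ t' hT'
      (by change M.vert b' ∉ E; rwa [m.vert_b'])
      (by change M.vert c' ∉ E; rwa [m.vert_c']) (hF' false)
      (fun x hx => by
        rw [hFo' false x (by rw [← m.vert_a']; exact hx)]; exact (congrFun m.opp x).symm)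
      (hFp' false)
    have e2 : (G.refit M).vert a' = G.vert a := m.vert_a'
    rw [e2] at b2
    have hM := m.agreesOff t hT
    have nT : ∀ x, x ∉ T → x ≠ G.vert a := by
      rintro x hx rfl
      exact hx (by rw [hT]; simp)
    refine b1.trans (Eq.trans ?_ b2.symm)
    refine stateSum_triangle_straight hΦ.iso t hT
      (agreesOff_of_vert_eq (hF false) fun x hx => hFo false x (nT _ hx))
      (hM.trans (agreesOff_of_vert_eq (G := G.refit M) (hF' false) fun x hx =>
        (hFo' false x (nT _ hx)).trans (congrFun m.opp x).symm))
      (hFp false) (hFo _ _ t.ne_ab.symm) (hFo _ _ (by rw [t.vert_a']; exact t.ne_ab.symm))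
      (hFo _ _ t.ne_ca) (hFo _ _ (by rw [t.vert_b']; exact t.ne_ca)) (q false)
      (hFo' _ _ ?_) (hFo' _ _ ?_) (hFo' _ _ ?_) (hFo' _ _ ?_)
    · rw [m.vert_a, t.vert_a']; exact t.ne_ab.symm
    · rw [m.vert_b']; exact t.ne_ab.symm
    · rw [m.vert_b, t.vert_b']; exact t.ne_ca
    · rw [m.vert_c']; exact t.ne_ca
  · exact stateSum_triangle_slide hΦ.iso t m hb hc (hF true) (hFo true) (hFp true) (hF' true)
      (hFo' true) (q true)

/-- Invariance of the state sum under the third move, if the number of smoothed crossings of the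
triangle is odd. -/
theorem stateSum_moveThree (hΦ : SecondMoveInvariant Φ)
    (t : G.Triangle a a' b b' c c') (m : G.ThirdMoved M a a' b b' c c')
    (hE : Xor (Xor (G.vert a ∈ E) (G.vert b ∈ E)) (G.vert c ∈ E)) :
    stateSum Φ G E ∅ = stateSum Φ (G.refit M) E ∅ := by
  by_cases ha : G.vert a ∈ E <;> by_cases hb : G.vert b ∈ E <;> by_cases hc : G.vert c ∈ E
  · refine stateSum_moveThree_smoothed hΦ.iso t m rfl ?_
    rintro x (h | h | (h : x = G.vert c)) <;> rwa [h]
  · simp [Xor, ha, hb, hc] at hE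
  · simp [Xor, ha, hb, hc] at hE
  · exact stateSum_moveThree_one hΦ t m ha hb hc
  · simp [Xor, ha, hb, hc] at hE
  · exact stateSum_moveThree_one hΦ t.rotate m.rotate hb hc ha
  · exact stateSum_moveThree_one hΦ t.rotate.rotate m.rotate.rotate hc ha hb
  · simp [Xor, ha, hb, hc] at hE

/-- The third move as a change of the incidences in `G`. -/
theorem ReidemeisterThree.exists_thirdMoved {G' : LongFramedGraph.{u}}
    (h : G.ReidemeisterThree G') :
    ∃ (a a' b b' c c' : G.HalfEdge) (M : Framing G.Crossing G.HalfEdge),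
      G.Triangle a a' b b' c c' ∧ G.ThirdMoved M a a' b b' c c' ∧
      Isomorphic (G.refit M) G' := by
  obtain ⟨a, a', b, b', c, c', ⟨h1, h2, h3⟩, ⟨v1, v2, v3⟩, ⟨n1, n2, n3⟩, ⟨o1, o2, o3⟩, f, g, g1, g2,
    g3, g4⟩ := h
  have t : G.Triangle a a' b b' c c' := ⟨h1, h2, h3, v1, v2, v3, n1, n2, n3, o1, o2, o3⟩
  let M : Framing G.Crossing G.HalfEdge :=
    { vert := fun h => f.symm (G'.vert (g h))
      valency_four := fun d => by
        rw [← G'.valency_four (f d)]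
        exact Nat.card_congr (g.subtypeEquiv fun h => by rw [Equiv.symm_apply_eq])
      opp := G.opp
      opp_opp := G.opp_opp
      opp_ne := G.opp_ne
      vert_opp := fun h => by rw [← g1, G'.vert_opp] }
  have hM : ∀ h k, h ∈ ({a, a', b, b', c, c'} : Set G.HalfEdge) →
      G.edge (Sum.inl h) = Sum.inl k → M.vert h = G.vert k := fun h k hh e =>
    f.symm_apply_eq.2 (g3 h k hh e)
  refine ⟨a, a', b, b', c, c', M, t,
    ⟨rfl, hM _ _ (by simp) h1, hM _ _ (by simp) t.edge_a', hM _ _ (by simp) h2,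
      hM _ _ (by simp) t.rotate.edge_a', hM _ _ (by simp) h3,
      hM _ _ (by simp) t.rotate.rotate.edge_a',
      fun x hx hx' => f.symm_apply_eq.2 (g4 x hx hx')⟩, f, g,
    fun h => (f.apply_symm_apply _).symm, g1, g2⟩

end

/-! ### Parity -/

/-- `μ` colours the half-edges in such a way that the two halves of an edge have different colours
and opposite half-edges have the same colour: along the long component, the colour at the
arrival at a crossing alternates. -/
structure IsParity (G : LongFramedGraph.{u}) (μ : G.Dart → Bool) : Prop where
  edge : ∀ x, μ (G.edge x) = !μ x
  opp : ∀ h, μ (Sum.inl (G.opp h)) = μ (Sum.inl h)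

/-- The even crossings: the two strands through the crossing have different colours. In a graph
with one component this does not depend on the parity chosen. -/
def evenCrossings (G : LongFramedGraph.{u}) : Set G.Crossing :=
  {c | ∃ μ, G.IsParity μ ∧ ∃ h k, G.vert h = c ∧ G.vert k = c ∧ μ (Sum.inl h) ≠ μ (Sum.inl k)}

section
variable {G G' : LongFramedGraph.{u}} {S : Set G.Crossing} {x y : G.Dart} {n m : ℕ}
  {h k : G.HalfEdge} {μ ν : G.Dart → Bool}

/-! ### The walk along the long component -/

theorem walk_succ_of_inl (e : G.walk n = Sum.inl h) :
    G.walk (n + 1) = G.edge (Sum.inl (G.opp h)) := by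
  rw [walk, e]

theorem walk_succ_of_inr {i : LongEnd} (e : G.walk n = Sum.inr i) :
    G.walk (n + 1) = Sum.inr i := by
  rw [walk, e]

theorem walk_eq_inr_of_le {i : LongEnd} (e : G.walk n = Sum.inr i) (hm : n ≤ m) :
    G.walk m = Sum.inr i := by
  induction m, hm using Nat.le_induction with
  | base => exact e
  | succ m _ ih => exact walk_succ_of_inr ih

theorem exists_walk_eq_inl (e : G.walk n = Sum.inl h) (hm : m ≤ n) :
    ∃ k, G.walk m = Sum.inl k := by
  rcases e' : G.walk m with k | i
  · exact ⟨k, rfl⟩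
  · rw [walk_eq_inr_of_le e' hm] at e
    cases e

/-- The walk does not arrive at a half-edge twice: it can be traced back uniquely. -/
theorem walk_inl_injective (e : G.walk n = Sum.inl h) (e' : G.walk m = Sum.inl h) : n = m := by
  have key : ∀ (n m : ℕ) (h : G.HalfEdge), n < m → G.walk n = Sum.inl h →
      G.walk m = Sum.inl h → False := by
    intro n
    induction n with
    | zero =>
      intro m h hm e e'
      obtain ⟨m, rfl⟩ : ∃ p, m = p + 1 := ⟨m - 1, by omega⟩
      obtain ⟨k, ek⟩ := exists_walk_eq_inl e' (Nat.le_succ m)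
      rw [walk_succ_of_inl ek, ← e] at e'
      exact absurd (G.edge_injective e') (by simp)
    | succ n ih =>
      intro m h hm e e'
      obtain ⟨m, rfl⟩ : ∃ p, m = p + 1 := ⟨m - 1, by omega⟩
      obtain ⟨k, ek⟩ := exists_walk_eq_inl e' (Nat.le_succ m)
      obtain ⟨l, el⟩ := exists_walk_eq_inl e (Nat.le_succ n)
      rw [walk_succ_of_inl ek, ← e, walk_succ_of_inl el] at e'
      have := G.opp_injective (Sum.inl_injective (G.edge_injective e'))
      subst this
      exact ih m k (by omega) el ek
  rcases lt_trichotomy n m with hlt | heq | hlt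
  · exact absurd (key n m h hlt e e') id
  · exact heq
  · exact absurd (key m n h hlt e' e) id

theorem run_walk (hm : n ≤ m) : G.Run Set.univ (G.walk n) (G.walk m) := by
  induction m, hm using Nat.le_induction with
  | base => exact run_refl _
  | succ m _ ih =>
    rcases e : G.walk m with k | i
    · rw [walk_succ_of_inl e]
      rw [e] at ih
      exact ih.tail ⟨k, rfl, trivial, rfl⟩
    · rw [walk_succ_of_inr e, ← e]
      exact ih

/-- The walk passes no edge in both directions. -/
theorem walk_ne_edge (n m : ℕ) : G.walk m ≠ G.edge (G.walk n) := by
  intro e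
  rcases le_total n m with hle | hle
  · have r := run_walk (G := G) hle
    rw [e] at r
    have := not_run_edge (G := G) (S := Set.univ) (G.edge (G.walk n))
    rw [G.edge_edge] at this
    exact this r
  · have r := run_walk (G := G) hle
    rw [e] at r
    exact not_run_edge _ r

/-- If the walk passes the edge of `h` away from `h`, it has arrived at `opp h` just before, unless
it is already resting at an end. -/
theorem walk_eq_edge_inl (e : G.walk n = G.edge (Sum.inl h)) :
    ∃ m, G.walk m = Sum.inl (G.opp h) ∧ (n = m + 1 ∨ ∃ i, G.walk (n - 1) = Sum.inr i) := by
  induction n with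
  | zero => exact absurd (G.edge_injective e) (by simp)
  | succ n ih =>
    rcases e' : G.walk n with k | i
    · rw [walk_succ_of_inl e'] at e
      have := Sum.inl_injective (G.edge_injective e)
      exact ⟨n, by rw [e', ← this, G.opp_opp], Or.inl rfl⟩
    · rw [walk_succ_of_inr e', ← e'] at e
      obtain ⟨m, hm, -⟩ := ih e
      exact ⟨m, hm, Or.inr ⟨i, e'⟩⟩

/-- Every edge is passed by the walk. -/
theorem OneComponent.exists_walk (hG : G.OneComponent) (x : G.Dart) :
    ∃ n, G.walk n = x ∨ G.walk n = G.edge x := by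
  refine hG.induction (fun x => ∃ n, G.walk n = x ∨ G.walk n = G.edge x) ?_ ?_
    (x := Sum.inr LongEnd.start) ⟨0, Or.inr rfl⟩ x
  · rintro x ⟨n, e | e⟩
    · exact ⟨n, Or.inr (by rw [G.edge_edge, e])⟩
    · exact ⟨n, Or.inl e⟩
  · rintro h ⟨n, e | e⟩
    · exact ⟨n + 1, Or.inr (walk_succ_of_inl e)⟩
    · obtain ⟨m, hm, -⟩ := walk_eq_edge_inl e
      exact ⟨m, Or.inl hm⟩

/-- The walk arrives at `x` for the first time by its edge number `n`. -/
def ArrivesAt (G : LongFramedGraph.{u}) (n : ℕ) (x : G.Dart) : Prop :=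
  G.walk n = x ∧ ∀ m < n, ∃ h, G.walk m = Sum.inl h

theorem arrivesAt_of_walk (e : G.walk n = Sum.inl h) : G.ArrivesAt n (Sum.inl h) :=
  ⟨e, fun _ hm => exists_walk_eq_inl e hm.le⟩

theorem ArrivesAt.unique (a : G.ArrivesAt n x) (b : G.ArrivesAt m x) : n = m := by
  rcases lt_trichotomy n m with hlt | heq | hlt
  · obtain ⟨h, e⟩ := b.2 n hlt
    exact walk_inl_injective e (b.1.trans (a.1.symm.trans e))
  · exact heq
  · obtain ⟨h, e⟩ := a.2 m hlt
    exact walk_inl_injective (a.1.trans (b.1.symm.trans e)) e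

theorem exists_arrivesAt (e : G.walk n = x) : ∃ m, G.ArrivesAt m x := by
  classical
  have hex : ∃ n, G.walk n = x := ⟨n, e⟩
  refine ⟨Nat.find hex, Nat.find_spec hex, fun m hm => ?_⟩
  rcases e' : G.walk m with h | i
  · exact ⟨h, rfl⟩
  · have := walk_eq_inr_of_le e' hm.le
    rw [Nat.find_spec hex] at this
    exact absurd (e'.trans this.symm) (Nat.find_min hex hm)

/-- In a graph with one component the number of the edge by which the walk arrives at a half-edge
defines a parity. -/
theorem OneComponent.exists_parity (hG : G.OneComponent) :
    ∃ μ, G.IsParity μ ∧ ∀ n h, G.walk n = Sum.inl h → μ (Sum.inl h) = n.bodd := by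
  let R : G.Dart → Bool → Prop := fun x b =>
    (∃ n, G.ArrivesAt n x ∧ b = n.bodd) ∨ ∃ n, G.ArrivesAt n (G.edge x) ∧ b = !n.bodd
  have hex : ∀ x, ∃ b, R x b := by
    intro x
    obtain ⟨n, e | e⟩ := hG.exists_walk x
    · obtain ⟨m, hm⟩ := exists_arrivesAt e
      exact ⟨_, Or.inl ⟨m, hm, rfl⟩⟩
    · obtain ⟨m, hm⟩ := exists_arrivesAt e
      exact ⟨_, Or.inr ⟨m, hm, rfl⟩⟩
  have huniq : ∀ x b b', R x b → R x b' → b = b' := by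
    rintro x b b' (⟨n, hn, rfl⟩ | ⟨n, hn, rfl⟩) (⟨m, hm, rfl⟩ | ⟨m, hm, rfl⟩)
    · rw [hn.unique hm]
    · exact absurd (by rw [hn.1, hm.1]) (walk_ne_edge (G := G) n m)
    · exact absurd (by rw [hn.1, hm.1]) (walk_ne_edge (G := G) m n)
    · rw [hn.unique hm]
  choose μ hμ using hex
  refine ⟨μ, ⟨fun x => huniq _ _ _ (hμ _) ?_, fun h => huniq _ _ _ (hμ _) ?_⟩, fun n h e =>
    huniq _ _ _ (hμ _) (Or.inl ⟨n, arrivesAt_of_walk e, rfl⟩)⟩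
  · rcases hμ x with ⟨n, hn, e⟩ | ⟨n, hn, e⟩
    · exact Or.inr ⟨n, by rwa [G.edge_edge], by rw [e]⟩
    · exact Or.inl ⟨n, hn, by rw [e, Bool.not_not]⟩
  · rcases hμ (Sum.inl h) with ⟨n, hn, e⟩ | ⟨n, hn, e⟩
    · refine Or.inr ⟨n + 1, ⟨walk_succ_of_inl hn.1, fun m hm => ?_⟩, by simp [e]⟩
      exact exists_walk_eq_inl hn.1 (by omega)
    · obtain ⟨m, hm, e'⟩ := walk_eq_edge_inl hn.1
      have e2 : n = m + 1 := by
        rcases e' with e' | ⟨i, hi⟩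
        · exact e'
        · rcases n with _ | n
          · exact absurd (G.edge_injective hn.1) (by simp)
          · obtain ⟨k, hk⟩ := hn.2 n (Nat.lt_succ_self n)
            rw [Nat.add_sub_cancel, hk] at hi
            cases hi
      subst e2
      exact Or.inl ⟨m, arrivesAt_of_walk hm, by simp [e]⟩

/-! ### Even crossings -/

theorem OneComponent.parity_unique (hG : G.OneComponent) (hμ : G.IsParity μ) (hν : G.IsParity ν) :
    ∃ b, ∀ x, μ x = (ν x ^^ b) := by
  refine ⟨μ (Sum.inr LongEnd.start) ^^ ν (Sum.inr LongEnd.start), fun x => ?_⟩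
  refine hG.induction
    (fun x => μ x = (ν x ^^ (μ (Sum.inr LongEnd.start) ^^ ν (Sum.inr LongEnd.start)))) ?_ ?_
    (x := Sum.inr LongEnd.start) ?_ x
  · intro x e
    rw [hμ.edge, hν.edge, e, Bool.not_xor]
  · intro h e
    rw [hμ.opp, hν.opp, e]
  · cases μ (Sum.inr LongEnd.start) <;> cases ν (Sum.inr LongEnd.start) <;> rfl

theorem IsParity.mem_evenCrossings_iff (hG : G.OneComponent) (hμ : G.IsParity μ)
    {c : G.Crossing} : c ∈ G.evenCrossings ↔
      ∃ h k, G.vert h = c ∧ G.vert k = c ∧ μ (Sum.inl h) ≠ μ (Sum.inl k) := by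
  constructor
  · rintro ⟨ν, hν, h, k, hh, hk, hne⟩
    obtain ⟨b, hb⟩ := hG.parity_unique hν hμ
    exact ⟨h, k, hh, hk, fun e => hne (by rw [hb, hb, e])⟩
  · rintro ⟨h, k, hh, hk, hne⟩
    exact ⟨μ, hμ, h, k, hh, hk, hne⟩

theorem IsParity.vert_mem_evenCrossings_iff (hG : G.OneComponent) (hμ : G.IsParity μ)
    (hk : G.vert k = G.vert h) (h1 : k ≠ h) (h2 : k ≠ G.opp h) :
    G.vert h ∈ G.evenCrossings ↔ μ (Sum.inl h) ≠ μ (Sum.inl k) := by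
  rw [hμ.mem_evenCrossings_iff hG]
  constructor
  · rintro ⟨x, y, hx, hy, hne⟩ e
    have : ∀ x, G.vert x = G.vert h → μ (Sum.inl x) = μ (Sum.inl h) := by
      intro x hx
      rcases eq_of_vert_eq hk h1 h2 hx with rfl | rfl | rfl | rfl
      · rfl
      · exact hμ.opp h
      · exact e.symm
      · rw [hμ.opp, e]
    exact hne (by rw [this x hx, this y hy])
  · exact fun hne => ⟨h, k, rfl, hk, hne⟩

/-- The parity restricts to the graph obtained by erasing `S` if each strand passing through `S`
does this in an even number of steps: it enters `S` and leaves `S` at outer half-edges, and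
meets inner and outer half-edges in turn. Here `I` is the set of inner half-edges. -/
theorem IsParity.of_erasesVia (hμ : G.IsParity μ) {f : G'.Crossing ↪ G.Crossing}
    {g : G'.HalfEdge ↪ G.HalfEdge} (R : G.ErasesVia S G' f g) (I : Set G.HalfEdge)
    (hIS : ∀ h ∈ I, G.vert h ∈ S) (hI : ∀ h, G.vert h ∈ S → (h ∈ I ↔ G.opp h ∉ I))
    (hIe : ∀ h ∈ I, ∃ k ∈ I, G.edge (Sum.inl h) = Sum.inl k) :
    G'.IsParity (fun x => μ (Sum.map g id x)) := by
  classical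
  let J : Set G.Dart := Sum.inl '' I
  have hJe : ∀ x, G.edge x ∈ J ↔ x ∈ J := by
    have : ∀ x ∈ J, G.edge x ∈ J := by
      rintro _ ⟨h, hh, rfl⟩
      obtain ⟨k, hk, e⟩ := hIe h hh
      exact ⟨k, hk, e.symm⟩
    refine fun x => ⟨fun hx => ?_, this x⟩
    simpa [G.edge_edge] using this _ hx
  have hJ : ∀ h, Sum.inl h ∈ J ↔ h ∈ I := fun h => by simp [J]
  have hout : ∀ x : G'.Dart, Sum.map g id x ∉ J := by
    rintro x ⟨h, hh, e⟩
    exact R.out x h e.symm (hIS h hh)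
  -- The colour of outer half-edges, and the opposite colour of inner ones, stays constant.
  have hrun : ∀ x y, G.Run S x y → (μ x ^^ decide (x ∈ J)) = (μ y ^^ decide (y ∈ J)) := by
    intro x y r
    induction r with
    | refl => rfl
    | tail _ s ih =>
      obtain ⟨h, rfl, hh, rfl⟩ := s
      rw [ih, hμ.edge, hμ.opp]
      simp only [hJe, hJ]
      by_cases hi : h ∈ I
      · simp [hi, (hI h hh).1 hi]
      · have : G.opp h ∈ I := by_contra fun hc => hi ((hI h hh).2 hc)
        simp [hi, this]
  refine ⟨fun x => ?_, fun h => ?_⟩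
  · have e := hrun _ _ (R.run x)
    rw [hμ.edge] at e
    simp only [hJe, hout, decide_false, Bool.xor_false] at e
    exact e.symm
  · change μ (Sum.inl (g (G'.opp h))) = μ (Sum.inl (g h))
    rw [← R.opp, hμ.opp]

/-- Under the same conditions on `I`, erasing `S` does not change the parity of the others. -/
theorem evenCrossings_of_erasesVia (hG : G.OneComponent) {f : G'.Crossing ↪ G.Crossing}
    {g : G'.HalfEdge ↪ G.HalfEdge} (R : G.ErasesVia S G' f g) (I : Set G.HalfEdge)
    (hIS : ∀ h ∈ I, G.vert h ∈ S) (hI : ∀ h, G.vert h ∈ S → (h ∈ I ↔ G.opp h ∉ I))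
    (hIe : ∀ h ∈ I, ∃ k ∈ I, G.edge (Sum.inl h) = Sum.inl k) :
    G'.evenCrossings = f ⁻¹' G.evenCrossings := by
  obtain ⟨μ, hμ, -⟩ := hG.exists_parity
  have hμ' := hμ.of_erasesVia R I hIS hI hIe
  ext c
  rw [Set.mem_preimage, hμ.mem_evenCrossings_iff hG,
    hμ'.mem_evenCrossings_iff (hG.of_erasesVia R)]
  constructor
  · rintro ⟨h, k, rfl, hk, hne⟩
    exact ⟨g h, g k, R.vert h, by rw [R.vert, hk], hne⟩
  · rintro ⟨h, k, hh, hk, hne⟩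
    obtain ⟨h, rfl⟩ := R.exists_halfEdge (h := h) (by rw [hh]; exact R.notMem c)
    obtain ⟨k, rfl⟩ := R.exists_halfEdge (h := k) (by rw [hk]; exact R.notMem c)
    rw [R.vert] at hh hk
    exact ⟨h, k, f.injective hh, f.injective hk, hne⟩

end

/-! ### Even crossings under the moves -/

section
variable {Φ : LongFramedGraph.{u} → Prop} {G G' : LongFramedGraph.{u}} {v w : G.Crossing}
  {a a' b b' c c' : G.HalfEdge} {M : Framing G.Crossing G.HalfEdge}

theorem OneComponent.loop_mem_evenCrossings (hG : G.OneComponent) (hl : G.LoopAt v) :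
    v ∈ G.evenCrossings := by
  obtain ⟨h, h', hh, hh', -, e⟩ := hl
  obtain ⟨μ, hμ, -⟩ := hG.exists_parity
  refine ⟨μ, hμ, h, h', hh, hh', ?_⟩
  rw [← e, hμ.edge]
  cases μ (Sum.inl h) <;> simp

theorem OneComponent.bigon_mem_evenCrossings_iff (hG : G.OneComponent) (hb : G.BigonAt v w) :
    v ∈ G.evenCrossings ↔ w ∈ G.evenCrossings := by
  obtain ⟨-, h, k, h', k', rfl, hk, hhk, hkh, rfl, hk', hk2, e, e'⟩ := hb
  obtain ⟨μ, hμ, -⟩ := hG.exists_parity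
  have hne : k' ≠ h' := by
    rintro rfl
    exact hhk (Sum.inl_injective (G.edge_injective (e.trans e'.symm)))
  rw [hμ.vert_mem_evenCrossings_iff hG hk hhk.symm hkh,
    hμ.vert_mem_evenCrossings_iff hG hk' hne hk2, ← e, ← e', hμ.edge, hμ.edge]
  simp

/-- The number of even crossings of a triangle is odd. -/
theorem Triangle.xor_mem_evenCrossings (hG : G.OneComponent) (t : G.Triangle a a' b b' c c') :
    Xor (Xor (G.vert a ∈ G.evenCrossings) (G.vert b ∈ G.evenCrossings))
      (G.vert c ∈ G.evenCrossings) := by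
  obtain ⟨μ, hμ, -⟩ := hG.exists_parity
  rw [hμ.vert_mem_evenCrossings_iff hG t.vert_c' t.ne_c' t.opp_a,
    hμ.vert_mem_evenCrossings_iff hG t.rotate.vert_c' t.rotate.ne_c' t.rotate.opp_a,
    hμ.vert_mem_evenCrossings_iff hG t.rotate.rotate.vert_c' t.rotate.rotate.ne_c'
      t.rotate.rotate.opp_a, ← t.edge_a, ← t.edge_b, ← t.edge_c, hμ.edge, hμ.edge, hμ.edge]
  cases μ (Sum.inl a) <;> cases μ (Sum.inl b) <;> cases μ (Sum.inl c) <;> simp [Xor]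

theorem ThirdMoved.oneComponent (m : G.ThirdMoved M a a' b b' c c') (hG : G.OneComponent) :
    (G.refit M).OneComponent := by
  have e : (G.refit M).Adjacent = G.Adjacent := by
    funext x y
    unfold Adjacent
    change (G.edge x = y ∨ ∃ h, x = Sum.inl h ∧ y = Sum.inl (M.opp h)) = _
    rw [m.opp]
  intro x y
  rw [e]
  exact hG x y

/-- At each corner the third move replaces two half-edges of the triangle by the other halves of
their edges, which both have the other colour. -/
theorem ThirdMoved.evenCrossings_eq (m : G.ThirdMoved M a a' b b' c c')
    (t : G.Triangle a a' b b' c c') (hG : G.OneComponent) :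
    (G.refit M).evenCrossings = G.evenCrossings := by
  have hG' := m.oneComponent hG
  have t' := m.triangle t
  obtain ⟨μ, hμ, -⟩ := hG.exists_parity
  have hμ' : (G.refit M).IsParity μ := ⟨hμ.edge, fun h => by
    change μ (Sum.inl (M.opp h)) = _
    rw [m.opp, hμ.opp]⟩
  have corner : ∀ x, G.vert x = G.vert a ∨ G.vert x = G.vert b ∨ G.vert x = G.vert c →
      (G.vert x ∈ (G.refit M).evenCrossings ↔ G.vert x ∈ G.evenCrossings) := by
    have ha := hμ.vert_mem_evenCrossings_iff hG t.vert_c' t.ne_c' t.opp_a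
    have hb := hμ.vert_mem_evenCrossings_iff hG t.rotate.vert_c' t.rotate.ne_c' t.rotate.opp_a
    have hc := hμ.vert_mem_evenCrossings_iff hG t.rotate.rotate.vert_c' t.rotate.rotate.ne_c'
      t.rotate.rotate.opp_a
    have ha' := hμ'.vert_mem_evenCrossings_iff hG' t'.vert_c' t'.ne_c' t'.opp_a
    have hb' := hμ'.vert_mem_evenCrossings_iff hG' t'.rotate.vert_c' t'.rotate.ne_c'
      t'.rotate.opp_a
    have hc' := hμ'.vert_mem_evenCrossings_iff hG' t'.rotate.rotate.vert_c'
      t'.rotate.rotate.ne_c' t'.rotate.rotate.opp_a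
    have ea : (G.refit M).vert a' = G.vert a := m.vert_a'
    have eb : (G.refit M).vert b' = G.vert b := m.vert_b'
    have ec : (G.refit M).vert c' = G.vert c := m.vert_c'
    rw [ea] at ha'
    rw [eb] at hb'
    rw [ec] at hc'
    rw [← t.edge_c, hμ.edge] at ha
    rw [← t.edge_a, hμ.edge] at hb
    rw [← t.edge_b, hμ.edge] at hc
    rw [← t.edge_a, hμ.edge] at ha'
    rw [← t.edge_b, hμ.edge] at hb'
    rw [← t.edge_c, hμ.edge] at hc'
    rintro x (e | e | e) <;> rw [e]
    · rw [ha, ha']; cases μ (Sum.inl a) <;> cases μ (Sum.inl c) <;> simp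
    · rw [hb, hb']; cases μ (Sum.inl b) <;> cases μ (Sum.inl a) <;> simp
    · rw [hc, hc']; cases μ (Sum.inl c) <;> cases μ (Sum.inl b) <;> simp
  have hM := m.agreesOff t rfl
  ext d
  by_cases hd : d ∈ ({G.vert a, G.vert b, G.vert c} : Set G.Crossing)
  · rcases hd with e | e | (e : d = G.vert c) <;> rw [e]
    · exact corner a (Or.inl rfl)
    · exact corner b (Or.inr (Or.inl rfl))
    · exact corner c (Or.inr (Or.inr rfl))
  · have hv : ∀ x, M.vert x = d ↔ G.vert x = d := by
      refine fun x => ⟨fun e => ?_, fun e => ?_⟩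
      · have := hM.vert x (fun h => hd (by rw [← e]; exact (hM.mem x).2 h))
        rw [← e]; exact this.symm
      · have := hM.vert x (fun h => hd (by rw [← e]; exact h))
        rw [← e]; exact this
    rw [hμ.mem_evenCrossings_iff hG, hμ'.mem_evenCrossings_iff hG']
    change (∃ h k, M.vert h = d ∧ M.vert k = d ∧ _) ↔ _
    simp only [hv]

/-! ### The parity bracket -/

/-- The coefficient modulo 2 of the class `Φ` in the parity bracket of `G`: the even crossings are
smoothed in all ways, and the states with one component and the property `Φ` are counted. -/
noncomputable def bracket (Φ : LongFramedGraph.{u} → Prop) (G : LongFramedGraph.{u}) : ZMod 2 :=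
  stateSum Φ G G.evenCrossings ∅

theorem bracket_isomorphic (hΦ : SecondMoveInvariant Φ) (hG : G.OneComponent)
    (h : Isomorphic G G') : bracket Φ G = bracket Φ G' := by
  obtain ⟨f, g, R⟩ := erases_iff.1 (isomorphic_iff.1 h)
  unfold bracket
  rw [stateSum_erase hΦ.iso R (hG.noCircle _) (by simp),
    evenCrossings_of_erasesVia hG R ∅ (by simp) (by simp) (by simp)]

theorem bracket_reidemeisterOne (hΦ : SecondMoveInvariant Φ) (hG : G.OneComponent)
    (h : ReidemeisterOne G G') : bracket Φ G = bracket Φ G' := by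
  obtain ⟨v, hl, R⟩ := h
  obtain ⟨f, g, R⟩ := erases_iff.1 R
  have hv := hG.loop_mem_evenCrossings hl
  unfold bracket
  rw [stateSum_moveOne hΦ.iso hG hv hl R]
  obtain ⟨h, h', hh, hh', hne, e⟩ := hl
  have e' : G.edge (Sum.inl h') = Sum.inl h := by rw [← e, G.edge_edge]
  have hne' : h' ≠ h := fun e2 => G.edge_ne (Sum.inl h) (by rw [e, e2])
  rw [evenCrossings_of_erasesVia hG R {h, h'} ?_ ?_ ?_]
  · rintro x (e2 | (e2 : x = h')) <;> rw [e2] <;> assumption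
  · intro x hx
    exact opp_mem_iff_of_inter (I := {h, h'}) (x := h) (y := h') (by simp) (by simp)
      (hh'.trans hh.symm) hne' hne (fun y hy _ => by simpa using hy) (Eq.trans hx hh.symm)
  · rintro x (e2 | (e2 : x = h')) <;> rw [e2]
    · exact ⟨h', by simp, e⟩
    · exact ⟨h, by simp, e'⟩

theorem bracket_reidemeisterTwo (hΦ : SecondMoveInvariant Φ) (hG : G.OneComponent)
    (h : ReidemeisterTwo G G') : bracket Φ G = bracket Φ G' := by
  obtain ⟨v, w, hb, R⟩ := h
  obtain ⟨f, g, R⟩ := erases_iff.1 R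
  have hvw := hG.bigon_mem_evenCrossings_iff hb
  unfold bracket
  rw [stateSum_moveTwo hΦ hG hvw hb R]
  obtain ⟨hne, h, k, h', k', vh, vk, hhk, hkh, vh', vk', hkh', e, e'⟩ := hb
  have hne' : k' ≠ h' := by
    rintro rfl
    exact hhk (Sum.inl_injective (G.edge_injective (e.trans e'.symm)))
  rw [evenCrossings_of_erasesVia hG R {h, k, h', k'} ?_ ?_ ?_]
  · rintro x (e2 | e2 | e2 | (e2 : x = k')) <;> rw [e2] <;> simp [*]
  · rintro x (hx | (hx : G.vert x = w))
    · refine opp_mem_iff_of_inter (I := {h, k, h', k'}) (x := h) (y := k) (by simp) (by simp)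
        (vk.trans vh.symm) hhk.symm hkh ?_ (hx.trans vh.symm)
      rintro y (e2 | e2 | e2 | (e2 : y = k')) hy
      · exact Or.inl e2
      · exact Or.inr e2
      · exact absurd (by rw [← vh, ← hy, e2, vh']) hne
      · exact absurd (by rw [← vh, ← hy, e2, vk']) hne
    · refine opp_mem_iff_of_inter (I := {h, k, h', k'}) (x := h') (y := k') (by simp) (by simp)
        (vk'.trans vh'.symm) hne' hkh' ?_ (hx.trans vh'.symm)
      rintro y (e2 | e2 | e2 | (e2 : y = k')) hy
      · exact absurd (by rw [← vh', ← hy, e2, vh]) hne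
      · exact absurd (by rw [← vh', ← hy, e2, vk]) hne
      · exact Or.inl e2
      · exact Or.inr e2
  · rintro x (e2 | e2 | e2 | (e2 : x = k')) <;> rw [e2]
    · exact ⟨h', by simp, e⟩
    · exact ⟨k', by simp, e'⟩
    · exact ⟨h, by simp, by rw [← e, G.edge_edge]⟩
    · exact ⟨k, by simp, by rw [← e', G.edge_edge]⟩

theorem bracket_reidemeisterThree (hΦ : SecondMoveInvariant Φ) (hG : G.OneComponent)
    (h : ReidemeisterThree G G') : bracket Φ G = bracket Φ G' := by
  obtain ⟨a, a', b, b', c, c', M, t, m, hiso⟩ := ReidemeisterThree.exists_thirdMoved h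
  rw [← bracket_isomorphic hΦ (m.oneComponent hG) hiso]
  unfold bracket
  rw [m.evenCrossings_eq t hG]
  exact stateSum_moveThree hΦ t m (t.xor_mem_evenCrossings hG)

/-- The parity bracket is invariant under all moves. -/
theorem bracket_move (hΦ : SecondMoveInvariant Φ) (hG : G.OneComponent) (h : Move G G') :
    bracket Φ G = bracket Φ G' := by
  rcases h with h | h | h | h
  · exact bracket_isomorphic hΦ hG h
  · exact bracket_reidemeisterOne hΦ hG h
  · exact bracket_reidemeisterTwo hΦ hG h
  · exact bracket_reidemeisterThree hΦ hG h

/-- If there are no even crossings, the only state is the graph itself. -/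
theorem bracket_of_evenCrossings_eq_empty (hΦ : ∀ H H', Isomorphic H H' → Φ H → Φ H')
    (hG : G.OneComponent) (he : G.evenCrossings = ∅) :
    bracket Φ G = 1 ↔ Φ G := by
  have hgood : IsGood Φ G ∅ ↔ Φ G := by
    constructor
    · rintro ⟨-, H, hH, hΦH⟩
      obtain ⟨f, g, h1, h2, h3⟩ := isomorphic_iff.2 hH
      obtain ⟨f1, g1, R⟩ := erases_iff.1 hH
      have hid : G.Erases ∅ G := isomorphic_iff.1 ⟨Equiv.refl _, Equiv.refl _, fun _ => rfl,
        fun _ => rfl, fun x => by simp⟩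
      obtain ⟨f2, g2, R'⟩ := erases_iff.1 hid
      exact hΦ _ _ (R.isomorphic R') hΦH
    · exact fun h => ⟨hG, G, isomorphic_iff.1 ⟨Equiv.refl _, Equiv.refl _, fun _ => rfl,
        fun _ => rfl, fun x => by simp⟩, h⟩
  have hstate : ∀ F, G.IsState ∅ F ↔ F = G.framing := by
    intro F
    constructor
    · rintro ⟨h1, h2⟩
      exact Framing.ext h1 (funext fun h => (h2 h).2 (by simp))
    · rintro rfl
      exact ⟨rfl, fun h => by simp [framing]⟩
  unfold bracket stateSum
  rw [he]
  have hset : goodStates Φ G ∅ ∅ = {F | F = G.framing ∧ Φ G} := by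
    ext F
    change (G.IsState ∅ F ∧ IsGood Φ (G.refit F) (∅ ∪ ∅ : Set G.Crossing)) ↔ F = G.framing ∧ Φ G
    rw [Set.union_empty, hstate]
    refine and_congr_right ?_
    rintro rfl
    exact hgood
  rw [hset]
  by_cases h : Φ G
  · simp [h]
  · simp [h]

end

/-! ### Odd crossings of the Gauss diagram -/

section
variable {G : LongFramedGraph.{u}}

theorem exists_not_opposite (G : LongFramedGraph.{u}) (c : G.Crossing) :
    ∃ h k, G.vert h = c ∧ G.vert k = c ∧ k ≠ h ∧ k ≠ G.opp h := by
  have h4 : ({h | G.vert h = c} : Set G.HalfEdge).ncard = 4 := G.valency_four c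
  obtain ⟨h, hh⟩ : ({h | G.vert h = c} : Set G.HalfEdge).Nonempty := by
    rw [← Set.ncard_pos (Set.toFinite _), h4]; norm_num
  have hlt : ({h, G.opp h} : Set G.HalfEdge).ncard <
      ({h | G.vert h = c} : Set G.HalfEdge).ncard := by
    rw [h4]
    exact (Set.ncard_insert_le _ _).trans_lt (by rw [Set.ncard_singleton]; norm_num)
  obtain ⟨k, hk, hk'⟩ := Set.exists_mem_notMem_of_ncard_lt_ncard hlt (Set.toFinite _)
  simp only [Set.mem_insert_iff, Set.mem_singleton_iff, not_or] at hk'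
  exact ⟨h, k, hh, hk, hk'.1, hk'.2⟩

/-- Each crossing is passed exactly twice, along its two strands. -/
theorem OneComponent.exists_passes (hG : G.OneComponent) (c : G.Crossing) :
    ∃ (i j : ℕ) (h k : G.HalfEdge), i < j ∧ G.walk i = Sum.inl h ∧ G.walk j = Sum.inl k ∧
      G.vert h = c ∧ G.vert k = c ∧ k ≠ h ∧ k ≠ G.opp h ∧ ∀ n, G.PassesAt n c ↔ n = i ∨ n = j := by
  have harr : ∀ x : G.HalfEdge, ∃ i y, G.walk i = Sum.inl y ∧ (y = x ∨ y = G.opp x) := by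
    intro x
    obtain ⟨n, e | e⟩ := hG.exists_walk (Sum.inl x)
    · exact ⟨n, x, e, Or.inl rfl⟩
    · obtain ⟨m, hm, -⟩ := walk_eq_edge_inl e
      exact ⟨m, _, hm, Or.inr rfl⟩
  obtain ⟨h0, k0, hh0, hk0, n1, n2⟩ := exists_not_opposite G c
  obtain ⟨i, h, hi, hh⟩ := harr h0
  obtain ⟨j, k, hj, hk⟩ := harr k0
  have o2 : G.opp k0 ≠ h0 := fun e => n2 (by rw [← e, G.opp_opp])
  have o3 : G.opp k0 ≠ G.opp h0 := fun e => n1 (G.opp_injective e)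
  have vh : G.vert h = c := by rcases hh with rfl | rfl <;> simp [G.vert_opp, hh0]
  have vk : G.vert k = c := by rcases hk with rfl | rfl <;> simp [G.vert_opp, hk0]
  have m1 : k ≠ h := by
    rcases hh with rfl | rfl <;> rcases hk with rfl | rfl <;> assumption
  have m2 : k ≠ G.opp h := by
    rcases hh with rfl | rfl <;> rcases hk with rfl | rfl <;> first
      | assumption
      | rwa [G.opp_opp]
  -- A half-edge opposite to one by which the walk arrives is not one by which it arrives.
  have hopp : ∀ (p q : ℕ) (x : G.HalfEdge), G.walk p = Sum.inl x →
      G.walk q ≠ Sum.inl (G.opp x) := by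
    intro p q x hp hq
    exact walk_ne_edge (G := G) q (p + 1) (by rw [walk_succ_of_inl hp, hq])
  have hpass : ∀ n, G.PassesAt n c ↔ n = i ∨ n = j := by
    intro n
    constructor
    · rintro ⟨x, hx, hxc⟩
      rcases eq_of_vert_eq (vk.trans vh.symm) m1 m2 (hxc.trans vh.symm) with e | e | e | e
      · exact Or.inl (walk_inl_injective hx (by rw [hi, e]))
      · exact absurd (by rw [hx, e]) (hopp i n h hi)
      · exact Or.inr (walk_inl_injective hx (by rw [hj, e]))
      · exact absurd (by rw [hx, e]) (hopp j n k hj)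
    · rintro (rfl | rfl)
      · exact ⟨h, hi, vh⟩
      · exact ⟨k, hj, vk⟩
  rcases lt_trichotomy i j with hlt | rfl | hlt
  · exact ⟨i, j, h, k, hlt, hi, hj, vh, vk, m1, m2, hpass⟩
  · rw [hi] at hj
    exact absurd (Sum.inl_injective hj).symm m1
  · exact ⟨j, i, k, h, hlt, hj, hi, vk, vh, m1.symm, fun e => m2 (by rw [e, G.opp_opp]),
      fun n => (hpass n).trans Or.comm⟩

/-- A crossing that is odd in the Gauss diagram is not even: between its two passages the walk
passes each linked crossing once, and each other one twice or not at all. -/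
theorem OneComponent.notMem_evenCrossings (hG : G.OneComponent) {c : G.Crossing}
    (hc : G.IsOddCrossing c) : c ∉ G.evenCrossings := by
  classical
  have := G.finite_crossing
  have := Fintype.ofFinite G.Crossing
  obtain ⟨i, j, h, k, hij, hi, hj, vh, vk, n1, n2, hp⟩ := hG.exists_passes c
  have hcross : ∀ n, ∃ d, n < j → G.PassesAt n d := by
    intro n
    by_cases hn : n < j
    · obtain ⟨x, hx⟩ := exists_walk_eq_inl hj hn.le
      exact ⟨G.vert x, fun _ => ⟨x, hx, rfl⟩⟩
    · exact ⟨c, fun h => absurd h hn⟩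
  choose d hd using hcross
  -- Modulo 2, the number of passages of `e` between those of `c` tells whether `e` is linked.
  have hfib : ∀ e : G.Crossing,
      (((Finset.Ioo i j).filter fun n => d n = e).card : ZMod 2) =
        if G.Linked c e then 1 else 0 := by
    intro e
    have huniq : ∀ n e', G.PassesAt n e → G.PassesAt n e' → e = e' := by
      rintro n e' ⟨x, hx, rfl⟩ ⟨y, hy, rfl⟩
      rw [Sum.inl_injective (hx.symm.trans hy)]
    obtain ⟨p, q, -, -, hpq, -, -, -, -, -, -, hpq'⟩ := hG.exists_passes e
    by_cases hce : e = c
    · subst hce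
      have hempty : (Finset.Ioo i j).filter (fun n => d n = e) = ∅ := by
        ext n
        simp only [Finset.mem_filter, Finset.mem_Ioo, Finset.notMem_empty, iff_false, not_and]
        rintro ⟨h1, h2⟩ rfl
        have := (hp n).1 (hd n h2)
        omega
      rw [hempty, if_neg fun hl => hl.1 rfl]
      simp
    · have hpi : p ≠ i ∧ p ≠ j := by
        refine not_or.1 fun hor => hce ?_
        exact huniq p c ((hpq' p).2 (Or.inl rfl)) ((hp p).2 hor)
      have hqi : q ≠ i ∧ q ≠ j := by
        refine not_or.1 fun hor => hce ?_
        exact huniq q c ((hpq' q).2 (Or.inr rfl)) ((hp q).2 hor)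
      have hmem : ∀ n, n ∈ (Finset.Ioo i j).filter (fun n => d n = e) ↔
          (i < n ∧ n < j) ∧ (n = p ∨ n = q) := by
        intro n
        rw [Finset.mem_filter, Finset.mem_Ioo]
        refine and_congr_right fun hn => ?_
        rw [← hpq']
        constructor
        · rintro rfl
          exact hd n hn.2
        · intro h
          exact (huniq n _ h (hd n hn.2)).symm
      have hlink : G.Linked c e ↔ (i < p ∧ p < j ∧ j < q) ∨ (p < i ∧ i < q ∧ q < j) := by
        constructor
        · rintro ⟨-, t1, t2, t3, t4, h1, h2, h3, ⟨h4, h5, h6, h7⟩ | ⟨h4, h5, h6, h7⟩⟩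
          · rw [hp] at h4 h6
            rw [hpq'] at h5 h7
            omega
          · rw [hp] at h5 h7
            rw [hpq'] at h4 h6
            omega
        · refine fun hor => ⟨Ne.symm hce, ?_⟩
          rcases hor with ⟨h1, h2, h3⟩ | ⟨h1, h2, h3⟩
          · exact ⟨i, p, j, q, h1, h2, h3, Or.inl ⟨(hp _).2 (Or.inl rfl),
              (hpq' _).2 (Or.inl rfl), (hp _).2 (Or.inr rfl), (hpq' _).2 (Or.inr rfl)⟩⟩
          · exact ⟨p, i, q, j, h1, h2, h3, Or.inr ⟨(hpq' _).2 (Or.inl rfl),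
              (hp _).2 (Or.inl rfl), (hpq' _).2 (Or.inr rfl), (hp _).2 (Or.inr rfl)⟩⟩
      by_cases p1 : i < p ∧ p < j <;> by_cases q1 : i < q ∧ q < j
      · have : (Finset.Ioo i j).filter (fun n => d n = e) = {p, q} := by
          ext n; rw [hmem]; simp only [Finset.mem_insert, Finset.mem_singleton]; omega
        rw [this, Finset.card_pair hpq.ne, if_neg (by rw [hlink]; omega)]
        rfl
      · have : (Finset.Ioo i j).filter (fun n => d n = e) = {p} := by
          ext n; rw [hmem]; simp only [Finset.mem_singleton]; omega
        rw [this, Finset.card_singleton, if_pos (by rw [hlink]; omega)]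
        rfl
      · have : (Finset.Ioo i j).filter (fun n => d n = e) = {q} := by
          ext n; rw [hmem]; simp only [Finset.mem_singleton]; omega
        rw [this, Finset.card_singleton, if_pos (by rw [hlink]; omega)]
        rfl
      · have : (Finset.Ioo i j).filter (fun n => d n = e) = ∅ := by
          ext n; rw [hmem]; simp only [Finset.notMem_empty, iff_false]; omega
        rw [this, if_neg (by rw [hlink]; omega)]
        rfl
  have hsum : ((Finset.Ioo i j).card : ZMod 2) =
      (Set.ncard {e : G.Crossing | G.Linked c e} : ZMod 2) := by
    rw [Finset.card_eq_sum_card_fiberwise (f := d) (t := Finset.univ) (fun _ _ => by simp),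
      Nat.cast_sum, Finset.sum_congr rfl fun e _ => hfib e, Finset.sum_ite, Finset.sum_const_zero,
      add_zero, Finset.sum_const, nsmul_one, ← Set.ncard_coe_finset]
    congr 3
    ext e
    simp
  have hodd : Odd (j - i - 1) := by
    rw [← Nat.card_Ioo, ← ZMod.natCast_eq_one_iff_odd, hsum, ZMod.natCast_eq_one_iff_odd]
    exact hc
  obtain ⟨μ, hμ, hμw⟩ := hG.exists_parity
  rw [← vh, hμ.vert_mem_evenCrossings_iff hG (vk.trans vh.symm) n1 n2, hμw i h hi, hμw j k hj,
    not_not]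
  obtain ⟨r, hr⟩ := hodd
  have : j = i + 2 * (r + 1) := by omega
  rw [this, Nat.bodd_add, Nat.bodd_mul]
  simp

theorem OneComponent.evenCrossings_reverse (hG : G.OneComponent) :
    G.reverse.evenCrossings = G.evenCrossings := by
  obtain ⟨μ, hμ, -⟩ := hG.exists_parity
  have hμ' : G.reverse.IsParity fun x => μ (flipEnds x) := ⟨fun x => by
    change μ (flipEnds (flipEnds (G.edge (flipEnds x)))) = _
    rw [flipEnds_flipEnds, hμ.edge], fun h => hμ.opp h⟩
  ext c
  exact (hμ'.mem_evenCrossings_iff (reverse_oneComponent hG)).trans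
    (hμ.mem_evenCrossings_iff hG).symm

end

/-! ### Confluence of the decreasing second moves -/

section
variable {G G' G'' H : LongFramedGraph.{u}} {S : Set G.Crossing} {v w x y : G.Crossing}

theorem Isomorphic.refl (G : LongFramedGraph.{u}) : Isomorphic G G :=
  ⟨Equiv.refl _, Equiv.refl _, fun _ => rfl, fun _ => rfl, fun x => by simp⟩

theorem Erases.trans_isomorphic (h : G.Erases S G') (h' : Isomorphic G' G'') : G.Erases S G'' := by
  obtain ⟨f, g, R⟩ := erases_iff.1 h
  obtain ⟨f', g', R'⟩ := erases_iff.1 (isomorphic_iff.1 h')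
  exact erases_iff.2 ⟨_, _, R.trans R' (by simp)⟩

theorem Erases.isomorphic (h : G.Erases S G') (h' : G.Erases S G'') : Isomorphic G' G'' := by
  obtain ⟨f, g, R⟩ := erases_iff.1 h
  obtain ⟨f', g', R'⟩ := erases_iff.1 h'
  exact R.isomorphic R'

theorem Isomorphic.symm (h : Isomorphic G G') : Isomorphic G' G :=
  (isomorphic_iff.1 h).isomorphic (isomorphic_iff.1 (Isomorphic.refl G))

theorem Isomorphic.trans (h : Isomorphic G G') (h' : Isomorphic G' G'') : Isomorphic G G'' :=
  isomorphic_iff.2 ((isomorphic_iff.1 h).trans_isomorphic h')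

theorem BigonAt.symm (h : G.BigonAt v w) : G.BigonAt w v := by
  obtain ⟨hne, h, k, h', k', vh, vk, hhk, hkh, vh', vk', hkh', e, e'⟩ := h
  refine ⟨hne.symm, h', k', h, k, vh', vk', ?_, hkh', vh, vk, hkh, ?_, ?_⟩
  · rintro rfl
    exact hhk (Sum.inl_injective (G.edge_injective (e.trans e'.symm)))
  · rw [← e, G.edge_edge]
  · rw [← e', G.edge_edge]

/-- A bigon disjoint from the erased crossings is still there after erasing. -/
theorem ErasesVia.bigonAt {f : G'.Crossing ↪ G.Crossing} {g : G'.HalfEdge ↪ G.HalfEdge}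
    (R : G.ErasesVia S G' f g) {v w : G'.Crossing} (hb : G.BigonAt (f v) (f w)) :
    G'.BigonAt v w := by
  obtain ⟨hne, h, k, h', k', vh, vk, hhk, hkh, vh', vk', hkh', e, e'⟩ := hb
  obtain ⟨h, rfl⟩ := R.exists_halfEdge (h := h) (by rw [vh]; exact R.notMem _)
  obtain ⟨k, rfl⟩ := R.exists_halfEdge (h := k) (by rw [vk]; exact R.notMem _)
  obtain ⟨h', rfl⟩ := R.exists_halfEdge (h := h') (by rw [vh']; exact R.notMem _)
  obtain ⟨k', rfl⟩ := R.exists_halfEdge (h := k') (by rw [vk']; exact R.notMem _)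
  rw [R.vert] at vh vk vh' vk'
  refine ⟨fun e => hne (by rw [e]), h, k, h', k', f.injective vh, f.injective vk,
    fun e => hhk (by rw [e]), fun e => hkh (by rw [R.opp, e]), f.injective vh', f.injective vk',
    fun e => hkh' (by rw [R.opp, e]), R.edge_eq ?_, R.edge_eq ?_⟩
  · rw [Sum.map_inl, e]; exact run_refl _
  · rw [Sum.map_inl, e']; exact run_refl _

theorem Isomorphic.reidemeisterTwo (h : Isomorphic G G') (h2 : ReidemeisterTwo G' H) :
    ReidemeisterTwo G H := by
  obtain ⟨v, w, hb, hE⟩ := h2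
  obtain ⟨f, g, R⟩ := erases_iff.1 (isomorphic_iff.1 h)
  obtain ⟨f2, g2, R2⟩ := erases_iff.1 hE
  have he : ∀ x, G.edge (Sum.map g id x) = Sum.map g id (G'.edge x) := fun x =>
    (Out.eq_of_run (S := ∅) (fun _ _ h => h) (R.run x)).symm
  refine ⟨f v, f w, ?_, erases_iff.2 ⟨_, _, R.trans R2 (by rw [Set.empty_union, Set.image_pair])⟩⟩
  obtain ⟨hne, h, k, h', k', rfl, vk, hhk, hkh, rfl, vk', hkh', e, e'⟩ := hb
  refine ⟨fun e => hne (f.injective e), g h, g k, g h', g k', R.vert h, by rw [R.vert, vk],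
    fun e => hhk (g.injective e), fun e => hkh (g.injective (by rw [e, R.opp])), R.vert h',
    by rw [R.vert, vk'], fun e => hkh' (g.injective (by rw [e, R.opp])), ?_, ?_⟩
  · have := he (Sum.inl h)
    rwa [e] at this
  · have := he (Sum.inl k)
    rwa [e'] at this

/-- Disjoint bigons can be removed in any order. -/
theorem BigonAt.exists_of_disjoint (h2 : G.BigonAt x y)
    (hx : x ∉ ({v, w} : Set G.Crossing)) (hy : y ∉ ({v, w} : Set G.Crossing))
    (R1 : G.Erases {v, w} G') : ∃ H, ReidemeisterTwo G' H ∧ G.Erases {v, w, x, y} H := by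
  obtain ⟨f, g, R⟩ := erases_iff.1 R1
  obtain ⟨x, rfl⟩ := R.exists_crossing hx
  obtain ⟨y, rfl⟩ := R.exists_crossing hy
  obtain ⟨f', g', R'⟩ := erase_erasesVia G' {x, y}
  refine ⟨_, ⟨x, y, R.bigonAt h2, erases_iff.2 ⟨f', g', R'⟩⟩,
    erases_iff.2 ⟨_, _, R.trans R' ?_⟩⟩
  rw [Set.image_pair]
  ext z
  simp only [Set.mem_insert_iff, Set.mem_singleton_iff, Set.mem_union]
  tauto

/-- If two bigons have the crossing of `h` and `k` in common, it does not matter which of them is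
removed: the strands through `h` and `k` meet three crossings in succession, and
only one of these is left. -/
theorem ErasesVia.of_bigons {h h' k k' l' m' : G.HalfEdge}
    (e1 : G.edge (Sum.inl h) = Sum.inl h') (e2 : G.edge (Sum.inl k) = Sum.inl k')
    (e3 : G.edge (Sum.inl (G.opp h)) = Sum.inl l')
    (e4 : G.edge (Sum.inl (G.opp k)) = Sum.inl m')
    (vh : G.vert h = v) (vk : G.vert k = v) (vh' : G.vert h' = w) (vk' : G.vert k' = w)
    (vl' : G.vert l' = y) (vm' : G.vert m' = y)
    (n1 : k ≠ h) (n2 : k ≠ G.opp h) (n3 : k' ≠ h') (n4 : k' ≠ G.opp h') (n5 : m' ≠ l')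
    (n6 : m' ≠ G.opp l') (hvw : v ≠ w) (hvy : v ≠ y) (hwy : w ≠ y)
    {f : G'.Crossing ↪ G.Crossing} {g : G'.HalfEdge ↪ G.HalfEdge}
    (R : G.ErasesVia {v, w} G' f g) : G.Erases {v, y} G' := by
  classical
  have e1' : G.edge (Sum.inl h') = Sum.inl h := by rw [← e1, G.edge_edge]
  have e2' : G.edge (Sum.inl k') = Sum.inl k := by rw [← e2, G.edge_edge]
  have e3' : G.edge (Sum.inl l') = Sum.inl (G.opp h) := by rw [← e3, G.edge_edge]
  have e4' : G.edge (Sum.inl m') = Sum.inl (G.opp k) := by rw [← e4, G.edge_edge]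
  have vo := G.vert_opp
  have oo := G.opp_opp
  have hne : ∀ x y, G.vert x ≠ G.vert y → x ≠ y := fun x y h e => h (by rw [e])
  have hyw := hwy.symm
  -- The matching `τ` interchanges `w` and `y`, sliding each along the two strands through `v`.
  obtain ⟨τ, ⟨t1, t2, t3, t4⟩, ⟨t5, t6, t7, t8⟩, t9⟩ := exists_swap_two_pairs (G := G)
    (x := l') (y := G.opp h') (z := m') (w := G.opp k')
    (hne _ _ (by rw [vo, vh', vl']; exact hwy)) (hne _ _ (by rw [vo, vh', vo, vl']; exact hwy))
    (hne _ _ (by rw [vo, vk', vm']; exact hwy)) (hne _ _ (by rw [vo, vk', vo, vm']; exact hwy))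
    n5.symm (fun e => n6 (by rw [e, oo])) (hne _ _ (by rw [vo, vk', vl']; exact hyw))
    (hne _ _ (by rw [vo, vo, vk', vl']; exact hyw)) (hne _ _ (by rw [vo, vh', vm']; exact hwy))
    (hne _ _ (by rw [vo, vh', vo, vm']; exact hwy)) (fun e => n3 (G.opp_injective e).symm)
    (by rw [oo]; exact n4.symm)
  rw [oo] at t3 t4 t7 t8
  simp only [oo] at t9
  have t10 : ∀ u, G.vert u ≠ w → G.vert u ≠ y → τ u = u := fun u hw hy =>
    t9 u (hne _ _ (by rwa [vl'])) (hne _ _ (by rwa [vo, vl'])) (hne _ _ (by rwa [vo, vh']))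
      (hne _ _ (by rwa [vh'])) (hne _ _ (by rwa [vm'])) (hne _ _ (by rwa [vo, vm']))
      (hne _ _ (by rwa [vo, vk'])) (hne _ _ (by rwa [vk']))
  have cw : ∀ u, G.vert u = w → u = h' ∨ u = G.opp h' ∨ u = k' ∨ u = G.opp k' := fun u hu =>
    eq_of_vert_eq (vk'.trans vh'.symm) n3 n4 (hu.trans vh'.symm)
  have cy : ∀ u, G.vert u = y → u = l' ∨ u = G.opp l' ∨ u = m' ∨ u = G.opp m' := fun u hu =>
    eq_of_vert_eq (vm'.trans vl'.symm) n5 n6 (hu.trans vl'.symm)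
  have cv : ∀ u, G.vert u = v → u = h ∨ u = G.opp h ∨ u = k ∨ u = G.opp k := fun u hu =>
    eq_of_vert_eq (vk.trans vh.symm) n1 n2 (hu.trans vh.symm)
  have ψw : Equiv.swap w y w = y := Equiv.swap_apply_left _ _
  have ψy : Equiv.swap w y y = w := Equiv.swap_apply_right _ _
  have ψo : ∀ c, c ≠ w → c ≠ y → Equiv.swap w y c = c := fun c => Equiv.swap_apply_of_ne_of_ne
  have hτv : ∀ u, G.vert (τ u) = Equiv.swap w y (G.vert u) := by
    intro u
    by_cases hw : G.vert u = w
    · rcases cw u hw with e | e | e | e <;> rw [e]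
      · rw [t4, vo, vl', vh', ψw]
      · rw [t2, vl', vo, vh', ψw]
      · rw [t8, vo, vm', vk', ψw]
      · rw [t6, vm', vo, vk', ψw]
    · by_cases hy : G.vert u = y
      · rcases cy u hy with e | e | e | e <;> rw [e]
        · rw [t1, vo, vh', vl', ψy]
        · rw [t3, vh', vo, vl', ψy]
        · rw [t5, vo, vk', vm', ψy]
        · rw [t7, vk', vo, vm', ψy]
      · rw [t10 u hw hy, ψo _ hw hy]
  have hτo : ∀ u, G.opp (τ u) = τ (G.opp u) := by
    intro u
    by_cases hw : G.vert u = w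
    · rcases cw u hw with e | e | e | e <;> rw [e]
      · rw [t4, oo, t2]
      · rw [t2, oo, t4]
      · rw [t8, oo, t6]
      · rw [t6, oo, t8]
    · by_cases hy : G.vert u = y
      · rcases cy u hy with e | e | e | e <;> rw [e]
        · rw [t1, oo, t3]
        · rw [t3, oo, t1]
        · rw [t5, oo, t7]
        · rw [t7, oo, t5]
      · rw [t10 u hw hy, t10 _ (by rwa [vo]) (by rwa [vo])]
  have hψ : ∀ c, Equiv.swap w y c ∈ ({v, y} : Set G.Crossing) ↔ c ∈ ({v, w} : Set G.Crossing) := by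
    intro c
    by_cases hw : c = w
    · rw [hw, ψw]; simp
    · by_cases hy : c = y
      · rw [hy, ψy]
        simp only [Set.mem_insert_iff, Set.mem_singleton_iff]
        exact iff_of_false (by rintro (e | e); exacts [hvw e.symm, hwy e])
          (by rintro (e | e); exacts [hvy e.symm, hyw e])
      · rw [ψo c hw hy]
        simp [hw, hy]
  have sv : ∀ u, G.vert u = v → G.vert u ∈ ({v, w} : Set G.Crossing) := fun u hu => Or.inl hu
  have sw : ∀ u, G.vert u = w → G.vert u ∈ ({v, w} : Set G.Crossing) := fun u hu => Or.inr hu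
  have sv' : ∀ u, G.vert u = v → G.vert u ∈ ({v, y} : Set G.Crossing) := fun u hu => Or.inl hu
  have sy' : ∀ u, G.vert u = y → G.vert u ∈ ({v, y} : Set G.Crossing) := fun u hu => Or.inr hu
  have outy : ∀ u, G.vert u = y → G.Out ({v, w} : Set G.Crossing) (Sum.inl u) := by
    intro u hu
    rw [out_inl, hu]
    rintro (e | e)
    exacts [hvy e.symm, hyw e]
  have step : ∀ {T : Set G.Crossing} {p q : G.HalfEdge} {z : G.Dart}, G.vert p ∈ T →
      G.edge (Sum.inl (G.opp p)) = Sum.inl q → G.Run T (Sum.inl q) z → G.Run T (Sum.inl p) z :=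
    fun hp e r => Run.cons hp (by rwa [e])
  -- The half-edges of the two bigons; runs are compared from one dart outside `I` to the next.
  let I : Set G.HalfEdge := {h, k, h', k', G.opp h, G.opp k, l', m'}
  have hIe : ∀ u ∈ I, ∃ u' ∈ I, G.edge (Sum.inl u) = Sum.inl u' := by
    rintro u (e | e | e | e | e | e | e | (e : u = m')) <;> rw [e]
    exacts [⟨h', by simp [I], e1⟩, ⟨k', by simp [I], e2⟩, ⟨h, by simp [I], e1'⟩,
      ⟨k, by simp [I], e2'⟩, ⟨l', by simp [I], e3⟩, ⟨m', by simp [I], e4⟩,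
      ⟨G.opp h, by simp [I], e3'⟩, ⟨G.opp k, by simp [I], e4'⟩]
  let Z : Set G.Dart := {z | ∀ u ∈ I, z ≠ Sum.inl u}
  have hZe : ∀ u, u ∉ I → G.edge (Sum.inl u) ∈ Z := by
    intro u hu j hj e
    obtain ⟨i, hi, e'⟩ := hIe j hj
    rw [← e, G.edge_edge] at e'
    exact hu (Sum.inl_injective e' ▸ hi)
  have hI : ∀ u, G.vert u ≠ v → u ≠ h' → u ≠ k' → u ≠ l' → u ≠ m' → u ∉ I := by
    rintro u hv a1 a2 a3 a4 (e | e | e | e | e | e | e | (e : u = m'))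
    exacts [hv (by rw [e, vh]), hv (by rw [e, vk]), a1 e, a2 e, hv (by rw [e, vo, vh]),
      hv (by rw [e, vo, vk]), a3 e, a4 e]
  have i1 : G.opp h' ∉ I := hI _ (by rw [vo, vh']; exact hvw.symm) (G.opp_ne _) n4.symm
    (hne _ _ (by rw [vo, vh', vl']; exact hwy)) (hne _ _ (by rw [vo, vh', vm']; exact hwy))
  have i2 : G.opp k' ∉ I := hI _ (by rw [vo, vk']; exact hvw.symm)
    (fun e => n4 (by rw [← e, oo])) (G.opp_ne _)
    (hne _ _ (by rw [vo, vk', vl']; exact hwy)) (hne _ _ (by rw [vo, vk', vm']; exact hwy))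
  have i3 : G.opp l' ∉ I := hI _ (by rw [vo, vl']; exact hvy.symm)
    (hne _ _ (by rw [vo, vl', vh']; exact hyw)) (hne _ _ (by rw [vo, vl', vk']; exact hyw))
    (G.opp_ne _) n6.symm
  have i4 : G.opp m' ∉ I := hI _ (by rw [vo, vm']; exact hvy.symm)
    (hne _ _ (by rw [vo, vm', vh']; exact hyw)) (hne _ _ (by rw [vo, vm', vk']; exact hyw))
    (fun e => n6 (by rw [← e, oo])) (G.opp_ne _)
  have hZ : ∀ z ∈ Z, ∃ z', G.Out ({v, w} : Set G.Crossing) z' ∧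
      G.Run ({v, w} : Set G.Crossing) z z' ∧
      G.Run ({v, y} : Set G.Crossing) (id z) (Sum.map τ id z') := by
    rintro (u | e) hz
    · have hu : u ∉ I := fun hi => hz u hi rfl
      by_cases hv : G.vert u = v
      · exact absurd (by rcases cv u hv with e | e | e | e <;> simp [I, e]) hu
      · by_cases hw : G.vert u = w
        · rcases cw u hw with e | e | e | e
          · exact absurd (by simp [I, e]) hu
          · refine ⟨Sum.inl l', outy _ vl', ?_, ?_⟩
            · rw [e]
              exact step (sw _ (by rw [vo, vh'])) (by rw [oo, e1']) (step (sv _ vh) e3 (run_refl _))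
            · rw [Sum.map_inl, t1, e]; exact run_refl _
          · exact absurd (by simp [I, e]) hu
          · refine ⟨Sum.inl m', outy _ vm', ?_, ?_⟩
            · rw [e]
              exact step (sw _ (by rw [vo, vk'])) (by rw [oo, e2']) (step (sv _ vk) e4 (run_refl _))
            · rw [Sum.map_inl, t5, e]; exact run_refl _
        · by_cases hy : G.vert u = y
          · rcases cy u hy with e | e | e | e
            · exact absurd (by simp [I, e]) hu
            · refine ⟨Sum.inl u, outy _ hy, run_refl _, ?_⟩
              rw [Sum.map_inl, e, t3]
              exact step (sy' _ (by rw [vo, vl'])) (by rw [oo, e3'])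
                (step (sv' _ (by rw [vo, vh])) (by rw [oo, e1]) (run_refl _))
            · exact absurd (by simp [I, e]) hu
            · refine ⟨Sum.inl u, outy _ hy, run_refl _, ?_⟩
              rw [Sum.map_inl, e, t7]
              exact step (sy' _ (by rw [vo, vm'])) (by rw [oo, e4'])
                (step (sv' _ (by rw [vo, vk])) (by rw [oo, e2]) (run_refl _))
          · refine ⟨Sum.inl u, out_inl.2 ?_, run_refl _, ?_⟩
            · rintro (e | e)
              exacts [hv e, hw e]
            · rw [Sum.map_inl, t10 u hw hy]; exact run_refl _
    · exact ⟨Sum.inr e, out_inr, run_refl _, run_refl _⟩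
  have hstart : ∀ x, G.Out ({v, w} : Set G.Crossing) x → ∃ z ∈ Z,
      G.Run ({v, w} : Set G.Crossing) (G.edge x) z ∧
        G.Run ({v, y} : Set G.Crossing) (G.edge (Sum.map τ id x)) (id z) := by
    rintro (u | e) hx
    · have hu : G.vert u ∉ ({v, w} : Set G.Crossing) := out_inl.1 hx
      have hv : G.vert u ≠ v := fun e => hu (Or.inl e)
      have hw : G.vert u ≠ w := fun e => hu (Or.inr e)
      by_cases hy : G.vert u = y
      · rcases cy u hy with e | e | e | e <;> rw [e, Sum.map_inl]
        · refine ⟨_, hZe _ i1, ?_, ?_⟩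
          · rw [e3']
            exact step (sv _ (by rw [vo, vh])) (by rw [oo, e1]) (Run.cons (sw _ vh') (run_refl _))
          · rw [t1]; exact run_refl _
        · refine ⟨_, hZe _ i3, run_refl _, ?_⟩
          rw [t3, e1']
          exact step (sv' _ vh) e3 (Run.cons (sy' _ vl') (run_refl _))
        · refine ⟨_, hZe _ i2, ?_, ?_⟩
          · rw [e4']
            exact step (sv _ (by rw [vo, vk])) (by rw [oo, e2]) (Run.cons (sw _ vk') (run_refl _))
          · rw [t5]; exact run_refl _
        · refine ⟨_, hZe _ i4, run_refl _, ?_⟩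
          rw [t7, e2']
          exact step (sv' _ vk) e4 (Run.cons (sy' _ vm') (run_refl _))
      · refine ⟨_, hZe u (hI u hv (hne _ _ (by rwa [vh'])) (hne _ _ (by rwa [vk']))
          (hne _ _ (by rwa [vl'])) (hne _ _ (by rwa [vm']))), run_refl _, ?_⟩
        rw [Sum.map_inl, t10 u hw hy]
        exact run_refl _
    · refine ⟨G.edge (Sum.inr e), ?_, run_refl _, run_refl _⟩
      intro j hj e'
      obtain ⟨i, hi, e2⟩ := hIe j hj
      rw [← e', G.edge_edge] at e2
      cases e2
  exact erases_iff.2 ⟨_, _, R.transfer (Equiv.swap w y) τ hψ (fun u => by rw [hτv, hψ])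
    (fun u _ => hτv u) (fun u _ => hτo u)
    (fun p q hp hq r => Run.transfer (fun z hz => Or.inl (hZ z hz)) hstart hp hq r)⟩

/-- Removing either of two different bigons with a common crossing gives the same result. -/
theorem BigonAt.isomorphic_of_common (h1 : G.BigonAt v w) (h2 : G.BigonAt v y) (hwy : w ≠ y)
    (R1 : G.Erases {v, w} G') (R2 : G.Erases {v, y} G'') : Isomorphic G' G'' := by
  obtain ⟨f, g, R⟩ := erases_iff.1 R1
  refine Erases.isomorphic ?_ R2
  obtain ⟨hvw, h, k, h', k', vh, vk, hhk, hkh, vh', vk', n4, e1, e2⟩ := h1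
  obtain ⟨hvy, l, m, l', m', vl, vm, hlm, -, vl', vm', n6, e3, e4⟩ := h2
  have n3 : k' ≠ h' := by
    rintro rfl
    exact hhk (Sum.inl_injective (G.edge_injective (e1.trans e2.symm)))
  have n5 : m' ≠ l' := by
    rintro rfl
    exact hlm (Sum.inl_injective (G.edge_injective (e3.trans e4.symm)))
  -- The edges at `h` and `k` lead to `w`, and those at `l` and `m` to `y`.
  have hcase : ∀ {p p'}, G.vert p = v → G.edge (Sum.inl p) = Sum.inl p' → G.vert p' = y →
      p = G.opp h ∨ p = G.opp k := by
    intro p p' hp e hy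
    rcases eq_of_vert_eq (vk.trans vh.symm) hhk.symm hkh (hp.trans vh.symm) with a | a | a | a
    · rw [a, e1] at e
      exact absurd (by rw [← vh', Sum.inl_injective e, hy]) hwy
    · exact Or.inl a
    · rw [a, e2] at e
      exact absurd (by rw [← vk', Sum.inl_injective e, hy]) hwy
    · exact Or.inr a
  rcases hcase vl e3 vl' with rfl | rfl <;> rcases hcase vm e4 vm' with rfl | rfl
  · exact absurd rfl hlm
  · exact R.of_bigons e1 e2 e3 e4 vh vk vh' vk' vl' vm' hhk.symm hkh n3 n4 n5 n6 hvw hvy hwy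
  · exact R.of_bigons e1 e2 e4 e3 vh vk vh' vk' vm' vl' hhk.symm hkh n3 n4 n5.symm
      (fun e => n6 (by rw [e, G.opp_opp])) hvw hvy hwy
  · exact absurd rfl hlm

/-- Confluence: two decreasing second moves on the same graph lead to isomorphic graphs, or to
graphs from which one further such move leads to the same graph. -/
theorem ReidemeisterTwo.confluent (h1 : ReidemeisterTwo G G') (h2 : ReidemeisterTwo G G'') :
    Isomorphic G' G'' ∨ ∃ H, ReidemeisterTwo G' H ∧ ReidemeisterTwo G'' H := by
  obtain ⟨v, w, b1, R1⟩ := h1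
  obtain ⟨x, y, b2, R2⟩ := h2
  have R1' := R1
  have R2' := R2
  rw [Set.pair_comm] at R1' R2'
  by_cases hvx : v = x
  · subst hvx
    by_cases hwy : w = y
    · subst hwy; exact Or.inl (R1.isomorphic R2)
    · exact Or.inl (b1.isomorphic_of_common b2 hwy R1 R2)
  · by_cases hvy : v = y
    · subst hvy
      by_cases hwx : w = x
      · subst hwx; exact Or.inl (R1.isomorphic R2')
      · exact Or.inl (b1.isomorphic_of_common b2.symm hwx R1 R2')
    · by_cases hwx : w = x
      · subst hwx
        exact Or.inl (b1.symm.isomorphic_of_common b2 hvy R1' R2)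
      · by_cases hwy : w = y
        · subst hwy
          exact Or.inl (b1.symm.isomorphic_of_common b2.symm hvx R1' R2')
        · obtain ⟨H, hH, hE⟩ := b2.exists_of_disjoint
            (by rintro (e | e); exacts [hvx e.symm, hwx e.symm])
            (by rintro (e | e); exacts [hvy e.symm, hwy e.symm]) R1
          obtain ⟨H', hH', hE'⟩ := b1.exists_of_disjoint
            (by rintro (e | e); exacts [hvx e, hvy e])
            (by rintro (e | e); exacts [hwx e, hwy e]) R2
          refine Or.inr ⟨H, hH, ?_⟩
          obtain ⟨x', y', b, R⟩ := hH'
          refine ⟨x', y', b, R.trans_isomorphic (hE'.isomorphic ?_)⟩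
          have e : ({x, y, v, w} : Set G.Crossing) = {v, w, x, y} := by
            ext z
            simp only [Set.mem_insert_iff, Set.mem_singleton_iff]
            tauto
          rwa [e]

/-- The graph reduces to `K`, up to isomorphism, by decreasing second moves. -/
inductive ReducesTo (K : LongFramedGraph.{u}) : LongFramedGraph.{u} → Prop
  | base (G : LongFramedGraph.{u}) : Isomorphic G K → ReducesTo K G
  | step (G G' : LongFramedGraph.{u}) : ReidemeisterTwo G G' → ReducesTo K G' → ReducesTo K G

theorem NoDecreasingSecondMove.not_reidemeisterTwo (hG : G.NoDecreasingSecondMove) :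
    ¬ ReidemeisterTwo G G' := by
  rintro ⟨v, w, hb, -⟩
  exact hG v w hb

/-- By confluence, an irreducible graph determines a class of graphs closed under second moves in
both directions. -/
theorem secondMoveInvariant_reducesTo {K : LongFramedGraph.{u}}
    (hK : K.NoDecreasingSecondMove) : SecondMoveInvariant (ReducesTo K) := by
  have iso : ∀ H H', Isomorphic H H' → ReducesTo K H → ReducesTo K H' := by
    intro H H' h r
    cases r with
    | base _ h' => exact .base _ (h.symm.trans h')
    | step _ H1 h2 r => exact .step _ H1 (h.symm.reidemeisterTwo h2) r
  refine ⟨iso, fun H H' h => ⟨fun r => ?_, fun r => .step _ _ h r⟩⟩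
  induction r generalizing H' with
  | base H h' => exact absurd (h'.symm.reidemeisterTwo h) hK.not_reidemeisterTwo
  | step H H1 h1 r ih =>
    rcases h1.confluent h with h2 | ⟨H2, h2, h3⟩
    · exact iso _ _ h2 r
    · exact .step _ _ h3 (ih _ h2)

end

/-! ### Long free knots -/

theorem reverse_noDecreasingSecondMove {G : LongFramedGraph.{u}} (h : G.NoDecreasingSecondMove) :
    G.reverse.NoDecreasingSecondMove := by
  rintro v w ⟨hne, h1, k, h', k', vh, vk, n1, n2, vh', vk', n3, e, e'⟩
  exact h v w ⟨hne, h1, k, h', k', vh, vk, n1, n2, vh', vk', n3, edge_inl_of_reverse G e,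
    edge_inl_of_reverse G e'⟩

end LongFramedGraph

/-- The bracket is an invariant of long free knots. -/
theorem LongKnotGraph.bracket_eq_of_mk_eq {Φ : LongFramedGraph.{u} → Prop}
    (hΦ : LongFramedGraph.SecondMoveInvariant Φ) {K K' : LongKnotGraph.{u}}
    (h : LongFreeKnot.mk K = LongFreeKnot.mk K') :
    LongFramedGraph.bracket Φ K.toLongFramedGraph =
      LongFramedGraph.bracket Φ K'.toLongFramedGraph :=
  congrArg (Quot.lift (fun K : LongKnotGraph.{u} => LongFramedGraph.bracket Φ K.toLongFramedGraph)
    fun K _ h => LongFramedGraph.bracket_move hΦ K.oneComponent h) h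

theorem mainTheorem3 (K : LongKnotGraph.{u})
    (hodd : ∀ c : K.Crossing, K.IsOddCrossing c)
    (hred : K.NoDecreasingSecondMove)
    (hrev : ¬ LongFramedGraph.Isomorphic K.toLongFramedGraph K.reverse.toLongFramedGraph) :
    ¬ (LongFreeKnot.mk K).Invertible := by
  intro hinv
  have hΦ := LongFramedGraph.secondMoveInvariant_reducesTo hred
  have hK : K.evenCrossings = ∅ :=
    Set.eq_empty_of_forall_notMem fun c => K.oneComponent.notMem_evenCrossings (hodd c)
  have hK' : K.reverse.evenCrossings = ∅ :=
    (LongFramedGraph.OneComponent.evenCrossings_reverse K.oneComponent).trans hK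
  have h1 := (LongFramedGraph.bracket_of_evenCrossings_eq_empty hΦ.iso K.oneComponent hK).2
    (.base _ (LongFramedGraph.Isomorphic.refl _))
  have h2 : LongFreeKnot.mk K.reverse = LongFreeKnot.mk K := hinv
  rw [← LongKnotGraph.bracket_eq_of_mk_eq hΦ h2,
    LongFramedGraph.bracket_of_evenCrossings_eq_empty hΦ.iso K.reverse.oneComponent hK'] at h1
  cases h1 with
  | base _ h => exact hrev h.symm
  | step _ _ h _ =>
    exact (LongFramedGraph.reverse_noDecreasingSecondMove hred).not_reidemeisterTwo h
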